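/- \textbf{Conventions.} Let $G$ be a group. An \emph{involution} of $G$ is an element of order exactly $2$; let $I_G$ be the set of involutions and $I_G^{(2)}=\{(u,v)\in I_G^2 : u\neq v\}$, and let $G$ act on both by conjugation. A subgroup $H\le G$ is \emph{malnormal} if $H\cap gHg^{-1}$ is trivial for every $g\in G\setminus H$, and \emph{quasi-malnormal} if $|H\cap gHg^{-1}|\le 2$ for every $g\in G\setminus H$. Let $D_{\mathbb Z}=\mathbb Z/2\mathbb Z\ltimes\mathbb Z$ and $D_{\mathbb Q}=\mathbb Z/2\mathbb Z\ltimes\mathbb Q$, where the generator of $\mathbb Z/2\mathbb Z$ acts by $x\mapsto -x$. A pair $(u,v)\in I_G^{(2)}$ is \emph{of type $D_{\mathbb Z}$} if $\langle u,v\rangle$ is contained in a quasi-malnormal subgroup of $G$ isomorphic to $D_{\mathbb Z}$, and \emph{of type $D_{\mathbb Q}$} if $\langle u,v\rangle$ is contained in a subgroup of $G$ isomorphic to $D_{\mathbb Q}$. An element $h\in G$ of infinite order is a \emph{translation} if it is the product of two distinct involutions, a \emph{homothety} if it centralizes some involution, and \emph{isolated} if it is contained in a malnormal cyclic subgroup of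 $G$. The group $G$ belongs to the class $\mathcal C$ if (1) $G$ acts transitively on $I_G$ and freely on $I_G^{(2)}$; (2) every pair in $I_G^{(2)}$ is of type $D_{\mathbb Z}$ or of type $D_{\mathbb Q}$; (3) the set of pairs in $I_G^{(2)}$ of type $D_{\mathbb Q}$ is non-empty and $G$ acts transitively on it. It belongs to the class $\mathcal C'$ if moreover every element of $G$ has order $1$, $2$ or $\infty$, and every element of infinite order is a translation, a homothety or isolated. The group $G$ is \emph{sharply 2-transitive} if it acts on some set $X$ with at least two elements such that for all $(x_1,x_2),(y_1,y_2)\in X^2$ with $x_1\ne x_2$ and $y_1\neq y_2$ there is a unique $g\in G$ with $gx_1=y_1$ and $gx_2=y_2$. \textbf{Theorem.} Let $G_0$ be a countable group belonging to $\mathcal C'$. Then there exist a countable group $G$ and an injective homomorphism $G_0\to G$ such that \begin{itemize} \item $G$ is sharply 2-transitive and belongs to $\mathcal C'$; \item $G$ has exactly four conjugacy classes: $\{1\}$, the set of involutions, the set of translations and the set of homotheties; \item $G$ is simple. \end{itemize} -/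

import Mathlib

universe u

namespace SharpTwo

/-- The generalized dihedral group `ℤ/2 ⋉ A` of an additive abelian group `A`: the group
`ℤˣ = {1, -1}` of order two acts on `A` by `a ↦ ± a`. -/
abbrev Dih (A : Type) [AddCommGroup A] : Type :=
  Multiplicative A ⋊[((MulAutMultiplicative A).symm.toMonoidHom).comp
    (DistribMulAction.toAddAut ℤˣ A)] ℤˣ

section Group

variable {G : Type u} [Group G]

/-- The conjugate subgroup `g H g⁻¹`. -/
def conjSubgroup (g : G) (H : Subgroup G) : Subgroup G :=
  H.map (MulAut.conj g).toMonoidHom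

/-- `H` is malnormal: `H ∩ g H g⁻¹` is trivial for every `g ∉ H`. -/
def Malnormal (H : Subgroup G) : Prop :=
  ∀ g : G, g ∉ H → H ⊓ conjSubgroup g H = ⊥

/-- `H` is quasi-malnormal: `H ∩ g H g⁻¹` has at most two elements for every `g ∉ H`. -/
def QuasiMalnormal (H : Subgroup G) : Prop :=
  ∀ g : G, g ∉ H → ((H ⊓ conjSubgroup g H : Subgroup G) : Set G).encard ≤ 2

/-- An involution is an element of order exactly two. -/
def IsInvolution (x : G) : Prop := orderOf x = 2

/-- Ordered pairs of distinct involutions. -/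
def IsInvolutionPair (x y : G) : Prop := IsInvolution x ∧ IsInvolution y ∧ x ≠ y

/-- The pair `(x, y)` is of type `D_ℤ`: the subgroup generated by `x` and `y` is contained in a
quasi-malnormal infinite dihedral subgroup. -/
def IsTypeDZ (x y : G) : Prop :=
  ∃ D : Subgroup G, Subgroup.closure {x, y} ≤ D ∧ Nonempty (D ≃* Dih ℤ) ∧ QuasiMalnormal D

/-- The pair `(x, y)` is of type `D_ℚ`: the subgroup generated by `x` and `y` is contained in a
subgroup isomorphic to `D_ℚ`. -/
def IsTypeDQ (x y : G) : Prop :=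
  ∃ D : Subgroup G, Subgroup.closure {x, y} ≤ D ∧ Nonempty (D ≃* Dih ℚ)

/-- A translation: an element of infinite order that is a product of two distinct involutions. -/
def IsTranslation (h : G) : Prop :=
  ¬ IsOfFinOrder h ∧ ∃ x y : G, IsInvolutionPair x y ∧ h = x * y

/-- A homothety: an element of infinite order that centralizes some involution. -/
def IsHomothety (h : G) : Prop :=
  ¬ IsOfFinOrder h ∧ ∃ x : G, IsInvolution x ∧ h * x = x * h

/-- An isolated element: an element of infinite order contained in a malnormal cyclic subgroup. -/
def IsIsolated (h : G) : Prop :=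
  ¬ IsOfFinOrder h ∧ ∃ k : G, h ∈ Subgroup.zpowers k ∧ Malnormal (Subgroup.zpowers k)

end Group

section Classes

variable (G : Type u) [Group G]

/-- The class `𝒞`. -/
structure ClassC : Prop where
  /-- `G` acts transitively by conjugation on its involutions. -/
  transitive_involutions : ∀ x y : G, IsInvolution x → IsInvolution y → ∃ g : G, g * x * g⁻¹ = y
  /-- `G` acts freely by conjugation on the ordered pairs of distinct involutions. -/
  free_pairs : ∀ x y : G, IsInvolutionPair x y →
    ∀ g : G, g * x * g⁻¹ = x → g * y * g⁻¹ = y → g = 1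
  /-- Each pair of distinct involutions is of one of the two types. -/
  type_pairs : ∀ x y : G, IsInvolutionPair x y → IsTypeDZ x y ∨ IsTypeDQ x y
  /-- There is a pair of distinct involutions of type `D_ℚ`. -/
  exists_typeDQ : ∃ x y : G, IsInvolutionPair x y ∧ IsTypeDQ x y
  /-- `G` acts transitively by conjugation on the pairs of type `D_ℚ`. -/
  transitive_typeDQ : ∀ x y x' y' : G, IsInvolutionPair x y → IsTypeDQ x y →
    IsInvolutionPair x' y' → IsTypeDQ x' y' → ∃ g : G, g * x * g⁻¹ = x' ∧ g * y * g⁻¹ = y'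

/-- The 3-type condition: each element has order `1`, `2` or `∞`, and each element of infinite
order is a translation, a homothety or isolated. -/
def ThreeType : Prop :=
  (∀ h : G, orderOf h = 1 ∨ orderOf h = 2 ∨ ¬ IsOfFinOrder h) ∧
    ∀ h : G, ¬ IsOfFinOrder h → IsTranslation h ∨ IsHomothety h ∨ IsIsolated h

/-- The class `𝒞'`. -/
def ClassC' : Prop := ClassC G ∧ ThreeType G

/-- `G` is sharply 2-transitive: it has an action on a set `X` with at least two elements such that
any ordered pair of distinct points is mapped to any other one by exactly one element of `G`.
(Such an `X` is a `G`-orbit, so that it may be taken in the universe of `G`.) -/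
def IsSharplyTwoTransitive : Prop :=
  ∃ (X : Type u) (_ : MulAction G X), Nontrivial X ∧
    ∀ x₁ x₂ y₁ y₂ : X, x₁ ≠ x₂ → y₁ ≠ y₂ → ∃! g : G, g • x₁ = y₁ ∧ g • x₂ = y₂

end Classes

end SharpTwo

/-!
The group `G` is the union of a countable chain of HNN extensions, each of which forces one more
pair of elements to behave as in the limit.

*HNN extensions acting on trees.* An HNN extension `Γ` of `G₀` acts on its Bass–Serre tree
(`HNN.tree`). Elements of finite order, and pairs of involutions whose product fixes a vertex, are
conjugate into `G₀`. Any other element translates an axis (`TreeAction.exists_line`). If the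
pointwise stabilizer of the axis is trivial, then its setwise stabilizer is either a quasi-malnormal
infinite dihedral group or a malnormal infinite cyclic group. If some nontrivial element fixes the
axis pointwise, the conditions `HNN.Admissible` on the associated subgroups require an involution
which commutes with all elements translating the axis: these are homotheties. So `Γ` inherits from
`G₀` the class `𝒞'` (`HNN.classC'`), and its new elements of infinite order are translations,
homotheties or isolated.

*The extensions used.* There are two sources of admissible data. In the first one
(`HNN.admissible_of_quasiMalnormal`) one associated subgroup is quasi-malnormal and the other one
lies in a subgroup `D_ℚ`: conjugating a quasi-malnormal `D_ℤ` into `D_ℚ` turns pairs of type `D_ℤ`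
into pairs of type `D_ℚ`, and conjugating a malnormal cyclic subgroup into `D_ℚ` turns isolated
elements into translations. In the second one (`HNN.admissible_of_centralizer`) both associated
subgroups lie in the centralizer of an involution `x` which the stable letter centralizes: with
associated subgroups `⟨x, h⟩` and `⟨x, k⟩` this makes the homotheties `h` and `k` conjugate, and
with both equal to `⟨x⟩` it creates homotheties.

*The union.* Enumerating pairs of elements and treating one at each step, one obtains a union in
which all pairs of involutions have type `D_ℚ`, no element is isolated and all homotheties are
conjugate (`exists_saturated`). There `G` acts sharply 2-transitively on its involutions by
conjugation, and its conjugacy classes are the four announced ones. For simplicity, the chain is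
started with a group in which some homothety is a product of two translations
(`exists_extension_isHomothety`). A nontrivial normal subgroup always contains a translation, hence
all of them, hence this homothety and all others, hence all involutions.
-/

namespace SharpTwo

/-! ### Infinite dihedral groups -/

namespace Dih

variable {A : Type} [AddCommGroup A]

/-- The rotation of `Dih A` with parameter `a`. -/
def rot (a : A) : Dih A := ⟨Multiplicative.ofAdd a, 1⟩

/-- The reflection of `Dih A` with parameter `a`. -/
def refl (a : A) : Dih A := ⟨Multiplicative.ofAdd a, -1⟩

theorem eq_rot_or_refl (d : Dih A) : (∃ a, d = rot a) ∨ ∃ a, d = refl a := by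
  obtain ⟨a, e⟩ := d
  rcases Int.units_eq_one_or e with rfl | rfl
  · exact Or.inl ⟨a.toAdd, rfl⟩
  · exact Or.inr ⟨a.toAdd, rfl⟩

theorem mk_mul_mk (a b : A) (e f : ℤˣ) :
    (⟨Multiplicative.ofAdd a, e⟩ : Dih A) * ⟨Multiplicative.ofAdd b, f⟩ =
      ⟨Multiplicative.ofAdd (a + e • b), e * f⟩ := rfl

theorem rot_mul_rot (a b : A) : rot a * rot b = rot (a + b) := by
  simp only [rot, mk_mul_mk, one_smul, mul_one]

theorem rot_mul_refl (a b : A) : rot a * refl b = refl (a + b) := by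
  simp only [rot, refl, mk_mul_mk, one_smul, one_mul]

theorem refl_mul_rot (a b : A) : refl a * rot b = refl (a - b) := by
  simp only [rot, refl, mk_mul_mk, mul_one, Units.neg_smul, one_smul, sub_eq_add_neg]

theorem refl_mul_refl (a b : A) : refl a * refl b = rot (a - b) := by
  simp only [rot, refl, mk_mul_mk, neg_mul_neg, mul_one, Units.neg_smul, one_smul, sub_eq_add_neg]

theorem rot_zero : rot (0 : A) = 1 := rfl

theorem rot_injective : Function.Injective (rot : A → Dih A) := fun a b h => by
  simpa [rot] using congrArg SemidirectProduct.left h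

theorem refl_injective : Function.Injective (refl : A → Dih A) := fun a b h => by
  simpa [refl] using congrArg SemidirectProduct.left h

theorem rot_ne_refl (a b : A) : rot a ≠ refl b := fun h => by
  have := congrArg SemidirectProduct.right h
  simp [rot, refl] at this

theorem rot_pow (a : A) (n : ℕ) : rot a ^ n = rot (n • a) := by
  induction n with
  | zero => simp [rot_zero]
  | succ k ih => rw [pow_succ, ih, rot_mul_rot, succ_nsmul]

theorem not_isOfFinOrder_rot [IsAddTorsionFree A] {a : A} (ha : a ≠ 0) :
    ¬ IsOfFinOrder (rot a) := by
  rw [isOfFinOrder_iff_pow_eq_one]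
  rintro ⟨n, hn, h⟩
  rw [rot_pow, ← rot_zero] at h
  have := rot_injective h
  simp [ha, hn.ne'] at this

theorem orderOf_refl (a : A) : orderOf (refl a) = 2 := by
  rw [orderOf_eq_prime_iff]
  refine ⟨by rw [pow_two, refl_mul_refl, sub_self, rot_zero], fun h => ?_⟩
  rw [← rot_zero] at h
  exact rot_ne_refl _ _ h.symm

end Dih

section Basics

variable {G : Type u} [Group G]

theorem IsInvolution.mul_self {x : G} (h : IsInvolution x) : x * x = 1 := by
  rw [← pow_two, ← pow_orderOf_eq_one x, h]

theorem IsInvolution.inv {x : G} (h : IsInvolution x) : x⁻¹ = x :=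
  inv_eq_of_mul_eq_one_left h.mul_self

theorem IsInvolution.ne_one {x : G} (h : IsInvolution x) : x ≠ 1 := by
  rintro rfl
  simp [IsInvolution] at h

theorem isInvolution_iff {x : G} : IsInvolution x ↔ x * x = 1 ∧ x ≠ 1 := by
  rw [IsInvolution, orderOf_eq_prime_iff, pow_two]

theorem IsInvolution.isOfFinOrder {x : G} (h : IsInvolution x) : IsOfFinOrder x :=
  orderOf_pos_iff.1 (by rw [h]; norm_num)

theorem IsInvolution.map {H : Type*} [Group H] {f : G →* H} (hf : Function.Injective f) {x : G} :
    IsInvolution (f x) ↔ IsInvolution x := by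
  rw [isInvolution_iff, isInvolution_iff, ← map_mul, map_eq_one_iff f hf, Ne, map_eq_one_iff f hf]

theorem isInvolution_conj (g : G) {x : G} : IsInvolution (g * x * g⁻¹) ↔ IsInvolution x :=
  IsInvolution.map (f := (MulAut.conj g).toMonoidHom) (MulAut.conj g).injective

theorem isOfFinOrder_conj (g : G) {x : G} : IsOfFinOrder (g * x * g⁻¹) ↔ IsOfFinOrder x :=
  (MulAut.conj g).injective.isOfFinOrder_iff (f := (MulAut.conj g).toMonoidHom)

theorem isInvolutionPair_map {H : Type*} [Group H] {f : G →* H} (hf : Function.Injective f)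
    {x y : G} : IsInvolutionPair (f x) (f y) ↔ IsInvolutionPair x y := by
  rw [IsInvolutionPair, IsInvolutionPair, IsInvolution.map hf, IsInvolution.map hf, hf.ne_iff]

theorem isInvolutionPair_conj (g : G) {x y : G} :
    IsInvolutionPair (g * x * g⁻¹) (g * y * g⁻¹) ↔ IsInvolutionPair x y :=
  isInvolutionPair_map (f := (MulAut.conj g).toMonoidHom) (MulAut.conj g).injective

theorem mem_conjSubgroup {g h : G} {H : Subgroup G} : h ∈ conjSubgroup g H ↔ g⁻¹ * h * g ∈ H := by
  rw [conjSubgroup, Subgroup.mem_map]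
  constructor
  · rintro ⟨x, hx, rfl⟩
    simpa [mul_assoc] using hx
  · intro hx
    exact ⟨_, hx, by simp [mul_assoc]⟩

theorem IsTranslation.map {H : Type*} [Group H] {f : G →* H} (hf : Function.Injective f) {h : G}
    (hh : IsTranslation h) : IsTranslation (f h) := by
  obtain ⟨h1, x, y, hxy, rfl⟩ := hh
  exact ⟨by rwa [hf.isOfFinOrder_iff], f x, f y, (isInvolutionPair_map hf).2 hxy, map_mul _ _ _⟩

theorem IsHomothety.map {H : Type*} [Group H] {f : G →* H} (hf : Function.Injective f) {h : G}
    (hh : IsHomothety h) : IsHomothety (f h) := by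
  obtain ⟨h1, x, hx, hc⟩ := hh
  exact ⟨by rwa [hf.isOfFinOrder_iff], f x, (IsInvolution.map hf).2 hx, by
    rw [← map_mul, hc, map_mul]⟩

theorem IsTypeDQ.map {H : Type*} [Group H] {f : G →* H} (hf : Function.Injective f) {x y : G}
    (hh : IsTypeDQ x y) : IsTypeDQ (f x) (f y) := by
  obtain ⟨D, hD, ⟨e⟩⟩ := hh
  refine ⟨D.map f, ?_, ⟨(D.equivMapOfInjective f hf).symm.trans e⟩⟩
  rw [Subgroup.closure_le] at hD ⊢
  rintro _ (rfl | rfl)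
  · exact Subgroup.mem_map_of_mem f (hD (by simp))
  · exact Subgroup.mem_map_of_mem f (hD (by simp))

theorem IsTranslation.conj (g : G) {h : G} (hh : IsTranslation h) : IsTranslation (g * h * g⁻¹) :=
  hh.map (f := (MulAut.conj g).toMonoidHom) (MulAut.conj g).injective

theorem IsHomothety.conj (g : G) {h : G} (hh : IsHomothety h) : IsHomothety (g * h * g⁻¹) :=
  hh.map (f := (MulAut.conj g).toMonoidHom) (MulAut.conj g).injective

theorem IsTypeDQ.conj (g : G) {x y : G} (hh : IsTypeDQ x y) :
    IsTypeDQ (g * x * g⁻¹) (g * y * g⁻¹) :=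
  hh.map (f := (MulAut.conj g).toMonoidHom) (MulAut.conj g).injective

theorem IsTranslation.of_conj (g : G) {h : G} (hh : IsTranslation (g * h * g⁻¹)) :
    IsTranslation h := by
  simpa [mul_assoc] using hh.conj g⁻¹

theorem not_isOfFinOrder_zpow {h : G} (hh : ¬ IsOfFinOrder h) {n : ℤ} (hn : n ≠ 0) :
    ¬ IsOfFinOrder (h ^ n) := by
  rw [← injective_zpow_iff_not_isOfFinOrder] at hh ⊢
  intro a b hab
  simp only [← zpow_mul] at hab
  exact mul_left_cancel₀ hn (hh hab)

theorem IsTranslation.zpow {h : G} (hh : IsTranslation h) {n : ℤ} (hn : n ≠ 0) :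
    IsTranslation (h ^ n) := by
  obtain ⟨h1, x, y, hxy, rfl⟩ := hh
  have h2 : ¬ IsOfFinOrder ((x * y) ^ n) := not_isOfFinOrder_zpow h1 hn
  have hyy := hxy.2.1.mul_self
  have hinv : y * (x * y) ^ n * y = ((x * y) ^ n)⁻¹ := by
    have h3 := conj_zpow (i := n) (a := y) (b := x * y)
    rw [hxy.2.1.inv] at h3
    rw [← h3, ← inv_zpow]
    congr 1
    rw [mul_inv_rev, hxy.1.inv, hxy.2.1.inv]
    simp [mul_assoc, hyy]
  refine ⟨h2, (x * y) ^ n * y, y, ⟨isInvolution_iff.2 ⟨?_, fun h => ?_⟩, hxy.2.1, fun h => ?_⟩, ?_⟩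
  · rw [mul_assoc, ← mul_assoc y, hinv, mul_inv_cancel]
  · apply h2
    rw [eq_inv_of_mul_eq_one_left h, hxy.2.1.inv]
    exact hxy.2.1.isOfFinOrder
  · apply h2
    rw [mul_eq_right.1 h]
    exact IsOfFinOrder.one
  · rw [mul_assoc, hyy, mul_one]

/-! ### Dihedral subgroups -/

section Dihedral

variable {A : Type} [AddCommGroup A] {E : Subgroup G}

theorem coe_injective (e : E ≃* Dih A) :
    Function.Injective (E.subtype.comp e.symm.toMonoidHom) :=
  Subtype.val_injective.comp e.symm.injective

theorem isInvolution_coe_refl (e : E ≃* Dih A) (a : A) :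
    IsInvolution (e.symm (Dih.refl a) : G) :=
  (IsInvolution.map (coe_injective e)).2 (Dih.orderOf_refl a)

theorem exists_rot_of_infinite (e : E ≃* Dih A) {h : G} (hE : h ∈ E) (hh : ¬ IsOfFinOrder h) :
    ∃ a : A, a ≠ 0 ∧ h = e.symm (Dih.rot a) := by
  rcases Dih.eq_rot_or_refl (e ⟨h, hE⟩) with ⟨a, ha⟩ | ⟨a, ha⟩
  · refine ⟨a, ?_, by rw [← ha]; simp⟩
    rintro rfl
    rw [Dih.rot_zero, EmbeddingLike.map_eq_one_iff] at ha
    have : h = 1 := congrArg Subtype.val ha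
    exact hh (this ▸ IsOfFinOrder.one)
  · refine absurd ?_ hh
    have h1 : IsOfFinOrder (e.toMonoidHom ⟨h, hE⟩) := by
      change IsOfFinOrder (e ⟨h, hE⟩)
      rw [ha]; exact IsInvolution.isOfFinOrder (Dih.orderOf_refl a)
    rw [e.injective.isOfFinOrder_iff (f := e.toMonoidHom)] at h1
    exact Submonoid.isOfFinOrder_coe.2 h1

theorem exists_refl_of_isInvolution [IsAddTorsionFree A] (e : E ≃* Dih A) {h : G}
    (hE : h ∈ E) (hh : IsInvolution h) :
    ∃ a : A, h = e.symm (Dih.refl a) := by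
  rcases Dih.eq_rot_or_refl (e ⟨h, hE⟩) with ⟨a, ha⟩ | ⟨a, ha⟩
  · have h1 : IsOfFinOrder (e.toMonoidHom ⟨h, hE⟩) := by
      rw [e.injective.isOfFinOrder_iff (f := e.toMonoidHom)]
      exact Submonoid.isOfFinOrder_coe.1 hh.isOfFinOrder
    by_cases h0 : a = 0
    · subst h0
      rw [Dih.rot_zero, EmbeddingLike.map_eq_one_iff] at ha
      exact absurd (congrArg Subtype.val ha) hh.ne_one
    · change IsOfFinOrder (e ⟨h, hE⟩) at h1
      rw [ha] at h1
      exact absurd h1 (Dih.not_isOfFinOrder_rot h0)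
  · exact ⟨a, by rw [← ha]; simp⟩

theorem not_isOfFinOrder_coe_rot [IsAddTorsionFree A] (e : E ≃* Dih A) {a : A} (ha : a ≠ 0) :
    ¬ IsOfFinOrder (e.symm (Dih.rot a) : G) := by
  have := (coe_injective e).isOfFinOrder_iff (x := Dih.rot a)
  exact fun h => Dih.not_isOfFinOrder_rot ha (this.1 h)

/-- In a dihedral group over a torsion-free group, the product of two distinct involutions has
infinite order. -/
theorem not_isOfFinOrder_mul_of_mem [IsAddTorsionFree A] (e : E ≃* Dih A) {u v : G}
    (hu : u ∈ E) (hv : v ∈ E)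
    (h : IsInvolutionPair u v) : ¬ IsOfFinOrder (u * v) := by
  obtain ⟨a, rfl⟩ := exists_refl_of_isInvolution e hu h.1
  obtain ⟨b, rfl⟩ := exists_refl_of_isInvolution e hv h.2.1
  rw [← Subgroup.coe_mul, ← map_mul, Dih.refl_mul_refl]
  apply not_isOfFinOrder_coe_rot
  rw [sub_ne_zero]
  rintro rfl
  exact h.2.2 rfl

/-- Each element of infinite order of a dihedral subgroup is the product of two distinct involutions
of the subgroup. -/
theorem exists_involutions_of_infinite (e : E ≃* Dih A) {h : G} (hE : h ∈ E)
    (hh : ¬ IsOfFinOrder h) : ∃ u ∈ E, ∃ v ∈ E, IsInvolutionPair u v ∧ h = u * v := by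
  obtain ⟨a, ha, rfl⟩ := exists_rot_of_infinite e hE hh
  refine ⟨_, (e.symm (Dih.refl a)).2, _, (e.symm (Dih.refl 0)).2,
    ⟨isInvolution_coe_refl e a, isInvolution_coe_refl e 0, fun h => ha ?_⟩, ?_⟩
  · exact Dih.refl_injective (coe_injective e h)
  · rw [← Subgroup.coe_mul, ← map_mul, Dih.refl_mul_refl, sub_zero]

theorem isTranslation_of_mem (e : E ≃* Dih A) {h : G} (hE : h ∈ E)
    (hh : ¬ IsOfFinOrder h) : IsTranslation h := by
  obtain ⟨u, -, v, -, h1, h2⟩ := exists_involutions_of_infinite e hE hh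
  exact ⟨hh, u, v, h1, h2⟩

theorem conj_eq_or_of_infinite (e : E ≃* Dih A) {h k : G} (hE : h ∈ E) (kE : k ∈ E)
    (hh : ¬ IsOfFinOrder h) : k⁻¹ * h * k = h ∨ k⁻¹ * h * k = h⁻¹ := by
  obtain ⟨a, -, rfl⟩ := exists_rot_of_infinite e hE hh
  have hk : k = e.symm (e ⟨k, kE⟩) := by simp
  rw [hk]
  simp only [← Subgroup.coe_mul, ← Subgroup.coe_inv, ← map_mul, ← map_inv, SetLike.coe_eq_coe,
    EmbeddingLike.apply_eq_iff_eq]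
  rw [map_inv]
  rcases Dih.eq_rot_or_refl (e ⟨k, kE⟩) with ⟨b, hb⟩ | ⟨b, hb⟩
  · left
    rw [hb, mul_assoc, inv_mul_eq_iff_eq_mul, Dih.rot_mul_rot, Dih.rot_mul_rot, add_comm]
  · right
    rw [hb, mul_assoc, inv_mul_eq_iff_eq_mul, eq_mul_inv_iff_mul_eq, Dih.rot_mul_refl,
      Dih.refl_mul_rot]
    congr 1
    abel

end Dihedral

/-! ### Groups in the class `𝒞` -/

section ClassC

theorem mem_of_closure_le {x y : G} {D : Subgroup G} (h : Subgroup.closure {x, y} ≤ D) :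
    x ∈ D ∧ y ∈ D :=
  ⟨h (Subgroup.subset_closure (by simp)), h (Subgroup.subset_closure (by simp))⟩

theorem ClassC.not_isOfFinOrder_mul (hG : ClassC G) {u v : G} (h : IsInvolutionPair u v) :
    ¬ IsOfFinOrder (u * v) := by
  rcases hG.type_pairs u v h with ⟨D, hD, ⟨e⟩, -⟩ | ⟨D, hD, ⟨e⟩⟩
  · exact not_isOfFinOrder_mul_of_mem e (mem_of_closure_le hD).1 (mem_of_closure_le hD).2 h
  · exact not_isOfFinOrder_mul_of_mem e (mem_of_closure_le hD).1 (mem_of_closure_le hD).2 h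

/-- If products of distinct involutions have infinite order, then commuting involutions
are equal. -/
theorem eq_of_commute (hG : ∀ u v : G, IsInvolutionPair u v → ¬ IsOfFinOrder (u * v)) {u v : G}
    (hu : IsInvolution u) (hv : IsInvolution v) (h : u * v = v * u) : u = v := by
  by_contra hne
  refine hG u v ⟨hu, hv, hne⟩ (isOfFinOrder_iff_pow_eq_one.2 ⟨2, by norm_num, ?_⟩)
  have h' : Commute u v := h
  rw [h'.mul_pow, pow_two, pow_two, hu.mul_self, hv.mul_self, mul_one]

theorem ClassC.eq_of_commute (hG : ClassC G) {u v : G}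
    (hu : IsInvolution u) (hv : IsInvolution v) (h : u * v = v * u) : u = v :=
  SharpTwo.eq_of_commute (fun _ _ => hG.not_isOfFinOrder_mul) hu hv h

/-- Translations are not homotheties. If `u * v` commutes with an involution `w`, then
`u` and `v` both exchange `w` and `u * w * u`, so that `u * v` fixes this pair. -/
theorem ClassC.not_commute_of_isTranslation (hG : ClassC G) {h w : G} (hh : IsTranslation h)
    (hw : IsInvolution w) : h * w ≠ w * h := by
  obtain ⟨hf, u, v, huv, rfl⟩ := hh
  intro hc
  have hu := huv.1.mul_self
  have hv := huv.2.1.mul_self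
  have hui := huv.1.inv
  have hvi := huv.2.1.inv
  -- both involutions conjugate `w` to the same involution
  have h1 : u * w * u = v * w * v := by
    calc u * w * u = u * (w * (u * v)) * v := by simp [mul_assoc, hv]
      _ = v * w * v := by rw [← hc]; simp [← mul_assoc, hu]
  by_cases h2 : u * w * u = w
  · have h3 : u * w = w * u := by
      calc u * w = u * w * u * u := by simp [mul_assoc, hu]
        _ = w * u := by rw [h2]
    have h4 : v * w = w * v := by
      calc v * w = v * w * v * v := by simp [mul_assoc, hv]
        _ = w * v := by rw [← h1, h2]
    exact huv.2.2 ((hG.eq_of_commute huv.1 hw h3).trans (hG.eq_of_commute huv.2.1 hw h4).symm)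
  · have h3 : IsInvolution (u * w * u) := by
      have := (isInvolution_conj u).2 hw
      rwa [hui] at this
    have h4 := hG.free_pairs w (u * w * u) ⟨hw, h3, fun h => h2 h.symm⟩ (u * v)
      (by rw [hc, mul_assoc, mul_inv_cancel, mul_one])
      (by
        rw [mul_inv_rev, hui, hvi]
        calc u * v * (u * w * u) * (v * u) = u * v * (v * w * v) * (v * u) := by rw [h1]
          _ = u * (v * v) * w * (v * v) * u := by simp only [mul_assoc]
          _ = u * w * u := by simp [hv])
    exact hf (h4 ▸ IsOfFinOrder.one)

theorem ClassC.not_isHomothety_of_isTranslation (hG : ClassC G) {h : G} (hh : IsTranslation h) :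
    ¬ IsHomothety h := fun ⟨_, _, hw, hc⟩ => hG.not_commute_of_isTranslation hh hw hc

/-- A nontrivial element with two commuting involutions: freeness makes the involution unique. -/
theorem ClassC.involution_unique (hG : ClassC G) {h w w' : G} (h1 : h ≠ 1) (hw : IsInvolution w)
    (hw' : IsInvolution w') (hc : h * w = w * h) (hc' : h * w' = w' * h) : w = w' := by
  by_contra hne
  refine h1 (hG.free_pairs w w' ⟨hw, hw', hne⟩ h ?_ ?_)
  · rw [hc, mul_assoc, mul_inv_cancel, mul_one]
  · rw [hc', mul_assoc, mul_inv_cancel, mul_one]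

theorem Malnormal.mem {H : Subgroup G} (hH : Malnormal H) {g h : G} (h1 : h ∈ H)
    (h2 : g⁻¹ * h * g ∈ H) (h3 : h ≠ 1) : g ∈ H := by
  by_contra hg
  have : h ∈ H ⊓ conjSubgroup g H := ⟨h1, mem_conjSubgroup.2 h2⟩
  rw [hH g hg] at this
  exact h3 (Subgroup.mem_bot.1 this)

theorem QuasiMalnormal.mem {H : Subgroup G} (hH : QuasiMalnormal H) {g h : G} (h1 : h ∈ H)
    (h2 : g⁻¹ * h * g ∈ H) (h3 : ¬ IsOfFinOrder h) : g ∈ H := by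
  by_contra hg
  have h4 : h ∈ H ⊓ conjSubgroup g H := ⟨h1, mem_conjSubgroup.2 h2⟩
  have h5 : ((H ⊓ conjSubgroup g H : Subgroup G) : Set G).Finite :=
    Set.finite_of_encard_le_coe (k := 2) (hH g hg)
  have : Finite (H ⊓ conjSubgroup g H : Subgroup G) := h5
  exact h3 (Submonoid.isOfFinOrder_coe.2 (isOfFinOrder_of_finite (⟨h, h4⟩ :
    (H ⊓ conjSubgroup g H : Subgroup G))))

theorem Malnormal.quasiMalnormal {H : Subgroup G} (hH : Malnormal H) : QuasiMalnormal H := by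
  intro g hg
  rw [hH g hg]
  simp

/-- A nontrivial periodic subgroup of a group whose elements have order `1`, `2` or `∞`, and
in which products of distinct involutions have infinite order, has order two. -/
theorem eq_of_periodic (h1 : ∀ h : G, orderOf h = 1 ∨ orderOf h = 2 ∨ ¬ IsOfFinOrder h)
    (h2 : ∀ u v : G, IsInvolutionPair u v → ¬ IsOfFinOrder (u * v)) {K : Subgroup G}
    (hK : ∀ h ∈ K, IsOfFinOrder h) {u v : G} (hu : u ∈ K) (hv : v ∈ K) (hu1 : u ≠ 1)
    (hv1 : v ≠ 1) : IsInvolution u ∧ u = v := by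
  have key : ∀ w ∈ K, w ≠ 1 → IsInvolution w := fun w hw hw1 => by
    rcases h1 w with h | h | h
    · exact absurd (orderOf_eq_one_iff.1 h) hw1
    · exact h
    · exact absurd (hK w hw) h
  refine ⟨key u hu hu1, ?_⟩
  by_contra hne
  exact h2 u v ⟨key u hu hu1, key v hv hv1, hne⟩ (hK _ (K.mul_mem hu hv))

/-- In a group as in `eq_of_periodic`, quasi-malnormality need only be tested on elements of
infinite order. -/
theorem quasiMalnormal_of (h1 : ∀ h : G, orderOf h = 1 ∨ orderOf h = 2 ∨ ¬ IsOfFinOrder h)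
    (h2 : ∀ u v : G, IsInvolutionPair u v → ¬ IsOfFinOrder (u * v)) {H : Subgroup G}
    (hH : ∀ g h : G, h ∈ H → g⁻¹ * h * g ∈ H → ¬ IsOfFinOrder h → g ∈ H) : QuasiMalnormal H := by
  intro g hg
  have hK : ∀ h ∈ H ⊓ conjSubgroup g H, IsOfFinOrder h := fun h hh => by
    by_contra hf
    exact hg (hH g h hh.1 (mem_conjSubgroup.1 hh.2) hf)
  by_cases h : ∃ w ∈ H ⊓ conjSubgroup g H, w ≠ 1
  · obtain ⟨w, hw, hw1⟩ := h
    refine (Set.encard_le_encard (t := {1, w}) fun v hv => ?_).trans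
      (Set.encard_insert_le _ _ |>.trans (by simp; norm_num))
    by_cases hv1 : v = 1
    · exact Or.inl hv1
    · exact Or.inr (eq_of_periodic h1 h2 hK hw hv hw1 hv1).2.symm
  · push Not at h
    refine (Set.encard_le_encard (t := {1, 1}) fun v hv => ?_).trans
      (Set.encard_insert_le _ _ |>.trans (by simp; norm_num))
    exact Or.inl (h v hv)

theorem malnormal_of {H : Subgroup G}
    (hH : ∀ g h : G, h ∈ H → g⁻¹ * h * g ∈ H → h ≠ 1 → g ∈ H) : Malnormal H := by
  intro g hg
  rw [Subgroup.eq_bot_iff_forall]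
  intro h hh
  by_contra h1
  exact hg (hH g h hh.1 (mem_conjSubgroup.1 hh.2) h1)

theorem QuasiMalnormal.conj (h1 : ∀ h : G, orderOf h = 1 ∨ orderOf h = 2 ∨ ¬ IsOfFinOrder h)
    (h2 : ∀ u v : G, IsInvolutionPair u v → ¬ IsOfFinOrder (u * v)) {H : Subgroup G}
    (hH : QuasiMalnormal H) (d : G) : QuasiMalnormal (conjSubgroup d H) := by
  refine quasiMalnormal_of h1 h2 fun g h hh hh' hf => ?_
  rw [mem_conjSubgroup] at hh hh' ⊢
  refine hH.mem hh (g := d⁻¹ * g * d) ?_ ?_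
  · convert hh' using 1
    group
  · have := isOfFinOrder_conj d⁻¹ (x := h)
    rw [inv_inv] at this
    rwa [this]

theorem nonempty_conjSubgroup_mulEquiv {A : Type*} [Group A] {H : Subgroup G}
    (e : H ≃* A) (d : G) : Nonempty (conjSubgroup d H ≃* A) :=
  ⟨(H.equivMapOfInjective _ (MulAut.conj d).injective).symm.trans e⟩

theorem conj_mem_conjSubgroup {d h : G} {H : Subgroup G} (hh : h ∈ H) :
    d * h * d⁻¹ ∈ conjSubgroup d H := Subgroup.mem_map_of_mem _ hh

theorem IsTypeDZ.conj (h1 : ∀ h : G, orderOf h = 1 ∨ orderOf h = 2 ∨ ¬ IsOfFinOrder h)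
    (h2 : ∀ u v : G, IsInvolutionPair u v → ¬ IsOfFinOrder (u * v)) {x y : G}
    (h : IsTypeDZ x y) (d : G) : IsTypeDZ (d * x * d⁻¹) (d * y * d⁻¹) := by
  obtain ⟨D, hD, ⟨e⟩, hq⟩ := h
  refine ⟨conjSubgroup d D, ?_, nonempty_conjSubgroup_mulEquiv e d, hq.conj h1 h2 d⟩
  rw [Subgroup.closure_le]
  rintro _ (rfl | rfl)
  · exact conj_mem_conjSubgroup (mem_of_closure_le hD).1
  · exact conj_mem_conjSubgroup (mem_of_closure_le hD).2

theorem IsIsolated.conj {h : G} (hh : IsIsolated h) (d : G) : IsIsolated (d * h * d⁻¹) := by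
  obtain ⟨hf, k, hk, hm⟩ := hh
  have key : ∀ x, x ∈ Subgroup.zpowers (d * k * d⁻¹) ↔ d⁻¹ * x * d ∈ Subgroup.zpowers k := by
    intro x
    simp only [Subgroup.mem_zpowers_iff, conj_zpow]
    refine exists_congr fun n => ?_
    rw [mul_inv_eq_iff_eq_mul, mul_assoc d⁻¹, eq_inv_mul_iff_mul_eq]
  refine ⟨by rwa [isOfFinOrder_conj], d * k * d⁻¹, ?_, malnormal_of fun g x hx hx' h1 => ?_⟩
  · rw [key]
    simpa [mul_assoc] using hk
  · rw [key] at hx hx' ⊢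
    refine hm.mem hx (g := d⁻¹ * g * d) ?_ ?_
    · convert hx' using 1
      group
    · intro h
      apply h1
      have := congrArg (fun z => d * z * d⁻¹) h
      simpa [mul_assoc] using this

/-- Nontrivial elements of an infinite cyclic group have infinite order. -/
theorem not_isOfFinOrder_of_mem_zpowers {k h : G} (hk : ¬ IsOfFinOrder k)
    (h1 : h ∈ Subgroup.zpowers k) (h2 : h ≠ 1) : ¬ IsOfFinOrder h := by
  obtain ⟨n, rfl⟩ := Subgroup.mem_zpowers_iff.1 h1
  have hn : n ≠ 0 := by rintro rfl; simp at h2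
  exact not_isOfFinOrder_zpow hk hn

theorem not_isOfFinOrder_of_mem_zpowers' {k h : G} (hh : ¬ IsOfFinOrder h)
    (h1 : h ∈ Subgroup.zpowers k) : ¬ IsOfFinOrder k := by
  obtain ⟨n, rfl⟩ := Subgroup.mem_zpowers_iff.1 h1
  exact fun h => hh h.zpow

/-- No involution normalizes the cyclic subgroup generated by an isolated element. -/
theorem not_normalize_of_isolated {h k u : G} (hh : ¬ IsOfFinOrder h)
    (h1 : h ∈ Subgroup.zpowers k) (h2 : Malnormal (Subgroup.zpowers k)) (hu : IsInvolution u)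
    (h3 : u⁻¹ * h * u ∈ Subgroup.zpowers k) : False :=
  not_isOfFinOrder_of_mem_zpowers (not_isOfFinOrder_of_mem_zpowers' hh h1)
    (h2.mem h1 h3 fun h => hh (h ▸ IsOfFinOrder.one)) hu.ne_one hu.isOfFinOrder

theorem IsIsolated.not_isTranslation {h : G} (hh : IsIsolated h) : ¬ IsTranslation h := by
  rintro ⟨-, x, y, hxy, rfl⟩
  obtain ⟨hf, k, h1, h2⟩ := hh
  refine not_normalize_of_isolated hf h1 h2 hxy.1 ?_
  have : x⁻¹ * (x * y) * x = (x * y)⁻¹ := by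
    rw [mul_inv_rev, hxy.1.inv, hxy.2.1.inv, ← mul_assoc, hxy.1.mul_self, one_mul]
  rw [this]
  exact inv_mem h1

theorem IsIsolated.not_isHomothety {h : G} (hh : IsIsolated h) : ¬ IsHomothety h := by
  rintro ⟨-, x, hx, hc⟩
  obtain ⟨hf, k, h1, h2⟩ := hh
  refine not_normalize_of_isolated hf h1 h2 hx ?_
  rw [mul_assoc, hc, inv_mul_cancel_left]
  exact h1

/-- A nontrivial element of the subgroup `ℚ` of a subgroup `D_ℚ` lies in no quasi-malnormal
infinite dihedral subgroup `E`: otherwise its centralizer, and so `ℚ`, would lie in `E`. -/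
theorem not_mem_quasiMalnormal {E D : Subgroup G} (hE : QuasiMalnormal E) (e : E ≃* Dih ℤ)
    (d : D ≃* Dih ℚ) {h : G} (hD : h ∈ D) (hh : ¬ IsOfFinOrder h) : h ∉ E := by
  intro h1
  obtain ⟨q, hq, rfl⟩ := exists_rot_of_infinite d hD hh
  have hmem : ∀ r : ℚ, (d.symm (Dih.rot r) : G) ∈ E := fun r => by
    refine hE.mem h1 ?_ hh
    have : ((d.symm (Dih.rot r) : G))⁻¹ * d.symm (Dih.rot q) * d.symm (Dih.rot r) =
        d.symm (Dih.rot q) := by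
      rw [mul_assoc, inv_mul_eq_iff_eq_mul]
      rw [← Subgroup.coe_mul, ← Subgroup.coe_mul, ← map_mul, ← map_mul, Dih.rot_mul_rot,
        Dih.rot_mul_rot, add_comm]
    rw [this]
    exact h1
  obtain ⟨a, ha, h2⟩ := exists_rot_of_infinite e h1 hh
  -- a root of order `2 * |a|` of `h` cannot exist in `E`
  set n : ℕ := 2 * a.natAbs with hn
  have hn0 : n ≠ 0 := by omega
  have hr : (q / n : ℚ) ≠ 0 := div_ne_zero hq (by exact_mod_cast hn0)
  obtain ⟨b, hb, h3⟩ := exists_rot_of_infinite e (hmem (q / n)) (not_isOfFinOrder_coe_rot d hr)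
  have h4 : (d.symm (Dih.rot (q / n)) : G) ^ n = d.symm (Dih.rot q) := by
    rw [← Subgroup.coe_pow, ← map_pow, Dih.rot_pow, nsmul_eq_mul, mul_div_cancel₀]
    exact_mod_cast hn0
  rw [h3, h2, ← Subgroup.coe_pow, ← map_pow, Dih.rot_pow] at h4
  have h5 := Dih.rot_injective (coe_injective e h4)
  rw [nsmul_eq_mul, hn] at h5
  have h6 := congrArg Int.natAbs h5
  rw [Int.natAbs_mul, Int.natAbs_natCast] at h6
  have h7 : 0 < b.natAbs := Int.natAbs_pos.2 hb
  nlinarith [Int.natAbs_pos.2 ha]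

/-- A quasi-malnormal subgroup contains each dihedral subgroup with which it shares an element of
infinite order. -/
theorem QuasiMalnormal.le_of_infinite {E D : Subgroup G} (hE : QuasiMalnormal E) {A : Type}
    [AddCommGroup A] (d : D ≃* Dih A) {h : G} (h1 : h ∈ E) (h2 : h ∈ D)
    (hh : ¬ IsOfFinOrder h) : D ≤ E := fun k hk => by
  refine hE.mem h1 ?_ hh
  rcases conj_eq_or_of_infinite d h2 hk hh with h | h
  · rw [h]; exact h1
  · rw [h]; exact inv_mem h1

end ClassC

end Basics

/-! ### Groups acting on trees -/

/-- An action of `Γ` on the vertices of a tree. The tree is encoded by its path metric `d`, which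
satisfies the four-point condition and has geodesics; the heights `ht`, translated by
the action, exclude inversions of edges. -/
structure TreeAction (Γ : Type*) (V : Type*) [Group Γ] [MulAction Γ V] where
  /-- The path metric. -/
  d : V → V → ℕ
  d_self : ∀ x, d x x = 0
  eq_of_d : ∀ x y, d x y = 0 → x = y
  d_comm : ∀ x y, d x y = d y x
  fourpt : ∀ x y z w, d x y + d z w ≤ d x z + d y w ∨ d x y + d z w ≤ d x w + d y z
  exists_step : ∀ x y, x ≠ y → ∃ z, d x z = 1 ∧ d z y + 1 = d x y
  d_smul : ∀ (g : Γ) x y, d (g • x) (g • y) = d x y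
  /-- The height of a vertex. -/
  ht : V → ℤ
  /-- The translation of heights by a group element. -/
  χ : Γ →* Multiplicative ℤ
  ht_step : ∀ x y, d x y = 1 → ht y = ht x + 1 ∨ ht y = ht x - 1
  ht_smul : ∀ (g : Γ) x, ht (g • x) = ht x + (χ g).toAdd

namespace TreeAction

variable {Γ : Type*} {V : Type*} [Group Γ] [MulAction Γ V] (T : TreeAction Γ V)

theorem triangle (x y z : V) : T.d x z ≤ T.d x y + T.d y z := by
  have h1 := T.fourpt x z y y
  have h2 := T.d_self y
  have h3 := T.d_comm y z
  omega

theorem d_pos {x y : V} (h : x ≠ y) : 0 < T.d x y :=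
  Nat.pos_of_ne_zero fun h0 => h (T.eq_of_d x y h0)

theorem exists_between (x y : V) (n : ℕ) (hn : n ≤ T.d x y) :
    ∃ z, T.d x z = n ∧ T.d x z + T.d z y = T.d x y := by
  induction n with
  | zero => exact ⟨x, T.d_self x, by simp [T.d_self]⟩
  | succ n ih =>
    obtain ⟨z, h1, h2⟩ := ih (by omega)
    have hz : z ≠ y := by
      rintro rfl
      have := T.d_self z
      omega
    obtain ⟨w, h3, h4⟩ := T.exists_step z y hz
    have h5 := T.triangle x z w
    have h6 := T.triangle x w y
    exact ⟨w, by omega, by omega⟩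

theorem eq_of_between {x y z w : V} (h1 : T.d x z + T.d z y = T.d x y) (h2 : T.d x w = T.d x z)
    (h3 : T.d w y = T.d z y) : z = w := by
  apply T.eq_of_d
  have h4 := T.fourpt x y z w
  have h5 := T.d_comm w y
  have h6 := T.d_comm z y
  omega

theorem smul_eq_of_between {x y z : V} (h1 : T.d x z + T.d z y = T.d x y) {g : Γ}
    (hx : g • x = x) (hy : g • y = y) : g • z = z := by
  refine (T.eq_of_between h1 ?_ ?_).symm
  · conv_lhs => rw [← hx]
    exact T.d_smul g x z
  · conv_lhs => rw [← hy]
    exact T.d_smul g z y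

theorem exists_parity (x y : V) : ∃ k : ℤ, (T.d x y : ℤ) = T.ht x - T.ht y + 2 * k := by
  induction h : T.d x y generalizing x with
  | zero =>
    obtain rfl := T.eq_of_d x y h
    exact ⟨0, by simp⟩
  | succ n ih =>
    have hne : x ≠ y := by
      rintro rfl
      have := T.d_self x
      omega
    obtain ⟨z, h1, h2⟩ := T.exists_step x y hne
    obtain ⟨k, hk⟩ := ih z (by omega)
    rcases T.ht_step x z h1 with h3 | h3
    · exact ⟨k + 1, by push_cast; omega⟩
    · exact ⟨k, by push_cast; omega⟩

theorem χ_mul (g h : Γ) : (T.χ (g * h)).toAdd = (T.χ g).toAdd + (T.χ h).toAdd := by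
  rw [map_mul, toAdd_mul]

theorem χ_eq_zero_of_mul_self {u : Γ} (hu : u * u = 1) : (T.χ u).toAdd = 0 := by
  have := T.χ_mul u u
  rw [hu, map_one, toAdd_one] at this
  omega

/-- If a product of two involutions fixes a vertex, then the involutions fix a common vertex,
the midpoint of the segment from `c` to `u • c`. -/
theorem exists_common_fixed (T : TreeAction Γ V) {u v : Γ} (hu : u * u = 1)
    (hv : v * v = 1) {c : V} (hc : (u * v) • c = c) : ∃ m : V, u • m = m ∧ v • m = m := by
  have h1 : v • c = u • c := by
    conv_rhs => rw [← hc]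
    rw [smul_smul, ← mul_assoc, hu, one_mul]
  have h2 : ∃ n, T.d c (u • c) = 2 * n := by
    obtain ⟨k, hk⟩ := T.exists_parity c (u • c)
    rw [T.ht_smul, T.χ_eq_zero_of_mul_self hu] at hk
    exact ⟨k.toNat, by omega⟩
  obtain ⟨n, hn⟩ := h2
  obtain ⟨m, hm1, hm2⟩ := T.exists_between c (u • c) n (by omega)
  have key : ∀ w : Γ, w * w = 1 → w • c = u • c → w • m = m := fun w hw hwc => by
    have e1 : T.d (w • c) (w • m) = T.d c m := T.d_smul w c m
    have e2 : T.d (w • (w • c)) (w • m) = T.d (w • c) m := T.d_smul w (w • c) m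
    rw [smul_smul, hw, one_smul, hwc] at e2
    rw [hwc] at e1
    have e3 := T.d_comm (u • c) m
    have e4 := T.d_comm (u • c) (w • m)
    exact (T.eq_of_between hm2 (by omega) (by omega)).symm
  exact ⟨m, key u hu rfl, key v hv h1⟩

/-! ### Axes of hyperbolic elements -/

/-- A bi-infinite geodesic. -/
def IsLine (p : ℤ → V) : Prop := ∀ i j, T.d (p i) (p j) = (i - j).natAbs

theorem d_pow_smul {g : Γ} {x : V} (h : T.d x (g • g • x) = 2 * T.d x (g • x))
    (hpos : 0 < T.d x (g • x)) (n : ℕ) :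
    T.d x (g ^ n • x) = n * T.d x (g • x) := by
  have shift : ∀ (k : ℕ) (y z : V), T.d (g ^ k • y) (g ^ k • z) = T.d y z :=
    fun k y z => T.d_smul _ y z
  have key : ∀ n, T.d x (g ^ n • x) = n * T.d x (g • x) ∧
      T.d x (g ^ (n + 1) • x) = (n + 1) * T.d x (g • x) := by
    intro n
    induction n with
    | zero => simp [T.d_self]
    | succ n ih =>
      refine ⟨by exact_mod_cast ih.2, ?_⟩
      have e1 : T.d (g ^ n • x) (g ^ (n + 1) • x) = T.d x (g • x) := by
        rw [pow_succ, mul_smul, shift]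
      have e2 : T.d (g ^ n • x) (g ^ (n + 1 + 1) • x) = 2 * T.d x (g • x) := by
        rw [pow_succ, pow_succ, mul_smul, mul_smul, shift, h]
      have e3 : T.d (g ^ (n + 1) • x) (g ^ (n + 1 + 1) • x) = T.d x (g • x) := by
        rw [pow_succ g (n + 1), mul_smul, shift]
      have f := T.fourpt x (g ^ (n + 1) • x) (g ^ n • x) (g ^ (n + 1 + 1) • x)
      have t := T.triangle x (g ^ (n + 1) • x) (g ^ (n + 1 + 1) • x)
      have c := T.d_comm (g ^ n • x) (g ^ (n + 1) • x)
      obtain ⟨i1, i2⟩ := ih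
      have m1 : (n + 1) * T.d x (g • x) = n * T.d x (g • x) + T.d x (g • x) := by ring
      have m2 : (n + 1 + 1) * T.d x (g • x) = n * T.d x (g • x) + 2 * T.d x (g • x) := by ring
      rw [m2]
      rw [m1] at i2
      omega
  exact (key n).1

/-- An element without fixed vertices is hyperbolic: a vertex with minimal displacement is moved
by the square twice as far. -/
theorem exists_hyperbolic {g : Γ} (hg : ∀ x : V, g • x ≠ x) [Nonempty V] :
    ∃ x : V, T.d x (g • g • x) = 2 * T.d x (g • x) := by
  obtain ⟨x, hx⟩ : ∃ x : V, ∀ y, T.d x (g • x) ≤ T.d y (g • y) := by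
    have := WellFounded.has_min (measure fun x : V => T.d x (g • x)).wf Set.univ
      Set.univ_nonempty
    obtain ⟨x, -, hx⟩ := this
    exact ⟨x, fun y => not_lt.1 (hx y trivial)⟩
  refine ⟨x, ?_⟩
  by_contra hne
  have hpos := T.d_pos (hg x).symm
  have s1 : T.d (g • x) (g • g • x) = T.d x (g • x) := T.d_smul _ _ _
  have hle : T.d x (g • g • x) + 2 ≤ 2 * T.d x (g • x) := by
    have t := T.triangle x (g • x) (g • g • x)
    obtain ⟨k, hk⟩ := T.exists_parity x (g • g • x)
    rw [T.ht_smul, T.ht_smul] at hk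
    omega
  by_cases h1 : T.d x (g • x) = 1
  · -- an element exchanging the ends of an edge would be an inversion
    obtain ⟨k, hk⟩ := T.exists_parity x (g • x)
    have h2 := T.eq_of_d x (g • g • x) (by omega)
    have h3 := congrArg T.ht h2
    rw [T.ht_smul, T.ht_smul] at h3
    rw [T.ht_smul] at hk
    omega
  · obtain ⟨y, hy1, hy2⟩ := T.exists_between x (g • x) 1 (by omega)
    obtain ⟨y', hy3, hy4⟩ := T.exists_between y (g • x) (T.d x (g • x) - 2) (by omega)
    have e1 : T.d (g • x) (g • y) = T.d x y := T.d_smul _ _ _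
    have e2 : T.d (g • y) (g • g • x) = T.d y (g • x) := T.d_smul _ _ _
    have f1 := T.fourpt (g • x) (g • g • x) x (g • y)
    have f2 := T.fourpt (g • x) x y' (g • y)
    have c1 := T.d_comm (g • x) x
    have c2 := T.d_comm (g • y) x
    have c3 := T.d_comm (g • g • x) x
    have c4 := T.d_comm (g • g • x) (g • y)
    have c5 := T.d_comm y' (g • x)
    have c6 := T.d_comm x y'
    have t1 := T.triangle x y y'
    have t2 := T.triangle x y' (g • x)
    have h2 := T.eq_of_d y' (g • y) (by omega)
    have h3 := hx y
    rw [← h2] at h3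
    omega

/-- A hyperbolic element translates a line, which is made up of the translates of a segment from a
vertex with minimal displacement to its image. -/
theorem exists_line {g : Γ} (hg : ∀ x : V, g • x ≠ x) [Nonempty V] :
    ∃ (p : ℤ → V) (L : ℤ), T.IsLine p ∧ 0 < L ∧ ∀ i, g • p i = p (i + L) := by
  obtain ⟨x, hx⟩ := T.exists_hyperbolic hg
  have hpos := T.d_pos (hg x).symm
  set L : ℕ := T.d x (g • x) with hL
  have hpow := T.d_pow_smul hx hpos
  have hz : ∀ n m : ℤ, (T.d (g ^ n • x) (g ^ m • x) : ℤ) = |(L : ℤ) * n - L * m| := by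
    have key : ∀ (n : ℤ) (k : ℕ), (T.d (g ^ n • x) (g ^ (n + k) • x) : ℤ) = L * k := fun n k => by
      rw [zpow_add, mul_smul, T.d_smul, zpow_natCast, hpow k, ← hL]
      push_cast
      ring
    intro n m
    rw [← mul_sub, abs_mul, Nat.abs_cast]
    rcases le_total n m with h | h
    · obtain ⟨k, rfl⟩ := Int.le.dest h
      rw [key]
      simp
    · obtain ⟨k, rfl⟩ := Int.le.dest h
      rw [T.d_comm, key]
      simp
  choose z hz1 hz2 using fun j : ℕ => fun h : j ≤ L => T.exists_between x (g • x) j h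
  have hLz : (0 : ℤ) < L := by exact_mod_cast hpos
  have hmod : ∀ i : ℤ, (i % L).toNat ≤ L := fun i => by
    have := Int.emod_lt_of_pos i hLz
    omega
  refine ⟨fun i => g ^ (i / L) • z (i % L).toNat (hmod i), L, ?_, hLz, ?_⟩
  · intro i j
    wlog hij : i ≤ j generalizing i j
    · rw [T.d_comm, this j i (by omega)]
      omega
    simp only
    have mi := Int.emod_nonneg i hLz.ne'
    have mj := Int.emod_nonneg j hLz.ne'
    have mi' := Int.emod_lt_of_pos i hLz
    have mj' := Int.emod_lt_of_pos j hLz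
    have di := Int.mul_ediv_add_emod i L
    have dj := Int.mul_ediv_add_emod j L
    have a1 := hz1 _ (hmod i)
    have a2 := hz2 _ (hmod i)
    have b1 := hz1 _ (hmod j)
    have b2 := hz2 _ (hmod j)
    set y := z (i % L).toNat (hmod i)
    set y' := z (j % L).toNat (hmod j)
    have sh : ∀ (n : ℤ) (a b : V), T.d (g ^ n • a) (g ^ n • b) = T.d a b :=
      fun n a b => T.d_smul _ a b
    have sx : ∀ n : ℤ, g ^ (n + 1) • x = g ^ n • (g • x) := fun n => by
      rw [zpow_add_one, mul_smul]
    have i1 := sh (i / L) x y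
    have i2 := sh (i / L) y (g • x)
    have j1 := sh (j / L) x y'
    have j2 := sh (j / L) y' (g • x)
    rw [← sx] at i2 j2
    have hdiv : i / L ≤ j / L := Int.ediv_le_ediv hLz hij
    rcases hdiv.eq_or_lt with heq | hlt
    · -- both points lie in the same translate of the segment from `x` to `g • x`
      rw [heq, sh]
      rw [heq] at di
      have f := T.fourpt x (g • x) y y'
      have t := T.triangle x y y'
      have c1 := T.d_comm (g • x) y
      have c2 := T.d_comm (g • x) y'
      omega
    · have q1 := hz (i / L) (j / L + 1)
      have q2 := hz (i / L + 1) (j / L)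
      have q0 : (L : ℤ) * (i / L) + L ≤ L * (j / L) := by
        have : (L : ℤ) * (i / L + 1) ≤ L * (j / L) := by gcongr; omega
        rwa [mul_add, mul_one] at this
      rw [mul_add, mul_one, abs_of_nonpos (by omega)] at q1 q2
      have t1 := T.triangle (g ^ (i / (L : ℤ)) • x) (g ^ (i / (L : ℤ)) • y)
        (g ^ (j / (L : ℤ) + 1) • x)
      have t2 := T.triangle (g ^ (i / (L : ℤ)) • y) (g ^ (j / (L : ℤ)) • y')
        (g ^ (j / (L : ℤ) + 1) • x)
      have t3 := T.triangle (g ^ (i / (L : ℤ)) • y) (g ^ (i / (L : ℤ) + 1) • x)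
        (g ^ (j / (L : ℤ)) • y')
      have t4 := T.triangle (g ^ (i / (L : ℤ) + 1) • x) (g ^ (j / (L : ℤ)) • x)
        (g ^ (j / (L : ℤ)) • y')
      omega
  · intro i
    simp only [smul_smul]
    have h1 : (i + L) / (L : ℤ) = 1 + i / L := by
      rw [Int.add_ediv_of_dvd_right (dvd_refl _), Int.ediv_self hLz.ne', add_comm]
    have h2 : (i + L) % (L : ℤ) = i % L := Int.add_emod_right i L
    rw [h1, zpow_one_add]
    congr 1
    simp only [h2]

/-- The distance from a point to the points of a line. -/
theorem IsLine.exists_proj {T : TreeAction Γ V} {p : ℤ → V} (hp : T.IsLine p) (y : V) :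
    ∃ (k : ℤ) (r : ℕ), ∀ j, T.d y (p j) = (j - k).natAbs + r := by
  obtain ⟨k, hk⟩ : ∃ k : ℤ, ∀ j, T.d y (p k) ≤ T.d y (p j) := by
    obtain ⟨x, -, hx⟩ := WellFounded.has_min (measure fun j : ℤ => T.d y (p j)).wf Set.univ
      Set.univ_nonempty
    exact ⟨x, fun j => not_lt.1 (hx j trivial)⟩
  refine ⟨k, T.d y (p k), fun j => ?_⟩
  have step : ∀ e : ℤ, e.natAbs = 1 → T.d y (p (k + e)) = T.d y (p k) + 1 := fun e he => by
    have h0 := hp k (k + e)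
    obtain ⟨a, ha⟩ := T.exists_parity y (p k)
    obtain ⟨b, hb⟩ := T.exists_parity y (p (k + e))
    have h1 := T.ht_step (p k) (p (k + e)) (by omega)
    have h2 := hk (k + e)
    have h3 := T.triangle y (p k) (p (k + e))
    omega
  have h1 := step 1 rfl
  have h2 := step (-1) rfl
  have t1 := T.triangle y (p k) (p j)
  have l1 := hp k j
  rcases lt_trichotomy j k with h | rfl | h
  · have f := T.fourpt y (p (k + -1)) (p k) (p j)
    have l2 := hp (k + -1) j
    have l3 := hp (k + -1) k
    omega
  · simp
  · have f := T.fourpt y (p (k + 1)) (p k) (p j)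
    have l2 := hp (k + 1) j
    have l3 := hp (k + 1) k
    omega

theorem smul_pow_line {s : Γ} {p : ℤ → V} {c : ℤ} (hs : ∀ i, s • p i = p (i + c)) (n : ℕ)
    (i : ℤ) : s ^ n • p i = p (i + n * c) := by
  induction n with
  | zero => simp
  | succ n ih =>
    rw [pow_succ', mul_smul, ih, hs]
    congr 1
    push_cast
    ring

theorem le_of_forall_mul_le {a b K : ℕ} (h : ∀ n : ℕ, n * a ≤ K + n * b) : a ≤ b := by
  by_contra hab
  have h1 := h (K + 1)
  have h2 : (K + 1) * (b + 1) ≤ (K + 1) * a := Nat.mul_le_mul_left _ (by omega)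
  nlinarith

/-- The translation length can be read off from the asymptotic displacement of any vertex, since
displacements of two vertices by powers of `s` differ by a bounded amount. -/
theorem IsLine.natAbs_le {T : TreeAction Γ V} {p : ℤ → V} (hp : T.IsLine p) {s : Γ} {c : ℤ}
    (hs : ∀ i, s • p i = p (i + c)) {y : V} {c' : ℕ} (hy : ∀ n : ℕ, T.d y (s ^ n • y) = n * c') :
    c.natAbs = c' := by
  have key : ∀ n : ℕ, T.d (p 0) (s ^ n • p 0) = n * c.natAbs := fun n => by
    rw [smul_pow_line hs, hp, zero_add, zero_sub, Int.natAbs_neg, Int.natAbs_mul,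
      Int.natAbs_natCast]
  have e : ∀ n : ℕ, T.d (s ^ n • y) (s ^ n • p 0) = T.d y (p 0) := fun n => T.d_smul _ _ _
  apply le_antisymm
  · refine le_of_forall_mul_le (K := 2 * T.d y (p 0)) fun n => ?_
    have t1 := T.triangle (p 0) y (s ^ n • p 0)
    have t2 := T.triangle y (s ^ n • y) (s ^ n • p 0)
    have := T.d_comm (p 0) y
    rw [← key, ← hy]
    have := e n
    omega
  · refine le_of_forall_mul_le (K := 2 * T.d y (p 0)) fun n => ?_
    have t1 := T.triangle y (p 0) (s ^ n • y)
    have t2 := T.triangle (p 0) (s ^ n • p 0) (s ^ n • y)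
    have := T.d_comm (s ^ n • p 0) (s ^ n • y)
    rw [← key, ← hy]
    have := e n
    omega

theorem IsLine.not_isOfFinOrder {T : TreeAction Γ V} {p : ℤ → V} (hp : T.IsLine p) {s : Γ} {c : ℤ}
    (hs : ∀ i, s • p i = p (i + c)) (hc : c ≠ 0) : ¬ IsOfFinOrder s := by
  rw [isOfFinOrder_iff_pow_eq_one]
  rintro ⟨n, hn, h⟩
  have h1 := smul_pow_line hs n 0
  rw [h, one_smul] at h1
  have h2 := hp 0 (0 + n * c)
  rw [← h1, T.d_self] at h2
  have h3 : (n : ℤ) * c = 0 := by omega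
  rcases mul_eq_zero.1 h3 with h | h
  · omega
  · exact hc h

/-- The axis of a hyperbolic element is unique. -/
theorem IsLine.unique {T : TreeAction Γ V} {p q : ℤ → V} (hp : T.IsLine p) (hq : T.IsLine q)
    {s : Γ} {c c' : ℤ} (hs : ∀ i, s • p i = p (i + c)) (hs' : ∀ i, s • q i = q (i + c'))
    (hc : c ≠ 0) : ∃ (ε : ℤˣ) (k : ℤ), ∀ i, q i = p (ε * i + k) := by
  have habs : c.natAbs = c'.natAbs := hp.natAbs_le hs (y := q 0) fun n => by
    rw [smul_pow_line hs', hq, zero_add, zero_sub, Int.natAbs_neg, Int.natAbs_mul,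
      Int.natAbs_natCast]
  -- each point of `q` lies on `p`
  have h1 : ∀ i, ∃ k, q i = p k := fun i => by
    obtain ⟨k, r, hk⟩ := hp.exists_proj (q i)
    have h2 : ∀ j, T.d (q (i + c')) (p j) = (j - c - k).natAbs + r := fun j => by
      rw [← hk, ← hs', ← T.d_smul s (q i), hs, sub_add_cancel]
    have h3 := hq i (i + c')
    have l := hp k (k + c)
    have f := T.fourpt (q i) (p (k + c)) (q (i + c')) (p k)
    have a1 := hk k
    have a2 := hk (k + c)
    have b1 := h2 k
    have b2 := h2 (k + c)
    have c1 := T.d_comm (q (i + c')) (p (k + c))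
    have c2 := T.d_comm (p (k + c)) (p k)
    exact ⟨k, T.eq_of_d _ _ (by omega)⟩
  choose k hk using h1
  have h2 : ∀ i j, (k i - k j).natAbs = (i - j).natAbs := fun i j => by
    rw [← hp, ← hk, ← hk, hq]
  have h3 := h2 1 0
  have h4 : k 1 - k 0 = 1 ∨ k 1 - k 0 = -1 := by omega
  rcases h4 with h4 | h4
  · refine ⟨1, k 0, fun i => ?_⟩
    rw [hk]
    congr 1
    have := h2 i 0
    have := h2 i 1
    simp only [Units.val_one, one_mul]
    omega
  · refine ⟨-1, k 0, fun i => ?_⟩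
    rw [hk]
    congr 1
    have := h2 i 0
    have := h2 i 1
    simp only [Units.val_neg, Units.val_one, neg_mul, one_mul]
    omega

end TreeAction

/-! ### Stabilizers of axes -/

/-- Recognition of the infinite dihedral group. -/
theorem nonempty_mulEquiv_dih {Γ : Type*} [Group Γ] {D : Subgroup Γ} {s r : Γ}
    (hs : ¬ IsOfFinOrder s) (hr : IsInvolution r) (hrs : r * s * r⁻¹ = s⁻¹)
    (hD : ∀ x, x ∈ D ↔ x ∈ Subgroup.zpowers s ∨ ∃ y ∈ Subgroup.zpowers s, x = y * r) :
    Nonempty (D ≃* Dih ℤ) := by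
  classical
  have hrz : ∀ n : ℤ, r * s ^ n = s ^ (-n) * r := fun n => by
    have := conj_zpow (i := n) (a := r) (b := s)
    rw [hrs, inv_zpow'] at this
    rw [this, inv_mul_cancel_right]
  let f : Dih ℤ → Γ := fun d => s ^ d.left.toAdd * if d.right = 1 then 1 else r
  have frot : ∀ n : ℤ, f (Dih.rot n) = s ^ n := fun n => by simp [f, Dih.rot]
  have frefl : ∀ n : ℤ, f (Dih.refl n) = s ^ n * r := fun n => by
    have : (-1 : ℤˣ) ≠ 1 := by decide
    simp [f, Dih.refl, this]
  let ψ : Dih ℤ →* Γ := MonoidHom.mk' f (by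
    intro a b
    rcases Dih.eq_rot_or_refl a with ⟨a, rfl⟩ | ⟨a, rfl⟩ <;>
      rcases Dih.eq_rot_or_refl b with ⟨b, rfl⟩ | ⟨b, rfl⟩
    · rw [Dih.rot_mul_rot, frot, frot, frot, zpow_add]
    · rw [Dih.rot_mul_refl, frefl, frot, frefl, zpow_add, mul_assoc]
    · rw [Dih.refl_mul_rot, frefl, frot, frefl, mul_assoc, hrz, sub_eq_add_neg, zpow_add,
        mul_assoc]
    · rw [Dih.refl_mul_refl, frot, frefl, frefl, mul_assoc, ← mul_assoc r, hrz, mul_assoc,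
        hr.mul_self, mul_one, sub_eq_add_neg, zpow_add])
  have hinj : Function.Injective ψ := by
    rw [injective_iff_map_eq_one]
    intro a ha
    change f a = 1 at ha
    rcases Dih.eq_rot_or_refl a with ⟨a, rfl⟩ | ⟨a, rfl⟩
    · rw [frot] at ha
      by_cases h : a = 0
      · rw [h, Dih.rot_zero]
      · exact absurd (ha ▸ IsOfFinOrder.one) (not_isOfFinOrder_zpow hs h)
    · rw [frefl] at ha
      have h1 : s ^ a = r := by rw [eq_inv_of_mul_eq_one_left ha, hr.inv]
      by_cases h : a = 0
      · rw [h, zpow_zero] at h1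
        exact absurd h1.symm hr.ne_one
      · exact absurd (h1 ▸ hr.isOfFinOrder) (not_isOfFinOrder_zpow hs h)
  have hrange : ψ.range = D := by
    ext x
    rw [hD, MonoidHom.mem_range]
    constructor
    · rintro ⟨a, rfl⟩
      rcases Dih.eq_rot_or_refl a with ⟨a, rfl⟩ | ⟨a, rfl⟩
      · exact Or.inl ⟨a, (frot a).symm⟩
      · exact Or.inr ⟨_, ⟨a, rfl⟩, frefl a⟩
    · rintro (⟨a, rfl⟩ | ⟨_, ⟨a, rfl⟩, rfl⟩)
      · exact ⟨_, frot a⟩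
      · exact ⟨_, frefl a⟩
  exact ⟨((MulEquiv.subgroupCongr hrange).symm.trans (MonoidHom.ofInjective hinj).symm)⟩

namespace TreeAction

variable {Γ : Type*} {V : Type*} [Group Γ] [MulAction Γ V] {T : TreeAction Γ V}

/-- The setwise stabilizer of a line `p`, described through its action on the parameters: these are
translated (`ε = 1`) or reflected (`ε = -1`). -/
def axisStab (Γ : Type*) {V : Type*} [Group Γ] [MulAction Γ V] (p : ℤ → V) : Subgroup Γ where
  carrier := {g | ∃ (ε : ℤˣ) (k : ℤ), ∀ i, g • p i = p (ε * i + k)}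
  one_mem' := ⟨1, 0, fun i => by simp⟩
  mul_mem' := by
    rintro a b ⟨ε, k, h⟩ ⟨ε', k', h'⟩
    refine ⟨ε * ε', ε * k' + k, fun i => ?_⟩
    rw [mul_smul, h', h]
    congr 1
    push_cast
    ring
  inv_mem' := by
    rintro a ⟨ε, k, h⟩
    refine ⟨ε, -(ε * k), fun i => ?_⟩
    rw [inv_smul_eq_iff, h]
    congr 1
    have : (ε : ℤ) * ε = 1 := by rw [← Units.val_mul, Int.units_mul_self, Units.val_one]
    linear_combination (k - i) * this

theorem mem_axisStab_of_translate {p : ℤ → V} {g : Γ} {c : ℤ} (h : ∀ i, g • p i = p (i + c)) :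
    g ∈ axisStab Γ p := ⟨1, c, fun i => by rw [h]; simp⟩

theorem mem_axisStab_cases {p : ℤ → V} {g : Γ} (h : g ∈ axisStab Γ p) :
    (∃ c, ∀ i, g • p i = p (i + c)) ∨ ∃ k, ∀ i, g • p i = p (k - i) := by
  obtain ⟨ε, k, h⟩ := h
  rcases Int.units_eq_one_or ε with rfl | rfl
  · exact Or.inl ⟨k, fun i => by rw [h]; simp⟩
  · refine Or.inr ⟨k, fun i => ?_⟩
    rw [h]
    congr 1
    simp
    ring

theorem smul_zpow_line {s : Γ} {p : ℤ → V} {c : ℤ} (hs : ∀ i, s • p i = p (i + c)) (n : ℤ)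
    (i : ℤ) : s ^ n • p i = p (i + n * c) := by
  obtain ⟨n, rfl | rfl⟩ := n.eq_nat_or_neg
  · rw [zpow_natCast, smul_pow_line hs]
  · rw [zpow_neg, inv_smul_eq_iff, zpow_natCast, smul_pow_line hs]
    congr 1
    ring

theorem inv_smul_line {s : Γ} {p : ℤ → V} {c : ℤ} (hs : ∀ i, s • p i = p (i + c))
    (i : ℤ) : s⁻¹ • p i = p (i - c) := by
  rw [inv_smul_eq_iff, hs, sub_add_cancel]

theorem IsLine.injective {p : ℤ → V} (hp : T.IsLine p) : Function.Injective p := fun i j h => by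
  have := hp i j
  rw [h, T.d_self] at this
  omega

theorem IsLine.smul {p : ℤ → V} (hp : T.IsLine p) (g : Γ) : T.IsLine fun i => g • p i :=
  fun i j => by rw [T.d_smul, hp]

/-- Elements conjugating a translation along a line to another one preserve the line. -/
theorem IsLine.mem_axisStab_of_conj {p : ℤ → V} (hp : T.IsLine p) {s g : Γ} {c c' : ℤ}
    (hs : ∀ i, s • p i = p (i + c)) (hs' : ∀ i, (g⁻¹ * s * g) • p i = p (i + c')) (hc : c ≠ 0) :
    g ∈ axisStab Γ p := by
  refine hp.unique (hp.smul g) hs (c' := c') (fun i => ?_) hc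
  rw [← hs', smul_smul, smul_smul]
  simp [mul_assoc]

/-- Two involutions preserve the axis of their product. -/
theorem IsLine.mem_axisStab_of_mul {p : ℤ → V} (hp : T.IsLine p) {u v : Γ}
    (hu : IsInvolution u) (hv : IsInvolution v) {c : ℤ}
    (hs : ∀ i, (u * v) • p i = p (i + c)) (hc : c ≠ 0) :
    u ∈ axisStab Γ p ∧ v ∈ axisStab Γ p := by
  have h : u ∈ axisStab Γ p := by
    refine hp.mem_axisStab_of_conj hs (c' := -c) (fun i => ?_) hc
    have : u⁻¹ * (u * v) * u = (u * v)⁻¹ := by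
      rw [mul_inv_rev, hu.inv, hv.inv, ← mul_assoc, hu.mul_self, one_mul]
    rw [this, inv_smul_line hs, sub_eq_add_neg]
  refine ⟨h, ?_⟩
  have := mul_mem (inv_mem h) (mem_axisStab_of_translate hs)
  rwa [inv_mul_cancel_left] at this

section Faithful

variable {p : ℤ → V} (hK : ∀ a : Γ, (∀ i, a • p i = p i) → a = 1)
include hK

theorem mul_self_of_reflect {r : Γ} {k : ℤ} (hr : ∀ i, r • p i = p (k - i)) : r * r = 1 :=
  hK _ fun i => by rw [mul_smul, hr, hr, sub_sub_cancel]

theorem IsLine.isInvolution_of_reflect (hp : T.IsLine p) {r : Γ} {k : ℤ}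
    (hr : ∀ i, r • p i = p (k - i)) : IsInvolution r := by
  refine isInvolution_iff.2 ⟨mul_self_of_reflect hK hr, ?_⟩
  rintro rfl
  have h0 := hp.injective ((one_smul Γ (p 0)).symm.trans (hr 0))
  have h1 := hp.injective ((one_smul Γ (p 1)).symm.trans (hr 1))
  omega

theorem exists_translate_of_infinite {s : Γ} (hs : s ∈ axisStab Γ p) (hf : ¬ IsOfFinOrder s) :
    ∃ c, c ≠ 0 ∧ ∀ i, s • p i = p (i + c) := by
  rcases mem_axisStab_cases hs with ⟨c, h⟩ | ⟨k, h⟩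
  · refine ⟨c, ?_, h⟩
    rintro rfl
    have := hK s fun i => by rw [h, add_zero]
    exact hf (this ▸ IsOfFinOrder.one)
  · refine absurd (isOfFinOrder_iff_pow_eq_one.2 ⟨2, by norm_num, ?_⟩) hf
    rw [pow_two, mul_self_of_reflect hK h]

theorem IsLine.mem_axisStab_of_infinite (hp : T.IsLine p) {s g : Γ} (hs : s ∈ axisStab Γ p)
    (hs' : g⁻¹ * s * g ∈ axisStab Γ p) (hf : ¬ IsOfFinOrder s) : g ∈ axisStab Γ p := by
  obtain ⟨c, hc, h⟩ := exists_translate_of_infinite hK hs hf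
  have hf' : ¬ IsOfFinOrder (g⁻¹ * s * g) := by
    have := isOfFinOrder_conj g⁻¹ (x := s)
    rw [inv_inv] at this
    rwa [this]
  obtain ⟨c', -, h'⟩ := exists_translate_of_infinite hK hs' hf'
  exact hp.mem_axisStab_of_conj h h' hc

/-- Involutions reflect the lines which they preserve. -/
theorem IsLine.exists_reflect (hp : T.IsLine p) {u : Γ} (hu : IsInvolution u)
    (h : u ∈ axisStab Γ p) : ∃ k, ∀ i, u • p i = p (k - i) := by
  rcases mem_axisStab_cases h with ⟨c, h⟩ | h
  · by_cases h0 : c = 0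
    · subst h0
      exact absurd (hK u fun i => by rw [h, add_zero]) hu.ne_one
    · exact absurd hu.isOfFinOrder (hp.not_isOfFinOrder h h0)
  · exact h

/-- The translations along a line form a cyclic group. -/
theorem exists_generator {s : Γ} {c : ℤ} (hs : ∀ i, s • p i = p (i + c)) (hc : c ≠ 0) :
    ∃ (s₀ : Γ) (m : ℤ), m ≠ 0 ∧ (∀ i, s₀ • p i = p (i + m)) ∧
      ∀ (g : Γ) (k : ℤ), (∀ i, g • p i = p (i + k)) → g ∈ Subgroup.zpowers s₀ := by
  let A : AddSubgroup ℤ :=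
    { carrier := {k | ∃ g : Γ, ∀ i, g • p i = p (i + k)}
      zero_mem' := ⟨1, fun i => by simp⟩
      add_mem' := by
        rintro a b ⟨g, hg⟩ ⟨h, hh⟩
        exact ⟨h * g, fun i => by rw [mul_smul, hg, hh, add_assoc]⟩
      neg_mem' := by
        rintro a ⟨g, hg⟩
        exact ⟨g⁻¹, fun i => by rw [inv_smul_line hg, sub_eq_add_neg]⟩ }
  obtain ⟨m, hm⟩ := Int.subgroup_cyclic A
  have hmem : ∀ k, k ∈ A ↔ ∃ n : ℤ, n • m = k := fun k => by
    rw [hm, AddSubgroup.mem_closure_singleton]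
  obtain ⟨s₀, hs₀⟩ : m ∈ A := (hmem m).2 ⟨1, one_smul _ _⟩
  refine ⟨s₀, m, ?_, hs₀, fun g k hg => ?_⟩
  · rintro rfl
    obtain ⟨n, hn⟩ := (hmem c).1 ⟨s, hs⟩
    exact hc (by rw [← hn, smul_zero])
  · obtain ⟨n, hn⟩ := (hmem k).1 ⟨g, hg⟩
    refine ⟨n, ?_⟩
    have h1 := hK ((s₀ ^ n)⁻¹ * g) fun i => by
      rw [mul_smul, inv_smul_eq_iff, hg, smul_zpow_line hs₀, ← hn, smul_eq_mul]
    exact (inv_mul_eq_one.1 h1)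

/-- If a line is both translated and reflected, then its setwise stabilizer is infinite dihedral. -/
theorem IsLine.nonempty_mulEquiv (hp : T.IsLine p) {s r : Γ} {c k : ℤ}
    (hs : ∀ i, s • p i = p (i + c)) (hc : c ≠ 0) (hr : ∀ i, r • p i = p (k - i)) :
    Nonempty (axisStab Γ p ≃* Dih ℤ) := by
  obtain ⟨s₀, m, hm, hs₀, hgen⟩ := exists_generator hK hs hc
  have hrr := hp.isInvolution_of_reflect hK hr
  refine nonempty_mulEquiv_dih (s := s₀) (r := r) (hp.not_isOfFinOrder hs₀ hm) hrr ?_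
    fun x => ⟨fun hx => ?_, ?_⟩
  · rw [← mul_eq_one_iff_eq_inv]
    refine hK _ fun i => ?_
    rw [hrr.inv, mul_smul, mul_smul, mul_smul, hs₀, hr, hs₀, hr]
    congr 1
    ring
  · rcases mem_axisStab_cases hx with ⟨c', h⟩ | ⟨k', h⟩
    · exact Or.inl (hgen _ _ h)
    · refine Or.inr ⟨x * r, hgen _ (k' - k) fun i => ?_, ?_⟩
      · rw [mul_smul, hr, h]
        congr 1
        ring
      · rw [mul_assoc, hrr.mul_self, mul_one]
  · have h1 : ∀ y ∈ Subgroup.zpowers s₀, y ∈ axisStab Γ p := fun y hy =>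
      (Subgroup.zpowers_le.2 (mem_axisStab_of_translate hs₀)) hy
    have h2 : r ∈ axisStab Γ p := ⟨-1, k, fun i => by rw [hr]; congr 1; simp; ring⟩
    rintro (hx | ⟨y, hy, rfl⟩)
    · exact h1 x hx
    · exact mul_mem (h1 y hy) h2

/-- A hyperbolic element whose axis has trivial pointwise stabilizer is a translation or
isolated, according to whether its axis is reflected by some element or not. -/
theorem IsLine.isTranslation_or_isIsolated (hp : T.IsLine p) {s : Γ} {c : ℤ}
    (hs : ∀ i, s • p i = p (i + c)) (hc : c ≠ 0) : IsTranslation s ∨ IsIsolated s := by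
  have hf := hp.not_isOfFinOrder hs hc
  by_cases h : ∃ (r : Γ) (k : ℤ), ∀ i, r • p i = p (k - i)
  · obtain ⟨r, k, hr⟩ := h
    left
    have h1 : ∀ i, (s * r) • p i = p ((k + c) - i) := fun i => by
      rw [mul_smul, hr, hs]
      congr 1
      ring
    have hrr := hp.isInvolution_of_reflect hK hr
    refine ⟨hf, s * r, r, ⟨hp.isInvolution_of_reflect hK h1, hrr, fun h => hf ?_⟩, ?_⟩
    · rw [mul_eq_right.1 h]
      exact IsOfFinOrder.one
    · rw [mul_assoc, hrr.mul_self, mul_one]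
  · right
    obtain ⟨s₀, m, hm, hs₀, hgen⟩ := exists_generator hK hs hc
    have hS : axisStab Γ p = Subgroup.zpowers s₀ := by
      refine le_antisymm (fun x hx => ?_)
        (Subgroup.zpowers_le.2 (mem_axisStab_of_translate hs₀))
      rcases mem_axisStab_cases hx with ⟨c', h'⟩ | ⟨k', h'⟩
      · exact hgen _ _ h'
      · exact absurd ⟨x, k', h'⟩ h
    refine ⟨hf, s₀, hgen _ _ hs, malnormal_of fun g x hx hx' h1 => ?_⟩
    have hfx := not_isOfFinOrder_of_mem_zpowers (hp.not_isOfFinOrder hs₀ hm) hx h1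
    rw [← hS] at hx hx' ⊢
    exact hp.mem_axisStab_of_infinite hK hx hx' hfx

theorem IsLine.isTypeDZ (hp : T.IsLine p) {u v : Γ} (huv : IsInvolutionPair u v) {c : ℤ}
    (hs : ∀ i, (u * v) • p i = p (i + c)) (hc : c ≠ 0)
    (h1 : ∀ h : Γ, orderOf h = 1 ∨ orderOf h = 2 ∨ ¬ IsOfFinOrder h)
    (h2 : ∀ u v : Γ, IsInvolutionPair u v → ¬ IsOfFinOrder (u * v)) : IsTypeDZ u v := by
  obtain ⟨hu, hv⟩ := hp.mem_axisStab_of_mul huv.1 huv.2.1 hs hc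
  refine ⟨axisStab Γ p, ?_, ?_, quasiMalnormal_of h1 h2 fun g h =>
    hp.mem_axisStab_of_infinite hK⟩
  · rw [Subgroup.closure_le]
    rintro _ (rfl | rfl)
    · exact hu
    · exact hv
  · obtain ⟨k, h⟩ := hp.exists_reflect hK huv.1 hu
    exact hp.nonempty_mulEquiv hK hs hc h

end Faithful

end TreeAction

/-! ### The four-point condition -/

section FourPoint

variable {V : Type*} (d : V → V → ℕ) (d_self : ∀ x, d x x = 0) (eq_of_d : ∀ x y, d x y = 0 → x = y)
  (d_comm : ∀ x y, d x y = d y x)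
  (nbr : ∀ x y z, d x z = 1 → d z y = d x y + 1 ∨ d z y + 1 = d x y)
  (exists_step : ∀ x y, x ≠ y → ∃ z, d x z = 1 ∧ d z y + 1 = d x y)
  (step_unique : ∀ x y z z', d x z = 1 → d x z' = 1 → d z y + 1 = d x y → d z' y + 1 = d x y →
    z = z')
include d_self eq_of_d nbr exists_step

theorem triangle_of_steps (x y z : V) : d x z ≤ d x y + d y z := by
  induction h : d x y generalizing x with
  | zero => rw [eq_of_d x y h]; omega
  | succ n ih =>
    have hne : x ≠ y := by rintro rfl; rw [d_self] at h; omega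
    obtain ⟨w, h1, h2⟩ := exists_step x y hne
    have := ih w (by omega)
    have := nbr x z w h1
    omega

include d_comm step_unique

/-- If an edge points away from `y` at one end and towards `z` at the other one, then the segment
from `z` to `y` passes through it. -/
theorem d_eq_add_of_edge (x x' y z : V) (h : d x x' = 1) (h1 : d x y = d x' y + 1)
    (h2 : d x' z = d x z + 1) : d z y = d z x' + d x' y := by
  induction hn : d x' y generalizing x x' with
  | zero => rw [eq_of_d x' y hn]; omega
  | succ n ih =>
    have hne : x' ≠ y := by rintro rfl; rw [d_self] at hn; omega
    obtain ⟨w, h3, h4⟩ := exists_step x' y hne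
    have h5 : d w z = d x' z + 1 := by
      rcases nbr x' z w h3 with h5 | h5
      · exact h5
      · have := step_unique x' z w x h3 (by rw [d_comm, h]) h5 (by omega)
        subst this
        omega
    have := ih x' w h3 (by omega) h5 (by omega)
    have := d_comm z w
    have := d_comm z x'
    omega

/-- A graph metric for which each vertex has exactly one neighbour closer to any
given other vertex satisfies the four-point condition. -/
theorem fourpt_of_steps (x y z w : V) :
    d x y + d z w ≤ d x z + d y w ∨ d x y + d z w ≤ d x w + d y z := by
  have tri := triangle_of_steps d d_self eq_of_d nbr exists_step
  induction h : d x y generalizing x with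
  | zero =>
    obtain rfl := eq_of_d x y h
    have := tri z x w
    have := d_comm z x
    omega
  | succ n ih =>
    have hne : x ≠ y := by rintro rfl; rw [d_self] at h; omega
    obtain ⟨x', h1, h2⟩ := exists_step x y hne
    have key := d_eq_add_of_edge d d_self eq_of_d d_comm nbr exists_step step_unique x x' y
    have c1 := d_comm z y
    have c2 := d_comm z x'
    have c3 := d_comm w y
    have c4 := d_comm w x'
    have c5 := d_comm z x
    have c6 := d_comm w x
    rcases nbr x z x' h1 with hz | hz
    · have := key z h1 h2.symm hz
      have := tri z x w
      omega
    · rcases nbr x w x' h1 with hw | hw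
      · have := key w h1 h2.symm hw
        have := tri z x w
        omega
      · have := ih x' (by omega)
        omega

end FourPoint

/-! ### The Bass–Serre tree of an HNN extension -/

namespace HNN

open HNNExtension HNNExtension.NormalWord

variable {G : Type u} [Group G] {A B : Subgroup G} {φ : A ≃* B}

theorem zpow_t_mul_of (u : ℤˣ) {a : G} (ha : a ∈ toSubgroup A B u) :
    ∃ b ∈ toSubgroup A B (-u),
      (t ^ (u : ℤ) * of a : HNNExtension G A B φ) = of b * t ^ (u : ℤ) := by
  rcases Int.units_eq_one_or u with rfl | rfl
  · exact ⟨φ ⟨a, ha⟩, (φ ⟨a, ha⟩).2, by simpa using t_mul_of (φ := φ) ⟨a, ha⟩⟩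
  · refine ⟨φ.symm ⟨a, ha⟩, (φ.symm ⟨a, ha⟩).2, ?_⟩
    simpa using inv_t_mul_of (φ := φ) ⟨a, ha⟩

theorem exists_reducedWord (γ : HNNExtension G A B φ) :
    ∃ w : ReducedWord G A B, w.prod φ = γ := by
  obtain ⟨d⟩ := TransversalPair.nonempty G A B
  exact ⟨_, (NormalWord.equiv φ d).symm_apply_apply γ⟩

/-- The number of occurrences of the stable letter in a reduced word for `γ`. -/
noncomputable def tLen (γ : HNNExtension G A B φ) : ℕ :=
  (exists_reducedWord γ).choose.toList.length

theorem tLen_prod (w : ReducedWord G A B) : tLen (w.prod φ) = w.toList.length := by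
  have h := (exists_reducedWord (w.prod φ)).choose_spec
  have := congrArg List.length (ReducedWord.map_fst_eq_and_of_prod_eq φ h).1
  rw [List.length_map, List.length_map] at this
  exact this

theorem prod_mk_cons (g a : G) (u : ℤˣ) (l : List (ℤˣ × G))
    (h : ((u, a) :: l).IsChain (fun a b => a.2 ∈ toSubgroup A B a.1 → a.1 = b.1)) :
    (ReducedWord.mk g ((u, a) :: l) h).prod φ =
      of g * t ^ (u : ℤ) * (ReducedWord.mk a l (List.isChain_cons.1 h).2).prod φ := by
  simp [ReducedWord.prod, mul_assoc]

theorem prod_mk_head (g a : G) (l : List (ℤˣ × G))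
    (h : l.IsChain (fun a b => a.2 ∈ toSubgroup A B a.1 → a.1 = b.1)) :
    (ReducedWord.mk (g * a) l h).prod φ = of g * (ReducedWord.mk a l h).prod φ := by
  simp [ReducedWord.prod, mul_assoc]

theorem tLen_of_mul (g : G) (γ : HNNExtension G A B φ) : tLen (of g * γ) = tLen γ := by
  obtain ⟨⟨a, l, h⟩, rfl⟩ := exists_reducedWord γ
  rw [← prod_mk_head, tLen_prod, tLen_prod]

theorem tLen_of (g : G) : tLen (of g : HNNExtension G A B φ) = 0 := by
  have : (of g : HNNExtension G A B φ) = (ReducedWord.mk (A := A) (B := B) g []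
    List.isChain_nil).prod φ := by simp [ReducedWord.prod]
  rw [this, tLen_prod, List.length_nil]

/-- Multiplication by a stable letter cancels the first letter of a reduced word
or makes the word longer. -/
theorem tLen_zpow_mul (u : ℤˣ) (w : ReducedWord G A B) :
    (tLen (t ^ (u : ℤ) * w.prod φ) = w.toList.length + 1) ∨
      ∃ a l, w.toList = (-u, a) :: l ∧ w.head ∈ toSubgroup A B u ∧
        tLen (t ^ (u : ℤ) * w.prod φ) = l.length := by
  obtain ⟨g, l, h⟩ := w
  have long : ((u, g) :: l).IsChain (fun a b => a.2 ∈ toSubgroup A B a.1 → a.1 = b.1) →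
      tLen (t ^ (u : ℤ) * (ReducedWord.mk g l h).prod φ) = l.length + 1 := fun h' => by
    have := prod_mk_cons (φ := φ) 1 g u l h'
    rw [map_one, one_mul] at this
    rw [← this, tLen_prod, List.length_cons]
  rcases l with _ | ⟨⟨e, a⟩, l⟩
  · exact Or.inl (long (List.isChain_singleton _))
  · by_cases hc : g ∈ toSubgroup A B u → u = e
    · exact Or.inl (long (List.isChain_cons_cons.2 ⟨hc, h⟩))
    · push Not at hc
      have he : e = -u := by
        rcases Int.units_eq_one_or u with rfl | rfl <;>
          rcases Int.units_eq_one_or e with rfl | rfl <;> simp_all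
      subst he
      refine Or.inr ⟨a, l, rfl, hc.1, ?_⟩
      obtain ⟨b, -, hb⟩ := zpow_t_mul_of (φ := φ) u hc.1
      rw [prod_mk_cons, ← mul_assoc, ← mul_assoc, hb, mul_assoc (of b), ← zpow_add]
      simp only [Units.val_neg, add_neg_cancel, zpow_zero, mul_one]
      rw [tLen_of_mul, tLen_prod]

theorem tLen_zpow_mul_le (u : ℤˣ) (γ : HNNExtension G A B φ) :
    tLen (t ^ (u : ℤ) * γ) ≤ tLen γ + 1 := by
  obtain ⟨w, rfl⟩ := exists_reducedWord γ
  rw [tLen_prod]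
  rcases tLen_zpow_mul (φ := φ) u w with h | ⟨a, l, h1, -, h2⟩
  · omega
  · rw [h1, h2, List.length_cons]
    omega

theorem tLen_mul_le (γ γ' : HNNExtension G A B φ) : tLen (γ * γ') ≤ tLen γ + tLen γ' := by
  obtain ⟨⟨g, l, h⟩, rfl⟩ := exists_reducedWord γ
  induction l generalizing g with
  | nil =>
    have : (ReducedWord.mk g [] h).prod φ = of g := by simp [ReducedWord.prod]
    rw [this, tLen_of_mul]
    omega
  | cons x l ih =>
    obtain ⟨u, a⟩ := x
    have := ih a (List.isChain_cons.1 h).2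
    rw [tLen_prod] at this ⊢
    rw [prod_mk_cons, mul_assoc, mul_assoc, tLen_of_mul]
    refine (tLen_zpow_mul_le _ _).trans ?_
    simp only [List.length_cons] at this ⊢
    omega

theorem tLen_zpow (u : ℤˣ) : tLen (t ^ (u : ℤ) : HNNExtension G A B φ) = 1 := by
  have h := tLen_prod (φ := φ) (A := A) (B := B) ⟨1, [(u, 1)], List.isChain_singleton _⟩
  simpa [ReducedWord.prod] using h

theorem tLen_inv_le (γ : HNNExtension G A B φ) : tLen γ⁻¹ ≤ tLen γ := by
  obtain ⟨⟨g, l, h⟩, rfl⟩ := exists_reducedWord γ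
  induction l generalizing g with
  | nil =>
    have : (ReducedWord.mk g [] h).prod φ = of g := by simp [ReducedWord.prod]
    rw [this, ← map_inv, tLen_of]
    omega
  | cons x l ih =>
    obtain ⟨u, a⟩ := x
    have h1 := ih a (List.isChain_cons.1 h).2
    rw [tLen_prod] at h1 ⊢
    rw [prod_mk_cons, mul_inv_rev, mul_inv_rev, ← map_inv of]
    refine (tLen_mul_le _ _).trans ?_
    have h2 := tLen_mul_le (t ^ (u : ℤ))⁻¹ (of g⁻¹ : HNNExtension G A B φ)
    have h3 := tLen_zpow (φ := φ) (-u)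
    rw [tLen_of] at h2
    simp only [Units.val_neg, zpow_neg] at h3
    simp only [List.length_cons] at h1 ⊢
    omega

theorem tLen_inv (γ : HNNExtension G A B φ) : tLen γ⁻¹ = tLen γ :=
  le_antisymm (tLen_inv_le γ) (by simpa using tLen_inv_le γ⁻¹)

theorem tLen_mul_of (g : G) (γ : HNNExtension G A B φ) : tLen (γ * of g) = tLen γ := by
  rw [← tLen_inv, mul_inv_rev, ← map_inv, tLen_of_mul, tLen_inv]

theorem mem_range_of_tLen {γ : HNNExtension G A B φ} (h : tLen γ = 0) :
    γ ∈ (of : G →* HNNExtension G A B φ).range := by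
  obtain ⟨⟨g, l, hl⟩, rfl⟩ := exists_reducedWord γ
  rw [tLen_prod, List.length_eq_zero_iff] at h
  simp only at h
  subst h
  exact ⟨g, by simp [ReducedWord.prod]⟩

theorem eq_of_tLen_one {γ : HNNExtension G A B φ} (h : tLen γ = 1) :
    ∃ (g g' : G) (u : ℤˣ), γ = of g * t ^ (u : ℤ) * of g' := by
  obtain ⟨⟨g, l, hl⟩, rfl⟩ := exists_reducedWord γ
  rw [tLen_prod, List.length_eq_one_iff] at h
  obtain ⟨⟨u, a⟩, h⟩ := h
  simp only at h
  subst h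
  exact ⟨g, a, u, by simp [ReducedWord.prod, mul_assoc]⟩

theorem tLen_zpow_mul_cases (u : ℤˣ) (γ : HNNExtension G A B φ) :
    tLen (t ^ (u : ℤ) * γ) = tLen γ + 1 ∨ tLen (t ^ (u : ℤ) * γ) + 1 = tLen γ := by
  obtain ⟨w, rfl⟩ := exists_reducedWord γ
  rw [tLen_prod]
  rcases tLen_zpow_mul (φ := φ) u w with h | ⟨a, l, h1, -, h2⟩
  · exact Or.inl h
  · right
    rw [h1, h2, List.length_cons]

theorem exists_shorter {γ : HNNExtension G A B φ} (h : tLen γ ≠ 0) :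
    ∃ (g : G) (u : ℤˣ), tLen (t ^ (-u : ℤ) * (of g⁻¹ * γ)) + 1 = tLen γ := by
  obtain ⟨⟨g, l, hl⟩, rfl⟩ := exists_reducedWord γ
  rw [tLen_prod] at h ⊢
  rcases l with _ | ⟨⟨u, a⟩, l⟩
  · simp at h
  · refine ⟨g, u, ?_⟩
    rw [prod_mk_cons, map_inv, mul_assoc (of g), inv_mul_cancel_left, zpow_neg,
      inv_mul_cancel_left, tLen_prod, List.length_cons]

/-- The two ways to shorten an element by one stable letter lead to the same edge. -/
theorem shorter_unique {γ : HNNExtension G A B φ} {g g' : G} {u u' : ℤˣ}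
    (h : tLen (t ^ (u : ℤ) * (of g * γ)) + 1 = tLen γ)
    (h' : tLen (t ^ (u' : ℤ) * (of g' * γ)) + 1 = tLen γ) :
    ∃ b : G, (of b : HNNExtension G A B φ) * (t ^ (u : ℤ) * of g) = t ^ (u' : ℤ) * of g' := by
  obtain ⟨⟨a, l, hl⟩, rfl⟩ := exists_reducedWord γ
  rw [← prod_mk_head, tLen_prod] at h h'
  rcases tLen_zpow_mul (φ := φ) u ⟨g * a, l, hl⟩ with h1 | ⟨c, k, h1, h2, -⟩
  · rw [h1] at h
    simp only at h
    omega
  rcases tLen_zpow_mul (φ := φ) u' ⟨g' * a, l, hl⟩ with h1' | ⟨c', k', h1', h2', -⟩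
  · rw [h1'] at h'
    simp only at h'
    omega
  simp only at h1 h1' h2 h2'
  rw [h1] at h1'
  have hu : u = u' := by
    have := congrArg (fun l => l.head?.map Prod.fst) h1'
    simpa using this
  subst hu
  have h3 : g' * g⁻¹ ∈ toSubgroup A B u := by
    have := mul_mem h2' (inv_mem h2)
    simpa [mul_assoc] using this
  obtain ⟨b, -, hb⟩ := zpow_t_mul_of (φ := φ) u h3
  refine ⟨b, ?_⟩
  rw [← mul_assoc, ← hb, mul_assoc, ← map_mul, inv_mul_cancel_right]

variable (φ)

/-- The vertices of the Bass–Serre tree. -/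
abbrev Vert : Type u := HNNExtension G A B φ ⧸ (of : G →* HNNExtension G A B φ).range

/-- The base vertex. -/
def base : Vert φ := ((1 : HNNExtension G A B φ) : Vert φ)

/-- The distance in the Bass–Serre tree. It is defined on chosen representatives of the cosets, but
does not depend on them by `dist_mk`. -/
noncomputable def dist (x y : Vert φ) : ℕ := tLen (x.out⁻¹ * y.out)

variable {φ}

theorem dist_mk (a b : HNNExtension G A B φ) :
    dist φ (a : Vert φ) (b : Vert φ) = tLen (a⁻¹ * b) := by
  obtain ⟨⟨_, g, rfl⟩, h⟩ := QuotientGroup.mk_out_eq_mul (of : G →* HNNExtension G A B φ).range a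
  obtain ⟨⟨_, g', rfl⟩, h'⟩ := QuotientGroup.mk_out_eq_mul (of : G →* HNNExtension G A B φ).range b
  rw [dist, h, h', mul_inv_rev, ← map_inv, mul_assoc, tLen_of_mul, ← mul_assoc, tLen_mul_of]

theorem exists_mk (x : Vert φ) : ∃ a : HNNExtension G A B φ, x = a :=
  ⟨x.out, by simp⟩

theorem dist_eq_one_iff {a : HNNExtension G A B φ} {z : Vert φ} (h : dist φ (a : Vert φ) z = 1) :
    ∃ (g : G) (u : ℤˣ), z = ((a * of g * t ^ (u : ℤ) : HNNExtension G A B φ) : Vert φ) := by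
  obtain ⟨c, rfl⟩ := exists_mk z
  rw [dist_mk] at h
  obtain ⟨g, g', u, h⟩ := eq_of_tLen_one h
  refine ⟨g, u, QuotientGroup.eq.2 ?_⟩
  rw [inv_mul_eq_iff_eq_mul] at h
  rw [h]
  refine ⟨g'⁻¹, ?_⟩
  rw [map_inv]
  group

theorem dist_nbr (a b : HNNExtension G A B φ) (g : G) (u : ℤˣ) :
    dist φ ((a * of g * t ^ (u : ℤ) : HNNExtension G A B φ) : Vert φ) (b : Vert φ) =
      tLen (t ^ ((-u : ℤˣ) : ℤ) * (of g⁻¹ * (a⁻¹ * b))) := by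
  rw [dist_mk]
  simp [mul_assoc]

theorem nbr (x y z : Vert φ) (h : dist φ x z = 1) :
    dist φ z y = dist φ x y + 1 ∨ dist φ z y + 1 = dist φ x y := by
  obtain ⟨a, rfl⟩ := exists_mk x
  obtain ⟨b, rfl⟩ := exists_mk y
  obtain ⟨g, u, rfl⟩ := dist_eq_one_iff h
  rw [dist_nbr, dist_mk, ← tLen_of_mul g⁻¹ (a⁻¹ * b)]
  exact tLen_zpow_mul_cases _ _

theorem exists_step (x y : Vert φ) (h : x ≠ y) :
    ∃ z, dist φ x z = 1 ∧ dist φ z y + 1 = dist φ x y := by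
  obtain ⟨a, rfl⟩ := exists_mk x
  obtain ⟨b, rfl⟩ := exists_mk y
  have h0 : tLen (a⁻¹ * b) ≠ 0 := fun h0 => h (QuotientGroup.eq.2 (mem_range_of_tLen h0))
  obtain ⟨g, u, hu⟩ := exists_shorter h0
  refine ⟨((a * of g * t ^ (u : ℤ) : HNNExtension G A B φ) : Vert φ), ?_, ?_⟩
  · rw [dist_mk, mul_assoc, inv_mul_cancel_left, tLen_of_mul, tLen_zpow]
  · rw [dist_nbr, dist_mk]
    exact_mod_cast hu

/-- In a Bass–Serre tree, only one neighbour of `x` is closer to `y`. -/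
theorem step_unique (x y z z' : Vert φ) (h : dist φ x z = 1) (h' : dist φ x z' = 1)
    (hz : dist φ z y + 1 = dist φ x y) (hz' : dist φ z' y + 1 = dist φ x y) : z = z' := by
  obtain ⟨a, rfl⟩ := exists_mk x
  obtain ⟨b, rfl⟩ := exists_mk y
  obtain ⟨g, u, rfl⟩ := dist_eq_one_iff h
  obtain ⟨g', u', rfl⟩ := dist_eq_one_iff h'
  rw [dist_nbr, dist_mk] at hz hz'
  obtain ⟨c, hc⟩ := shorter_unique hz hz'
  refine (QuotientGroup.eq.2 (MonoidHom.mem_range.2 ⟨c, ?_⟩)).symm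
  rw [← eq_mul_inv_iff_mul_eq] at hc
  rw [hc]
  simp [mul_assoc]

variable (φ)

/-- The exponent sum of the stable letter. -/
noncomputable def expSum : HNNExtension G A B φ →* Multiplicative ℤ :=
  lift 1 (Multiplicative.ofAdd 1) (by simp)

theorem expSum_of (g : G) : expSum φ (of g) = 1 := by simp [expSum]

theorem expSum_t : expSum φ t = Multiplicative.ofAdd 1 := by simp [expSum]

/-- The height of a vertex of the Bass–Serre tree: the exponent sum of any representative of the
coset, by `height_mk`. -/
noncomputable def height (x : Vert φ) : ℤ := (expSum φ x.out).toAdd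

theorem height_mk (a : HNNExtension G A B φ) : height φ (a : Vert φ) = (expSum φ a).toAdd := by
  obtain ⟨⟨_, g, rfl⟩, h⟩ := QuotientGroup.mk_out_eq_mul (of : G →* HNNExtension G A B φ).range a
  rw [height, h, map_mul, expSum_of, mul_one]

/-- The action of an HNN extension on its Bass–Serre tree. -/
noncomputable def tree : TreeAction (HNNExtension G A B φ) (Vert φ) where
  d := dist φ
  d_self x := by
    obtain ⟨a, rfl⟩ := exists_mk x
    rw [dist_mk, inv_mul_cancel, ← map_one of, tLen_of]
  eq_of_d x y h := by
    obtain ⟨a, rfl⟩ := exists_mk x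
    obtain ⟨b, rfl⟩ := exists_mk y
    rw [dist_mk] at h
    exact QuotientGroup.eq.2 (mem_range_of_tLen h)
  d_comm x y := by rw [dist, dist, ← tLen_inv, mul_inv_rev, inv_inv]
  fourpt := by
    refine fourpt_of_steps (dist φ) ?_ ?_ ?_ nbr exists_step step_unique
    · intro x
      obtain ⟨a, rfl⟩ := exists_mk x
      rw [dist_mk, inv_mul_cancel, ← map_one of, tLen_of]
    · intro x y h
      obtain ⟨a, rfl⟩ := exists_mk x
      obtain ⟨b, rfl⟩ := exists_mk y
      rw [dist_mk] at h
      exact QuotientGroup.eq.2 (mem_range_of_tLen h)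
    · intro x y
      rw [dist, dist, ← tLen_inv, mul_inv_rev, inv_inv]
  exists_step := exists_step
  d_smul g x y := by
    obtain ⟨a, rfl⟩ := exists_mk x
    obtain ⟨b, rfl⟩ := exists_mk y
    rw [MulAction.Quotient.smul_coe, MulAction.Quotient.smul_coe, dist_mk, dist_mk]
    simp [mul_assoc]
  ht := height φ
  χ := expSum φ
  ht_step x y h := by
    obtain ⟨a, rfl⟩ := exists_mk x
    obtain ⟨g, u, rfl⟩ := dist_eq_one_iff h
    rw [height_mk, height_mk, map_mul (expSum φ), map_mul (expSum φ), expSum_of, mul_one, map_zpow,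
      expSum_t, toAdd_mul]
    rcases Int.units_eq_one_or u with rfl | rfl
    · left; simp
    · right; simp; rfl
  ht_smul g x := by
    obtain ⟨a, rfl⟩ := exists_mk x
    rw [MulAction.Quotient.smul_coe, height_mk, height_mk, smul_eq_mul, map_mul, toAdd_mul,
      add_comm]

end HNN

namespace HNN

open HNNExtension HNNExtension.NormalWord TreeAction

variable {G : Type u} [Group G] {A B : Subgroup G} {φ : A ≃* B}

/-! ### Stabilizers in the Bass–Serre tree -/

theorem pow_smul_eq {M V : Type*} [Monoid M] [MulAction M V] {a : M} {x : V} (h : a • x = x)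
    (n : ℕ) : a ^ n • x = x := by
  induction n with
  | zero => simp
  | succ n ih => rw [pow_succ, mul_smul, h, ih]

theorem of_inj : Function.Injective (of : G →* HNNExtension G A B φ) := of_injective φ

theorem smul_base (γ : HNNExtension G A B φ) : γ • base φ = (γ : Vert φ) := by
  rw [base, MulAction.Quotient.smul_coe, smul_eq_mul, mul_one]

theorem exists_smul_base (x : Vert φ) : ∃ γ : HNNExtension G A B φ, x = γ • base φ := by
  obtain ⟨a, rfl⟩ := exists_mk x
  exact ⟨a, (smul_base a).symm⟩

theorem smul_base_eq_iff {γ : HNNExtension G A B φ} : γ • base φ = base φ ↔ ∃ g, γ = of g := by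
  rw [smul_base, base, eq_comm, QuotientGroup.eq, inv_one, one_mul]
  exact ⟨fun ⟨g, h⟩ => ⟨g, h.symm⟩, fun ⟨g, h⟩ => ⟨g, h.symm⟩⟩

theorem of_smul_base (g : G) : (of g : HNNExtension G A B φ) • base φ = base φ :=
  smul_base_eq_iff.2 ⟨g, rfl⟩

/-- An element fixing a vertex is conjugate to an element of the base group. -/
theorem exists_conj_of {γ δ : HNNExtension G A B φ} (h : γ • δ • base φ = δ • base φ) :
    ∃ g, γ = δ * of g * δ⁻¹ := by
  obtain ⟨g, hg⟩ := smul_base_eq_iff.1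
    (show (δ⁻¹ * γ * δ) • base φ = base φ by rw [mul_smul, mul_smul, h, inv_smul_smul])
  exact ⟨g, by rw [← hg]; group⟩

theorem mem_of_smul_t {g : G}
    (h : (of g : HNNExtension G A B φ) • (t : HNNExtension G A B φ) • base φ =
    (t : HNNExtension G A B φ) • base φ) : g ∈ B := by
  obtain ⟨g', hg'⟩ := exists_conj_of h
  have h0 : tLen (t ^ (((-1 : ℤˣ)) : ℤ) * (ReducedWord.mk (A := A) (B := B) g [(1, 1)]
      (List.isChain_singleton _)).prod φ) = 0 := by
    have : (ReducedWord.mk (A := A) (B := B) g [(1, 1)] (List.isChain_singleton _)).prod φ =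
        t * of g' := by
      simp [ReducedWord.prod, hg']
    rw [this]
    simp [tLen_of]
  rcases tLen_zpow_mul (φ := φ) (-1) ⟨g, [(1, 1)], List.isChain_singleton _⟩ with
    h1 | ⟨_, _, -, h2, -⟩
  · rw [h0] at h1
    simp at h1
  · exact h2

/-- Each edge is a translate of the edge from `base` to `t • base`, which points upwards. -/
theorem exists_edge_up {x y : Vert φ} (h : (tree φ).d x y = 1)
    (hy : (tree φ).ht y = (tree φ).ht x + 1) :
    ∃ γ : HNNExtension G A B φ, x = γ • base φ ∧ y = γ • (t : HNNExtension G A B φ) • base φ := by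
  obtain ⟨a, rfl⟩ := exists_mk x
  obtain ⟨g, u, rfl⟩ := dist_eq_one_iff h
  rcases Int.units_eq_one_or u with rfl | rfl
  · refine ⟨a * of g, ?_, ?_⟩
    · rw [mul_smul, of_smul_base, smul_base]
    · rw [smul_smul, smul_base]
      simp
  · exfalso
    change height φ _ = height φ _ + 1 at hy
    rw [height_mk, height_mk, map_mul (expSum φ), map_mul (expSum φ), expSum_of, mul_one, map_zpow,
      expSum_t, toAdd_mul] at hy
    simp at hy

/-- The stabilizer of the edge from `base` to `t • base` is `B`. -/
theorem exists_conj_edge {γ δ : HNNExtension G A B φ} (h : γ • δ • base φ = δ • base φ)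
    (h' : γ • δ • (t : HNNExtension G A B φ) • base φ = δ • (t : HNNExtension G A B φ) • base φ) :
    ∃ b ∈ B, γ = δ * of b * δ⁻¹ := by
  obtain ⟨g, rfl⟩ := exists_conj_of h
  refine ⟨g, mem_of_smul_t (φ := φ) ?_, rfl⟩
  rw [mul_smul, inv_smul_smul, mul_smul] at h'
  exact smul_left_cancel δ h'

/-- An element of the base group fixing another vertex fixes an edge at the base vertex. -/
theorem exists_conj_mem {g : G} {y : Vert φ} (hy : y ≠ base φ)
    (h : (of g : HNNExtension G A B φ) • y = y) :
    ∃ g' : G, g'⁻¹ * g * g' ∈ A ∨ g'⁻¹ * g * g' ∈ B := by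
  obtain ⟨z, hz1, hz2⟩ := (tree φ).exists_step (base φ) y hy.symm
  have hz : (of g : HNNExtension G A B φ) • z = z :=
    (tree φ).smul_eq_of_between (by omega) (of_smul_base g) h
  rcases (tree φ).ht_step _ _ hz1 with hh | hh
  · obtain ⟨γ, h1, rfl⟩ := exists_edge_up hz1 hh
    obtain ⟨g', rfl⟩ := smul_base_eq_iff.1 h1.symm
    obtain ⟨b, hb, h2⟩ := exists_conj_edge (δ := of g') (by rw [← h1, of_smul_base]) hz
    refine ⟨g', Or.inr ?_⟩
    rw [← map_inv, ← map_mul, ← map_mul] at h2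
    rw [of_inj h2]
    simpa [mul_assoc] using hb
  · obtain ⟨γ, h1, h2⟩ := exists_edge_up (by rwa [(tree φ).d_comm]) (by rw [hh, sub_add_cancel])
    rw [smul_smul] at h2
    obtain ⟨g', hg'⟩ := smul_base_eq_iff.1 h2.symm
    obtain ⟨b, hb, h3⟩ := exists_conj_edge (δ := γ) (γ := of g) (by rw [← h1, hz])
      (by rw [smul_smul γ t, ← h2, of_smul_base])
    refine ⟨g', Or.inl ?_⟩
    rw [← eq_mul_inv_iff_mul_eq] at hg'
    obtain ⟨a, rfl⟩ : ∃ a : A, (φ a : G) = b := ⟨φ.symm ⟨b, hb⟩, by simp⟩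
    have h4 : (of g : HNNExtension G A B φ) = of (g' * a * g'⁻¹) := by
      rw [h3, hg', equiv_eq_conj, map_mul, map_mul, map_inv]
      group
    rw [of_inj h4]
    simp [mul_assoc]

/-! ### HNN extensions of groups in the class `𝒞'` -/

theorem exists_fixed_of_isOfFinOrder {γ : HNNExtension G A B φ} (h : IsOfFinOrder γ) :
    ∃ x : Vert φ, γ • x = x := by
  by_contra hne
  push Not at hne
  have : Nonempty (Vert φ) := ⟨base φ⟩
  obtain ⟨p, L, hp, hL, hs⟩ := (tree φ).exists_line hne
  exact hp.not_isOfFinOrder hs hL.ne' h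

theorem exists_conj_of_isOfFinOrder {γ : HNNExtension G A B φ} (h : IsOfFinOrder γ) :
    ∃ δ g, γ = δ * of g * δ⁻¹ := by
  obtain ⟨x, hx⟩ := exists_fixed_of_isOfFinOrder h
  obtain ⟨δ, rfl⟩ := exists_smul_base x
  exact ⟨δ, exists_conj_of hx⟩

/-- Two involutions whose product fixes a vertex are simultaneously conjugate into the base
group. -/
theorem exists_conj_pair {u v : HNNExtension G A B φ} (h : IsInvolutionPair u v) {c : Vert φ}
    (hc : (u * v) • c = c) : ∃ δ u' v', IsInvolutionPair u' v' ∧ u = δ * of u' * δ⁻¹ ∧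
      v = δ * of v' * δ⁻¹ := by
  obtain ⟨m, h1, h2⟩ := (tree φ).exists_common_fixed h.1.mul_self h.2.1.mul_self hc
  obtain ⟨δ, rfl⟩ := exists_smul_base m
  obtain ⟨u', rfl⟩ := exists_conj_of h1
  obtain ⟨v', rfl⟩ := exists_conj_of h2
  exact ⟨δ, u', v', (isInvolutionPair_map of_inj).1 ((isInvolutionPair_conj δ).1 h), rfl, rfl⟩

theorem orderOf_cases (hG : ∀ h : G, orderOf h = 1 ∨ orderOf h = 2 ∨ ¬ IsOfFinOrder h)
    (h : HNNExtension G A B φ) : orderOf h = 1 ∨ orderOf h = 2 ∨ ¬ IsOfFinOrder h := by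
  by_cases hf : IsOfFinOrder h
  · obtain ⟨δ, g, rfl⟩ := exists_conj_of_isOfFinOrder hf
    have h1 : orderOf (δ * of g * δ⁻¹) = orderOf g :=
      (orderOf_injective (MulAut.conj δ).toMonoidHom (MulAut.conj δ).injective _).trans
        (orderOf_injective of of_inj g)
    rw [isOfFinOrder_conj, of_inj.isOfFinOrder_iff] at hf
    rw [h1]
    rcases hG g with h | h | h
    · exact Or.inl h
    · exact Or.inr (Or.inl h)
    · exact absurd hf h
  · exact Or.inr (Or.inr hf)

theorem not_isOfFinOrder_mul (hG : ClassC G) (u v : HNNExtension G A B φ)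
    (h : IsInvolutionPair u v) : ¬ IsOfFinOrder (u * v) := by
  intro hf
  obtain ⟨c, hc⟩ := exists_fixed_of_isOfFinOrder hf
  obtain ⟨δ, u', v', h', rfl, rfl⟩ := exists_conj_pair h hc
  have : δ * of u' * δ⁻¹ * (δ * of v' * δ⁻¹) = δ * of (u' * v') * δ⁻¹ := by
    rw [map_mul]
    group
  rw [this, isOfFinOrder_conj, of_inj.isOfFinOrder_iff] at hf
  exact hG.not_isOfFinOrder_mul h' hf

/-- A set of elements none of which is conjugate into an associated subgroup. -/
def Avoids (A B : Subgroup G) (S : Set G) : Prop :=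
  ∀ h ∈ S, ∀ g : G, g⁻¹ * h * g ∉ A ∧ g⁻¹ * h * g ∉ B

/-- Elements conjugating an element of `S` into the base group lie in the base group, since an
element of `S` fixes no vertex but the base vertex. -/
theorem exists_of_conj_of {S : Set G} (hS : Avoids A B S) {γ : HNNExtension G A B φ} {h h' : G}
    (hh : h ∈ S) (hc : γ⁻¹ * of h * γ = of h') : ∃ g, γ = of g ∧ g⁻¹ * h * g = h' := by
  have h1 : (of h : HNNExtension G A B φ) • γ • base φ = γ • base φ := by
    rw [mul_assoc, inv_mul_eq_iff_eq_mul] at hc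
    rw [smul_smul, hc, mul_smul, of_smul_base]
  by_cases h2 : γ • base φ = base φ
  · obtain ⟨g, rfl⟩ := smul_base_eq_iff.1 h2
    refine ⟨g, rfl, of_inj (φ := φ) ?_⟩
    rw [← hc, map_mul, map_mul, map_inv]
  · obtain ⟨g', h3 | h3⟩ := exists_conj_mem h2 h1
    · exact absurd h3 (hS h hh g').1
    · exact absurd h3 (hS h hh g').2

theorem quasiMalnormal_map (hC : ClassC' G) {E : Subgroup G} (hE : QuasiMalnormal E)
    (hav : Avoids A B {h | h ∈ E ∧ ¬ IsOfFinOrder h}) :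
    QuasiMalnormal (E.map (of : G →* HNNExtension G A B φ)) := by
  refine quasiMalnormal_of (orderOf_cases hC.2.1) (not_isOfFinOrder_mul hC.1) ?_
  rintro γ _ ⟨h, hh, rfl⟩ ⟨h', hh', hc⟩ hf
  rw [of_inj.isOfFinOrder_iff] at hf
  obtain ⟨g, rfl, h1⟩ := exists_of_conj_of hav ⟨hh, hf⟩ hc.symm
  exact Subgroup.mem_map_of_mem _ (hE.mem hh (by rw [h1]; exact hh') hf)

theorem malnormal_zpowers_of {k : G} (hk : Malnormal (Subgroup.zpowers k))
    (hav : Avoids A B {h | h ∈ Subgroup.zpowers k ∧ h ≠ 1}) :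
    Malnormal (Subgroup.zpowers (of k : HNNExtension G A B φ)) := by
  rw [← MonoidHom.map_zpowers]
  refine malnormal_of ?_
  rintro γ _ ⟨h, hh, rfl⟩ ⟨h', hh', hc⟩ h1
  have h2 : h ≠ 1 := by rintro rfl; exact h1 (map_one _)
  obtain ⟨g, rfl, h3⟩ := exists_of_conj_of hav ⟨hh, h2⟩ hc.symm
  exact Subgroup.mem_map_of_mem _ (hk.mem hh (by rw [h3]; exact hh') h2)

variable (φ) in
/-- The conditions on the associated subgroups under which the HNN extension of a group in the
class `𝒞'` is again in this class. -/
structure Admissible : Prop where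
  /-- A nontrivial pointwise stabilizer of a line contains an involution which is centralized by
  the setwise stabilizer. -/
  line : ∀ p : ℤ → Vert φ, (tree φ).IsLine p → ∀ a : HNNExtension G A B φ, a ≠ 1 →
    (∀ i, a • p i = p i) →
      ∃ w, IsInvolution w ∧ ∀ s ∈ axisStab (HNNExtension G A B φ) p, s * w = w * s
  /-- A quasi-malnormal infinite dihedral subgroup stays quasi-malnormal, unless its pairs of
  involutions become of type `D_ℚ`. -/
  dihedral : ∀ E : Subgroup G, QuasiMalnormal E → Nonempty (E ≃* Dih ℤ) →
    Avoids A B {h | h ∈ E ∧ ¬ IsOfFinOrder h} ∨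
      ∀ x ∈ E, ∀ y ∈ E, IsInvolutionPair x y → ∃ (γ : HNNExtension G A B φ) (x' y' : G),
        IsTypeDQ x' y' ∧ γ * of x * γ⁻¹ = of x' ∧ γ * of y * γ⁻¹ = of y'
  /-- A malnormal infinite cyclic subgroup stays malnormal, unless its generator becomes a
  translation. -/
  cyclic : ∀ k : G, ¬ IsOfFinOrder k → Malnormal (Subgroup.zpowers k) →
    Avoids A B {h | h ∈ Subgroup.zpowers k ∧ h ≠ 1} ∨
      ∃ (γ : HNNExtension G A B φ) (s : G), IsTranslation s ∧ γ * of k * γ⁻¹ = of s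
  /-- The action on pairs of distinct involutions of the base group stays free. -/
  free : ∀ u v : G, IsInvolutionPair u v → ∀ γ : HNNExtension G A B φ,
    γ * of u * γ⁻¹ = of u → γ * of v * γ⁻¹ = of v → γ = 1

section ClassC

variable (hC : ClassC' G) (hadm : Admissible φ)
include hC hadm

/-- A line translated by a product of two involutions has trivial pointwise stabilizer: otherwise
both would commute with the same involution. -/
theorem fix_line_eq_one {p : ℤ → Vert φ} (hp : (tree φ).IsLine p) {u v : HNNExtension G A B φ}
    (h : IsInvolutionPair u v) {c : ℤ} (hs : ∀ i, (u * v) • p i = p (i + c)) (hc : c ≠ 0)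
    (a : HNNExtension G A B φ) (ha : ∀ i, a • p i = p i) : a = 1 := by
  by_contra h1
  obtain ⟨w, hw, hw'⟩ := hadm.line p hp a h1 ha
  obtain ⟨hu, hv⟩ := hp.mem_axisStab_of_mul h.1 h.2.1 hs hc
  have e1 := eq_of_commute (not_isOfFinOrder_mul hC.1) h.1 hw (hw' u hu)
  have e2 := eq_of_commute (not_isOfFinOrder_mul hC.1) h.2.1 hw (hw' v hv)
  exact h.2.2 (e1.trans e2.symm)

theorem free_pairs (x y : HNNExtension G A B φ) (h : IsInvolutionPair x y)
    (γ : HNNExtension G A B φ) (hx : γ * x * γ⁻¹ = x) (hy : γ * y * γ⁻¹ = y) : γ = 1 := by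
  by_cases hc : ∃ c : Vert φ, (x * y) • c = c
  · obtain ⟨c, hc⟩ := hc
    obtain ⟨δ, u, v, huv, rfl, rfl⟩ := exists_conj_pair h hc
    have key := hadm.free u v huv (δ⁻¹ * γ * δ)
      (by rw [← mul_right_inj δ, ← mul_left_inj δ⁻¹]; convert hx using 1; group)
      (by rw [← mul_right_inj δ, ← mul_left_inj δ⁻¹]; convert hy using 1; group)
    have := congrArg (fun z => δ * z * δ⁻¹) key
    simpa [mul_assoc] using this
  · push Not at hc
    have : Nonempty (Vert φ) := ⟨base φ⟩
    obtain ⟨p, L, hp, hL, hs⟩ := (tree φ).exists_line hc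
    have hK := fix_line_eq_one hC hadm hp h hs hL.ne'
    obtain ⟨k, hk⟩ := hp.exists_reflect hK h.1 (hp.mem_axisStab_of_mul h.1 h.2.1 hs hL.ne').1
    rw [mul_inv_eq_iff_eq_mul] at hx hy
    have hxy : γ * (x * y) = x * y * γ := by rw [← mul_assoc, hx, mul_assoc, hy, mul_assoc]
    have hγ : γ ∈ axisStab (HNNExtension G A B φ) p :=
      hp.mem_axisStab_of_conj hs (c' := L) (fun i => by
        rw [mul_assoc, ← hxy, inv_mul_cancel_left, hs]) hL.ne'
    rcases mem_axisStab_cases hγ with ⟨c, h'⟩ | ⟨k', h'⟩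
    · have h1 := congrArg (fun z => z • p 0) hx
      simp only [mul_smul, hk, h'] at h1
      have := hp.injective h1
      exact hK γ fun i => by rw [h']; congr 1; omega
    · have h1 := congrArg (fun z => z • p 0) hxy
      rw [mul_smul, mul_smul (x * y), hs, h', h', hs] at h1
      have := hp.injective h1
      omega

/-- A pair of type `D_ℚ` is conjugate to a pair of type `D_ℚ` of the base group. Its product has
roots of all orders, and so fixes a vertex, as translation lengths are integers. -/
theorem exists_conj_typeDQ {x y : HNNExtension G A B φ} (h : IsInvolutionPair x y)
    (hq : IsTypeDQ x y) : ∃ (γ : HNNExtension G A B φ) (x' y' : G), IsInvolutionPair x' y' ∧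
      IsTypeDQ x' y' ∧ γ * x * γ⁻¹ = of x' ∧ γ * y * γ⁻¹ = of y' := by
  obtain ⟨D, hD, ⟨d⟩⟩ := hq
  have hxyD := D.mul_mem (mem_of_closure_le hD).1 (mem_of_closure_le hD).2
  have hinf := not_isOfFinOrder_mul hC.1 x y h
  by_cases hc : ∃ c : Vert φ, (x * y) • c = c
  · obtain ⟨c, hc⟩ := hc
    obtain ⟨δ, u, v, huv, rfl, rfl⟩ := exists_conj_pair h hc
    have hcu : δ⁻¹ * (δ * of u * δ⁻¹) * δ⁻¹⁻¹ = of u := by group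
    have hcv : δ⁻¹ * (δ * of v * δ⁻¹) * δ⁻¹⁻¹ = of v := by group
    rcases hC.1.type_pairs u v huv with ⟨E, hE, ⟨e⟩, hqm⟩ | hdq
    · rcases hadm.dihedral E hqm ⟨e⟩ with hav | hcon
      · exfalso
        have h1 := (quasiMalnormal_map (φ := φ) hC hqm hav).conj (orderOf_cases hC.2.1)
          (not_isOfFinOrder_mul hC.1) δ
        obtain ⟨e'⟩ := nonempty_conjSubgroup_mulEquiv
          ((E.equivMapOfInjective (of : G →* HNNExtension G A B φ) of_inj).symm.trans e) δ
        refine not_mem_quasiMalnormal h1 e' d hxyD hinf (mul_mem ?_ ?_)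
        · exact conj_mem_conjSubgroup (Subgroup.mem_map_of_mem _ (mem_of_closure_le hE).1)
        · exact conj_mem_conjSubgroup (Subgroup.mem_map_of_mem _ (mem_of_closure_le hE).2)
      · obtain ⟨γ, x', y', h1, h2, h3⟩ := hcon u (mem_of_closure_le hE).1 v
          (mem_of_closure_le hE).2 huv
        refine ⟨γ * δ⁻¹, x', y', ?_, h1, ?_, ?_⟩
        · rw [← isInvolutionPair_map (f := (of : G →* HNNExtension G A B φ)) of_inj, ← h2,
            ← h3, isInvolutionPair_conj, isInvolutionPair_map of_inj]
          exact huv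
        · rw [← h2]; group
        · rw [← h3]; group
    · exact ⟨δ⁻¹, u, v, huv, hdq, hcu, hcv⟩
  · exfalso
    push Not at hc
    have : Nonempty (Vert φ) := ⟨base φ⟩
    obtain ⟨p, L, hp, hL, hs⟩ := (tree φ).exists_line hc
    obtain ⟨q, hq, hxy⟩ := exists_rot_of_infinite d hxyD hinf
    -- a root of order greater than the translation length
    set n : ℕ := L.natAbs + 1 with hn
    have hroot : ((d.symm (Dih.rot (q / n)) : D) : HNNExtension G A B φ) ^ n = x * y := by
      rw [hxy, ← Subgroup.coe_pow, ← map_pow, Dih.rot_pow, nsmul_eq_mul, mul_div_cancel₀]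
      exact_mod_cast (by omega : n ≠ 0)
    obtain ⟨q', L', hq', hL', hs'⟩ :=
      (tree φ).exists_line (g := ((d.symm (Dih.rot (q / n)) : D) : HNNExtension G A B φ))
        fun z hz => hc z (by
          rw [← hroot]
          exact pow_smul_eq hz n)
    have h1 : ∀ i, (x * y) • q' i = q' (i + n * L') := fun i => by
      rw [← hroot, smul_pow_line hs']
    have h2 := hp.natAbs_le hs (y := q' 0) (c' := (n * L').natAbs) fun m => by
      rw [smul_pow_line h1, hq', zero_add, zero_sub, Int.natAbs_neg, Int.natAbs_mul,
        Int.natAbs_natCast]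
    rw [Int.natAbs_mul, Int.natAbs_natCast] at h2
    have h3 : 1 ≤ L'.natAbs := by omega
    nlinarith

theorem type_pairs (x y : HNNExtension G A B φ) (h : IsInvolutionPair x y) :
    IsTypeDZ x y ∨ IsTypeDQ x y := by
  by_cases hc : ∃ c : Vert φ, (x * y) • c = c
  · obtain ⟨c, hc⟩ := hc
    obtain ⟨δ, u, v, huv, rfl, rfl⟩ := exists_conj_pair h hc
    rcases hC.1.type_pairs u v huv with ⟨E, hE, ⟨e⟩, hqm⟩ | hdq
    · rcases hadm.dihedral E hqm ⟨e⟩ with hav | hcon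
      · left
        refine IsTypeDZ.conj (orderOf_cases hC.2.1) (not_isOfFinOrder_mul hC.1) ?_ δ
        refine ⟨E.map of, ?_, ⟨(E.equivMapOfInjective of of_inj).symm.trans e⟩,
          quasiMalnormal_map hC hqm hav⟩
        rw [Subgroup.closure_le]
        rintro _ (rfl | rfl)
        · exact Subgroup.mem_map_of_mem _ (mem_of_closure_le hE).1
        · exact Subgroup.mem_map_of_mem _ (mem_of_closure_le hE).2
      · right
        obtain ⟨γ, x', y', h1, h2, h3⟩ := hcon u (mem_of_closure_le hE).1 v
          (mem_of_closure_le hE).2 huv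
        have h4 := (h1.map (f := (of : G →* HNNExtension G A B φ)) of_inj).conj γ⁻¹
        rw [← h2, ← h3] at h4
        have h5 := h4.conj δ
        convert h5 using 1 <;> group
    · exact Or.inr ((hdq.map of_inj).conj δ)
  · push Not at hc
    have : Nonempty (Vert φ) := ⟨base φ⟩
    obtain ⟨p, L, hp, hL, hs⟩ := (tree φ).exists_line hc
    exact Or.inl (hp.isTypeDZ (fix_line_eq_one hC hadm hp h hs hL.ne') h hs hL.ne'
      (orderOf_cases hC.2.1) (not_isOfFinOrder_mul hC.1))

theorem classC : ClassC (HNNExtension G A B φ) where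
  transitive_involutions x y hx hy := by
    obtain ⟨δ, g, rfl⟩ := exists_conj_of_isOfFinOrder hx.isOfFinOrder
    obtain ⟨δ', g', rfl⟩ := exists_conj_of_isOfFinOrder hy.isOfFinOrder
    rw [isInvolution_conj, IsInvolution.map of_inj] at hx hy
    obtain ⟨k, rfl⟩ := hC.1.transitive_involutions g g' hx hy
    refine ⟨δ' * of k * δ⁻¹, ?_⟩
    rw [map_mul, map_mul, map_inv]
    group
  free_pairs := free_pairs hC hadm
  type_pairs := type_pairs hC hadm
  exists_typeDQ := by
    obtain ⟨x, y, h, hq⟩ := hC.1.exists_typeDQ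
    exact ⟨of x, of y, (isInvolutionPair_map of_inj).2 h, hq.map of_inj⟩
  transitive_typeDQ x y x' y' h hq h' hq' := by
    obtain ⟨γ, u, v, h1, h2, h3, h4⟩ := exists_conj_typeDQ hC hadm h hq
    obtain ⟨γ', u', v', h1', h2', h3', h4'⟩ := exists_conj_typeDQ hC hadm h' hq'
    obtain ⟨g, hg1, hg2⟩ := hC.1.transitive_typeDQ u v u' v' h1 h2 h1' h2'
    have key : ∀ {z z' : HNNExtension G A B φ} {w w' : G}, γ * z * γ⁻¹ = of w →
        γ' * z' * γ'⁻¹ = of w' → g * w * g⁻¹ = w' →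
        (γ'⁻¹ * of g * γ) * z * (γ'⁻¹ * of g * γ)⁻¹ = z' := by
      intro z z' w w' e1 e2 e3
      have e4 : z' = γ'⁻¹ * of w' * γ' := by rw [← e2]; group
      rw [e4, ← e3, map_mul, map_mul, ← e1, map_inv]
      group
    exact ⟨γ'⁻¹ * of g * γ, key h3 h3' hg1, key h4 h4' hg2⟩

theorem threeType : ThreeType (HNNExtension G A B φ) := by
  refine ⟨orderOf_cases hC.2.1, fun h hf => ?_⟩
  by_cases hc : ∃ c : Vert φ, h • c = c
  · obtain ⟨c, hc⟩ := hc
    obtain ⟨δ, rfl⟩ := exists_smul_base c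
    obtain ⟨g, rfl⟩ := exists_conj_of hc
    rw [isOfFinOrder_conj, of_inj.isOfFinOrder_iff] at hf
    rcases hC.2.2 g hf with h1 | h1 | ⟨-, k, hk, hm⟩
    · exact Or.inl ((h1.map of_inj).conj δ)
    · exact Or.inr (Or.inl ((h1.map of_inj).conj δ))
    · rcases hadm.cyclic k (not_isOfFinOrder_of_mem_zpowers' hf hk) hm with hav | ⟨γ, s, h1, h2⟩
      · right; right
        refine IsIsolated.conj ⟨by rwa [of_inj.isOfFinOrder_iff], of k, ?_,
          malnormal_zpowers_of hm hav⟩ δ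
        rw [← MonoidHom.map_zpowers]
        exact Subgroup.mem_map_of_mem _ hk
      · left
        obtain ⟨n, rfl⟩ := Subgroup.mem_zpowers_iff.1 hk
        have hn : n ≠ 0 := by
          rintro rfl
          exact hf (by rw [zpow_zero]; exact IsOfFinOrder.one)
        refine IsTranslation.conj δ (IsTranslation.of_conj γ ?_)
        rw [map_zpow, ← conj_zpow, h2, ← map_zpow]
        exact (h1.zpow hn).map of_inj
  · push Not at hc
    have : Nonempty (Vert φ) := ⟨base φ⟩
    obtain ⟨p, L, hp, hL, hs⟩ := (tree φ).exists_line hc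
    by_cases hK : ∀ a : HNNExtension G A B φ, (∀ i, a • p i = p i) → a = 1
    · rcases hp.isTranslation_or_isIsolated hK hs hL.ne' with h1 | h1
      · exact Or.inl h1
      · exact Or.inr (Or.inr h1)
    · push Not at hK
      obtain ⟨a, ha, h1⟩ := hK
      obtain ⟨w, hw, hw'⟩ := hadm.line p hp a h1 ha
      exact Or.inr (Or.inl ⟨hf, w, hw, hw' h (mem_axisStab_of_translate hs)⟩)

/-- The class `𝒞'` is stable under HNN extensions with admissible associated subgroups. -/
theorem classC' : ClassC' (HNNExtension G A B φ) := ⟨classC hC hadm, threeType hC hadm⟩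

end ClassC

end HNN

namespace HNN

open HNNExtension TreeAction

variable {G : Type u} [Group G] {A B : Subgroup G} {φ : A ≃* B}

/-! ### Associated subgroups in a quasi-malnormal subgroup and in `D_ℚ` -/

theorem exists_edge_down {x y : Vert φ} (h : (tree φ).d x y = 1)
    (hy : (tree φ).ht y = (tree φ).ht x - 1) :
    ∃ δ : HNNExtension G A B φ, x = δ • base φ ∧ y = δ • (t : HNNExtension G A B φ)⁻¹ • base φ := by
  obtain ⟨γ, h1, h2⟩ := exists_edge_up (by rwa [(tree φ).d_comm]) (show _ = _ + 1 by
    rw [hy, sub_add_cancel])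
  refine ⟨γ * t, ?_, ?_⟩
  · rw [h2, mul_smul]
  · rw [h1, smul_smul, mul_inv_cancel_right]

/-- The stabilizer of the edge from `base` to `t⁻¹ • base` is `A`. -/
theorem exists_conj_edge_down {γ δ : HNNExtension G A B φ} (h : γ • δ • base φ = δ • base φ)
    (h' : γ • δ • (t : HNNExtension G A B φ)⁻¹ • base φ =
      δ • (t : HNNExtension G A B φ)⁻¹ • base φ) : ∃ a ∈ A, γ = δ * of a * δ⁻¹ := by
  obtain ⟨b, hb, h1⟩ := exists_conj_edge (φ := φ) (γ := γ) (δ := δ * t⁻¹)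
    (by rw [mul_smul, h']) (by rw [mul_smul, inv_smul_smul, h])
  refine ⟨φ.symm ⟨b, hb⟩, (φ.symm ⟨b, hb⟩).2, ?_⟩
  rw [h1, equiv_symm_eq_conj (φ := φ) ⟨b, hb⟩]
  group

theorem exists_of_smul_base_eq {γ δ : HNNExtension G A B φ} (h : γ • base φ = δ • base φ) :
    ∃ g, δ = γ * of g := by
  obtain ⟨g, hg⟩ := smul_base_eq_iff.1 (show (γ⁻¹ * δ) • base φ = base φ by
    rw [mul_smul, ← h, inv_smul_smul])
  exact ⟨g, by rw [← hg, mul_inv_cancel_left]⟩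

/-- If `γ` fixes a vertex fixed by two distinct involutions which it centralizes, then `γ = 1`. -/
theorem eq_one_of_fixed (hC : ClassC G) {u v γ : HNNExtension G A B φ} (h : IsInvolutionPair u v)
    (hu : γ * u * γ⁻¹ = u) (hv : γ * v * γ⁻¹ = v) {x : Vert φ} (hx : γ • x = x) (hux : u • x = x)
    (hvx : v • x = x) : γ = 1 := by
  obtain ⟨δ, rfl⟩ := exists_smul_base x
  obtain ⟨g, rfl⟩ := exists_conj_of hx
  obtain ⟨u, rfl⟩ := exists_conj_of hux
  obtain ⟨v, rfl⟩ := exists_conj_of hvx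
  rw [isInvolutionPair_conj, isInvolutionPair_map of_inj] at h
  have key : ∀ w : G, δ * of g * δ⁻¹ * (δ * of w * δ⁻¹) * (δ * of g * δ⁻¹)⁻¹ =
      δ * of w * δ⁻¹ → g * w * g⁻¹ = w := fun w hw => by
    apply of_inj (φ := φ)
    rw [← mul_right_inj δ, ← mul_left_inj δ⁻¹, ← hw, map_mul, map_mul, map_inv]
    group
  rw [hC.free_pairs u v h g (key u hu) (key v hv), map_one]
  group

section QuasiMalnormal

variable (hC : ClassC' G) (hA : QuasiMalnormal A) {D : Subgroup G} (d : D ≃* Dih ℚ) (hB : B ≤ D)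
  (hAD : ∀ a ∈ A, ¬ IsOfFinOrder a → ∀ g : G, g⁻¹ * a * g ∉ D)

include hA hB hAD in
/-- Acylindricity: only elements of finite order fix a vertex, a lower neighbour and another
neighbour. -/
theorem isOfFinOrder_of_fix {x y y' : Vert φ} (hy : (tree φ).d x y = 1)
    (hy' : (tree φ).d x y' = 1) (hne : y ≠ y') (hh : (tree φ).ht y = (tree φ).ht x - 1)
    {a : HNNExtension G A B φ} (hx : a • x = x) (hay : a • y = y) (hay' : a • y' = y') :
    IsOfFinOrder a := by
  by_contra hf
  obtain ⟨δ, rfl, rfl⟩ := exists_edge_down hy hh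
  obtain ⟨h, hhA, rfl⟩ := exists_conj_edge_down hx hay
  rw [isOfFinOrder_conj, of_inj.isOfFinOrder_iff] at hf
  have key : ∀ (g b : G), δ * of h * δ⁻¹ = (δ * of g) * of b * (δ * of g)⁻¹ →
      g⁻¹ * h * g = b := fun g b hb => by
    apply of_inj (φ := φ)
    rw [map_mul, map_mul, map_inv]
    have := congrArg (fun z => (of g)⁻¹ * (δ⁻¹ * z * δ) * of g) hb
    simpa [mul_assoc] using this
  rcases (tree φ).ht_step _ _ hy' with h1 | h1
  · obtain ⟨γ, h2, rfl⟩ := exists_edge_up hy' h1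
    rw [h2] at hx
    obtain ⟨b, hb, h3⟩ := exists_conj_edge hx hay'
    obtain ⟨g, rfl⟩ := exists_of_smul_base_eq h2
    exact hAD h hhA hf g (by rw [key g b h3]; exact hB hb)
  · obtain ⟨γ, h2, rfl⟩ := exists_edge_down hy' h1
    rw [h2] at hx
    obtain ⟨b, hb, h3⟩ := exists_conj_edge_down hx hay'
    obtain ⟨g, rfl⟩ := exists_of_smul_base_eq h2
    have hg : g ∈ A := hA.mem hhA (by rw [key g b h3]; exact hb) hf
    apply hne
    rw [mul_smul, smul_smul (of g), of_mul_inv_t (φ := φ) ⟨g, hg⟩, mul_smul t⁻¹, of_smul_base]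

include hC hA hB hAD in
/-- The pointwise stabilizer of a line is periodic by acylindricity. If it is nontrivial, then it
has order two, and being normalized by the setwise stabilizer, it is centralized by it. -/
theorem exists_involution_of_line {p : ℤ → Vert φ} (hp : (tree φ).IsLine p)
    {a : HNNExtension G A B φ} (ha : a ≠ 1) (hfix : ∀ i, a • p i = p i) :
    ∃ w, IsInvolution w ∧ ∀ s ∈ axisStab (HNNExtension G A B φ) p, s * w = w * s := by
  have hfin : ∀ b ∈ fixingSubgroup (HNNExtension G A B φ) (Set.range p), IsOfFinOrder b := by
    intro b hb
    rw [mem_fixingSubgroup_iff] at hb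
    have hb' : ∀ i, b • p i = p i := fun i => hb _ ⟨i, rfl⟩
    have d1 := hp 0 1
    have d2 := hp 1 0
    have d3 := hp 0 (-1)
    have d4 := hp 1 2
    rcases (tree φ).ht_step (p 0) (p 1) (by omega) with h | h
    · exact isOfFinOrder_of_fix hA hB hAD (x := p 1) (y := p 0) (y' := p 2) (by omega) (by omega)
        (hp.injective.ne (by norm_num)) (by omega) (hb' _) (hb' _) (hb' _)
    · exact isOfFinOrder_of_fix hA hB hAD (x := p 0) (y := p 1) (y' := p (-1)) (by omega)
        (by omega) (hp.injective.ne (by norm_num)) (by omega) (hb' _) (hb' _) (hb' _)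
  have ha' : a ∈ fixingSubgroup (HNNExtension G A B φ) (Set.range p) := by
    rw [mem_fixingSubgroup_iff]
    rintro _ ⟨i, rfl⟩
    exact hfix i
  have key := fun b hb hb1 => eq_of_periodic (orderOf_cases hC.2.1) (not_isOfFinOrder_mul hC.1) hfin
    (u := a) (v := b) ha' hb ha hb1
  refine ⟨a, (key a ha' ha).1, fun s hs => ?_⟩
  have h1 : s * a * s⁻¹ ∈ fixingSubgroup (HNNExtension G A B φ) (Set.range p) := by
    rw [mem_fixingSubgroup_iff]
    rintro _ ⟨i, rfl⟩
    obtain ⟨ε, k, hk⟩ := inv_mem hs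
    rw [mul_smul, mul_smul, hk, hfix, ← hk, smul_inv_smul]
  have h2 : s * a * s⁻¹ ≠ 1 := fun h => ha (by
    have := congrArg (fun z => s⁻¹ * z * s) h
    simpa [mul_assoc] using this)
  have h3 := (key _ h1 h2).2
  rw [eq_mul_inv_iff_mul_eq] at h3
  exact h3.symm

include hC hA hB hAD in
/-- An element centralizing two distinct involutions and moving a vertex fixed by them moves it to
a vertex with a common lower neighbour. -/
theorem exists_lower_fixed {u v γ : HNNExtension G A B φ} (h : IsInvolutionPair u v)
    (hu : γ * u * γ⁻¹ = u) (hv : γ * v * γ⁻¹ = v) {x : Vert φ} (hux : u • x = x)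
    (hvx : v • x = x) (hx : γ • x ≠ x) :
    ∃ m : Vert φ, u • m = m ∧ v • m = m ∧ (tree φ).d x m = 1 ∧
      (tree φ).ht m = (tree φ).ht x - 1 := by
  have hf := not_isOfFinOrder_mul (φ := φ) hC.1 u v h
  have acyl : ∀ x y y' : Vert φ, (tree φ).d x y = 1 → (tree φ).d x y' = 1 → y ≠ y' →
      (tree φ).ht y = (tree φ).ht x - 1 → u • x = x → v • x = x → u • y = y → v • y = y →
      u • y' = y' → v • y' = y' → False := by
    intro x y y' h1 h2 h3 h4 a1 a2 a3 a4 a5 a6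
    exact hf (isOfFinOrder_of_fix hA hB hAD h1 h2 h3 h4 (by rw [mul_smul, a2, a1])
      (by rw [mul_smul, a4, a3]) (by rw [mul_smul, a6, a5]))
  rw [mul_inv_eq_iff_eq_mul] at hu hv
  have hfu : ∀ y : Vert φ, u • y = y → u • γ • y = γ • y := fun y hy => by
    rw [smul_smul, ← hu, mul_smul, hy]
  have hfv : ∀ y : Vert φ, v • y = y → v • γ • y = γ • y := fun y hy => by
    rw [smul_smul, ← hv, mul_smul, hy]
  have hpos := (tree φ).d_pos hx.symm
  obtain ⟨y, hy1, hy2⟩ := (tree φ).exists_step x (γ • x) hx.symm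
  have hyu := (tree φ).smul_eq_of_between (by omega : (tree φ).d x y + (tree φ).d y (γ • x) = _)
    hux (hfu x hux)
  have hyv := (tree φ).smul_eq_of_between (by omega : (tree φ).d x y + (tree φ).d y (γ • x) = _)
    hvx (hfv x hvx)
  rcases (tree φ).ht_step x y hy1 with hh | hh
  · exfalso
    by_cases h1 : y = γ • x
    · -- `γ` moves `x` to a neighbour, and `γ • x` lies between vertices of different heights
      subst h1
      have e1 := (tree φ).ht_smul γ x
      have e2 := (tree φ).ht_smul γ (γ • x)
      refine acyl (γ • x) x (γ • γ • x) (by rwa [(tree φ).d_comm])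
        (by rwa [(tree φ).d_smul]) (fun h => ?_) (by omega) hyu hyv hux hvx
        (hfu _ hyu) (hfv _ hyv)
      rw [← h] at e2
      omega
    · obtain ⟨z, hz1, hz2⟩ := (tree φ).exists_step y (γ • x) h1
      refine acyl y x z (by rwa [(tree φ).d_comm]) hz1 (fun h => ?_) (by omega) hyu hyv hux hvx
        ?_ ?_
      · rw [← h] at hz2
        omega
      · exact (tree φ).smul_eq_of_between (by omega : (tree φ).d y z + (tree φ).d z (γ • x) = _)
          hyu (hfu x hux)
      · exact (tree φ).smul_eq_of_between (by omega : (tree φ).d y z + (tree φ).d z (γ • x) = _)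
          hyv (hfv x hvx)
  · exact ⟨y, hyu, hyv, hy1, hh⟩

include hC hA d hB hAD in
/-- Let `A` be quasi-malnormal and `B` contained in a subgroup `D_ℚ`, such that no element of `A` of
infinite order is conjugate into `D_ℚ`. A dihedral or cyclic subgroup sharing an element of infinite
order with `A` is contained in `A`, and so is conjugated into `D_ℚ` by the stable letter. The
vertices fixed by a pair of involutions form a set of diameter at most two, all but one of its
vertices lying above the same vertex; so an element centralizing the pair fixes a vertex in this
set. -/
theorem admissible_of_quasiMalnormal : Admissible φ where
  line p hp a ha hfix := exists_involution_of_line hC hA hB hAD hp ha hfix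
  dihedral E hE := by
    rintro ⟨e⟩
    by_cases hav : Avoids A B {h | h ∈ E ∧ ¬ IsOfFinOrder h}
    · exact Or.inl hav
    right
    simp only [Avoids, Set.mem_ofPred_eq, not_forall] at hav
    obtain ⟨h, ⟨hh, hf⟩, g, hg⟩ := hav
    rw [not_and_or, not_not, not_not] at hg
    have hh' : g⁻¹ * h * g ∈ conjSubgroup g⁻¹ E := by
      rw [mem_conjSubgroup]
      simpa [mul_assoc] using hh
    have hf' : ¬ IsOfFinOrder (g⁻¹ * h * g) := by
      have := isOfFinOrder_conj g⁻¹ (x := h)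
      rw [inv_inv] at this
      rwa [this]
    obtain ⟨e'⟩ := nonempty_conjSubgroup_mulEquiv e g⁻¹
    rcases hg with hg | hg
    · have hle := hA.le_of_infinite e' hg hh' hf'
      intro x hx y hy _
      have hx' : g⁻¹ * x * g ∈ A := hle (by rw [mem_conjSubgroup]; simpa [mul_assoc] using hx)
      have hy' : g⁻¹ * y * g ∈ A := hle (by rw [mem_conjSubgroup]; simpa [mul_assoc] using hy)
      refine ⟨t * of g⁻¹, φ ⟨_, hx'⟩, φ ⟨_, hy'⟩, ⟨D, ?_, ⟨d⟩⟩, ?_, ?_⟩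
      · rw [Subgroup.closure_le]
        rintro _ (rfl | rfl)
        · exact hB (φ ⟨_, hx'⟩).2
        · exact hB (φ ⟨_, hy'⟩).2
      · rw [equiv_eq_conj]
        simp [mul_assoc]
      · rw [equiv_eq_conj]
        simp [mul_assoc]
    · exact absurd hh' (not_mem_quasiMalnormal (hE.conj hC.2.1
        (fun _ _ => hC.1.not_isOfFinOrder_mul) g⁻¹) e' d (hB hg) hf')
  cyclic k hk hm := by
    by_cases hav : Avoids A B {h | h ∈ Subgroup.zpowers k ∧ h ≠ 1}
    · exact Or.inl hav
    right
    simp only [Avoids, Set.mem_ofPred_eq, not_forall] at hav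
    obtain ⟨h, ⟨hh, h1⟩, g, hg⟩ := hav
    rw [not_and_or, not_not, not_not] at hg
    have hf := not_isOfFinOrder_of_mem_zpowers hk hh h1
    have hconj : ∀ z : G, IsOfFinOrder (g⁻¹ * z * g) ↔ IsOfFinOrder z := fun z => by
      have := isOfFinOrder_conj g⁻¹ (x := z)
      rwa [inv_inv] at this
    have hf' : ¬ IsOfFinOrder (g⁻¹ * h * g) := by rwa [hconj]
    rcases hg with hg | hg
    · have hkA : g⁻¹ * k * g ∈ A := by
        refine hA.mem hg ?_ hf'
        obtain ⟨n, rfl⟩ := Subgroup.mem_zpowers_iff.1 hh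
        convert hg using 1
        have : k⁻¹ * k ^ n * k = k ^ n := by
          rw [mul_assoc, ← zpow_add_one, add_comm, zpow_one_add, inv_mul_cancel_left]
        conv_rhs => rw [← this]
        group
      refine ⟨t * of g⁻¹, φ ⟨_, hkA⟩, isTranslation_of_mem d (hB (φ ⟨_, hkA⟩).2) ?_, ?_⟩
      · intro h2
        have h3 := (φ.injective.isOfFinOrder_iff (f := φ.toMonoidHom) (x := ⟨_, hkA⟩)).1
          (Submonoid.isOfFinOrder_coe.1 h2)
        exact hk ((hconj k).1 (Submonoid.isOfFinOrder_coe.2 h3))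
      · rw [equiv_eq_conj]
        simp [mul_assoc]
    · exfalso
      have h2 := isTranslation_of_mem d (hB hg) hf'
      have h3 : IsIsolated h := ⟨hf, k, hh, hm⟩
      refine h3.not_isTranslation (IsTranslation.of_conj g⁻¹ ?_)
      rwa [inv_inv]
  free u v huv γ hu hv := by
    have huv' := (isInvolutionPair_map (f := (of : G →* HNNExtension G A B φ)) of_inj).2 huv
    by_cases h0 : γ • base φ = base φ
    · exact eq_one_of_fixed hC.1 huv' hu hv h0 (of_smul_base u) (of_smul_base v)
    · obtain ⟨m, m1, m2, m3, m4⟩ := exists_lower_fixed hC hA hB hAD huv' hu hv (of_smul_base u)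
        (of_smul_base v) h0
      by_cases h1 : γ • m = m
      · exact eq_one_of_fixed hC.1 huv' hu hv h1 m1 m2
      · obtain ⟨m', m1', m2', m3', m4'⟩ := exists_lower_fixed hC hA hB hAD huv' hu hv m1 m2 h1
        exfalso
        refine not_isOfFinOrder_mul hC.1 _ _ huv' (isOfFinOrder_of_fix hA hB hAD (x := m)
          (y := m') (y' := base φ) m3' (by rwa [(tree φ).d_comm]) (fun h => ?_) m4' ?_ ?_ ?_)
        · rw [h] at m4'
          omega
        · rw [mul_smul, m2, m1]
        · rw [mul_smul, m2', m1']
        · rw [mul_smul, of_smul_base, of_smul_base]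

end QuasiMalnormal

/-! ### Associated subgroups in the centralizer of an involution -/

section Centralizer

variable (hC : ClassC' G) {x : G} (hx : IsInvolution x) (hxA : x ∈ A) (hφ : (φ ⟨x, hxA⟩ : G) = x)
  (hA : ∀ a ∈ A, a * x = x * a) (hB : ∀ b ∈ B, b * x = x * b)

/-- `w` is an involution fixing the vertices `y` and `z`, and it is central in their common
stabilizer. -/
def IsEdgeInvolution (w : HNNExtension G A B φ) (y z : Vert φ) : Prop :=
  IsInvolution w ∧ w • y = y ∧ w • z = z ∧
    ∀ b : HNNExtension G A B φ, b • y = y → b • z = z → b * w = w * b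

theorem IsEdgeInvolution.symm {w : HNNExtension G A B φ} {y z : Vert φ}
    (h : IsEdgeInvolution w y z) : IsEdgeInvolution w z y :=
  ⟨h.1, h.2.2.1, h.2.1, fun b h1 h2 => h.2.2.2 b h2 h1⟩

include hx hφ hB in
/-- The edge from `base` to `t • base` has the involution `x`. -/
theorem exists_isEdgeInvolution {y z : Vert φ} (h : (tree φ).d y z = 1) :
    ∃ w, IsEdgeInvolution w y z := by
  wlog hh : (tree φ).ht z = (tree φ).ht y + 1 generalizing y z
  · obtain ⟨w, hw⟩ := this (y := z) (z := y) (by rwa [(tree φ).d_comm]) (by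
      have := (tree φ).ht_step y z h
      omega)
    exact ⟨w, hw.symm⟩
  obtain ⟨γ, rfl, rfl⟩ := exists_edge_up h hh
  have htx : (of x : HNNExtension G A B φ) * t = t * of x := by
    have := t_mul_of (φ := φ) ⟨x, hxA⟩
    rw [hφ] at this
    exact this.symm
  refine ⟨γ * of x * γ⁻¹, ?_, ?_, ?_, fun b h1 h2 => ?_⟩
  · rwa [isInvolution_conj, IsInvolution.map of_inj]
  · rw [mul_smul, inv_smul_smul, mul_smul, of_smul_base]
  · rw [mul_smul, inv_smul_smul, mul_smul, smul_smul (of x), htx, mul_smul t, of_smul_base]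
  · obtain ⟨b, hb, rfl⟩ := exists_conj_edge h1 h2
    have : (of b : HNNExtension G A B φ) * of x = of x * of b := by
      rw [← map_mul, hB b hb, map_mul]
    calc γ * of b * γ⁻¹ * (γ * of x * γ⁻¹) = γ * (of b * of x) * γ⁻¹ := by group
      _ = γ * of x * γ⁻¹ * (γ * of b * γ⁻¹) := by rw [this]; group

include hC in
theorem IsEdgeInvolution.unique {w w' : HNNExtension G A B φ} {y z : Vert φ}
    (h : IsEdgeInvolution w y z) (h' : IsEdgeInvolution w' y z) : w = w' :=
  eq_of_commute (not_isOfFinOrder_mul hC.1) h.1 h'.1 (h'.2.2.2 w h.2.1 h.2.2.1)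

include hC in
/-- Edges at a common vertex which are fixed by the same nontrivial element have the same
involution. -/
theorem IsEdgeInvolution.eq_of_adj {w w' a : HNNExtension G A B φ} {y y' z : Vert φ}
    (h : IsEdgeInvolution w y z) (h' : IsEdgeInvolution w' z y') (ha : a ≠ 1) (hy : a • y = y)
    (hy' : a • y' = y') (hz : a • z = z) : w = w' := by
  by_contra hne
  have c1 := h.2.2.2 a hy hz
  have c2 := h'.2.2.2 a hz hy'
  exact ha (eq_one_of_fixed hC.1 ⟨h.1, h'.1, hne⟩ (by rw [c1, mul_inv_cancel_right])
    (by rw [c2, mul_inv_cancel_right]) hz h.2.2.1 h'.2.1)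

theorem IsEdgeInvolution.smul {w : HNNExtension G A B φ} {y z : Vert φ}
    (h : IsEdgeInvolution w y z) (s : HNNExtension G A B φ) :
    IsEdgeInvolution (s * w * s⁻¹) (s • y) (s • z) := by
  refine ⟨(isInvolution_conj s).2 h.1, ?_, ?_, fun b h1 h2 => ?_⟩
  · rw [mul_smul, inv_smul_smul, mul_smul, h.2.1]
  · rw [mul_smul, inv_smul_smul, mul_smul, h.2.2.1]
  · have := h.2.2.2 (s⁻¹ * b * s) (by rw [mul_smul, mul_smul, h1, inv_smul_smul])
      (by rw [mul_smul, mul_smul, h2, inv_smul_smul])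
    have h3 := congrArg (fun z => s * z * s⁻¹) this
    simpa [mul_assoc] using h3

include hC hx hφ hA hB in
/-- Let `A` and `B` centralize an involution `x` with `φ x = x`. Then each edge has its own
involution, and this is constant along a line fixed by a nontrivial element. Translations and
isolated elements of the base group are not conjugate into `A` or `B`, as they commute with no
involution. -/
theorem admissible_of_centralizer : Admissible φ where
  line p hp a ha hfix := by
    have hadj : ∀ i, (tree φ).d (p i) (p (i + 1)) = 1 := fun i => by
      rw [hp]
      omega
    choose w hw using fun i => exists_isEdgeInvolution hx hxA hφ hB (hadj i)
    have hsucc : ∀ i, w (i + 1) = w i := fun i =>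
      ((hw i).eq_of_adj hC (hw (i + 1)) ha (hfix _) (hfix _) (hfix _)).symm
    have hconst : ∀ i, w i = w 0 := fun i => by
      induction i using Int.induction_on with
      | zero => rfl
      | succ i ih => rw [hsucc, ih]
      | pred i ih => rw [← hsucc, sub_add_cancel, ih]
    refine ⟨w 0, (hw 0).1, fun s hs => ?_⟩
    have h1 := (hw 0).smul s
    have h2 : s * w 0 * s⁻¹ = w 0 := by
      rcases mem_axisStab_cases hs with ⟨c, hc⟩ | ⟨k, hk⟩
      · rw [hc, hc] at h1
        rw [show (0 : ℤ) + 1 + c = 0 + c + 1 by ring] at h1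
        rw [h1.unique hC (hw (0 + c)), hconst]
      · rw [hk, hk] at h1
        rw [show k - 0 = k - (0 + 1) + 1 by ring] at h1
        rw [h1.symm.unique hC (hw (k - (0 + 1))), hconst]
    rwa [mul_inv_eq_iff_eq_mul] at h2
  dihedral E hE := by
    rintro ⟨e⟩
    left
    rintro h ⟨hh, hf⟩ g
    have h1 : IsTranslation (g⁻¹ * h * g) := by
      have := (isTranslation_of_mem e hh hf).conj g⁻¹
      rwa [inv_inv] at this
    have h2 := hC.1.not_commute_of_isTranslation h1 hx
    exact ⟨fun h => h2 (hA _ h), fun h => h2 (hB _ h)⟩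
  cyclic k hk hm := by
    left
    rintro h ⟨hh, h1⟩ g
    have hf := not_isOfFinOrder_of_mem_zpowers hk hh h1
    have h2 : IsIsolated (g⁻¹ * h * g) := by
      have := IsIsolated.conj ⟨hf, k, hh, hm⟩ g⁻¹
      rwa [inv_inv] at this
    have h3 : ¬ (g⁻¹ * h * g) * x = x * (g⁻¹ * h * g) := fun h =>
      h2.not_isHomothety ⟨h2.1, x, hx, h⟩
    exact ⟨fun h => h3 (hA _ h), fun h => h3 (hB _ h)⟩
  free u v huv γ hu hv := by
    have huv' := (isInvolutionPair_map (f := (of : G →* HNNExtension G A B φ)) of_inj).2 huv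
    by_cases h0 : γ • base φ = base φ
    · exact eq_one_of_fixed hC.1 huv' hu hv h0 (of_smul_base u) (of_smul_base v)
    · -- the involutions fix an edge, whose stabilizer contains a single involution
      exfalso
      obtain ⟨y, hy1, hy2⟩ := (tree φ).exists_step (base φ) (γ • base φ) (Ne.symm h0)
      obtain ⟨w, hw⟩ := exists_isEdgeInvolution hx hxA hφ hB hy1
      have key : ∀ z : G, IsInvolution z → γ * of z * γ⁻¹ = of z → of z = w := fun z hz hc => by
        rw [mul_inv_eq_iff_eq_mul] at hc
        refine eq_of_commute (not_isOfFinOrder_mul hC.1) ((IsInvolution.map of_inj).2 hz) hw.1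
          (hw.2.2.2 _ (of_smul_base z) ?_)
        refine (tree φ).smul_eq_of_between (by omega : (tree φ).d (base φ) y +
          (tree φ).d y (γ • base φ) = _) (of_smul_base z) ?_
        rw [smul_smul, ← hc, mul_smul, of_smul_base]
      exact huv'.2.2 ((key u huv.1 hu).trans (key v huv.2.1 hv).symm)

end Centralizer

end HNN

open HNNExtension HNN

/-! ### One-step extensions -/

instance {G : Type u} [Group G] [Countable G] {A B : Subgroup G} {φ : A ≃* B} :
    Countable (HNNExtension G A B φ) := by
  have h1 : Countable (FreeMonoid (G ⊕ Multiplicative ℤ)) :=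
    inferInstanceAs (Countable (List (G ⊕ Multiplicative ℤ)))
  have h2 : Countable (Monoid.Coprod G (Multiplicative ℤ)) :=
    (Monoid.Coprod.mk_surjective).countable
  exact (Con.mk'_surjective (c := HNNExtension.con G A B φ)).countable

/-- The embedding of `D_ℤ` into `D_ℚ`. -/
def Dih.intToRat : Dih ℤ →* Dih ℚ :=
  MonoidHom.mk' (fun d => ⟨Multiplicative.ofAdd (d.left.toAdd : ℚ), d.right⟩) (by
    have h1 : ∀ n : ℤ, (⟨Multiplicative.ofAdd (((Dih.rot n).left.toAdd : ℤ) : ℚ),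
        (Dih.rot n).right⟩ : Dih ℚ) = Dih.rot (n : ℚ) := fun n => rfl
    have h2 : ∀ n : ℤ, (⟨Multiplicative.ofAdd (((Dih.refl n).left.toAdd : ℤ) : ℚ),
        (Dih.refl n).right⟩ : Dih ℚ) = Dih.refl (n : ℚ) := fun n => rfl
    intro a b
    rcases Dih.eq_rot_or_refl a with ⟨a, rfl⟩ | ⟨a, rfl⟩ <;>
      rcases Dih.eq_rot_or_refl b with ⟨b, rfl⟩ | ⟨b, rfl⟩
    · rw [Dih.rot_mul_rot, h1, h1, h1, Dih.rot_mul_rot, Int.cast_add]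
    · rw [Dih.rot_mul_refl, h2, h1, h2, Dih.rot_mul_refl, Int.cast_add]
    · rw [Dih.refl_mul_rot, h2, h1, h2, Dih.refl_mul_rot, Int.cast_sub]
    · rw [Dih.refl_mul_refl, h1, h2, h2, Dih.refl_mul_refl, Int.cast_sub])

theorem Dih.intToRat_injective : Function.Injective Dih.intToRat := by
  intro a b h
  have h1 := congrArg SemidirectProduct.left h
  have h2 := congrArg SemidirectProduct.right h
  refine SemidirectProduct.ext ?_ h2
  have h3 : ((a.left.toAdd : ℤ) : ℚ) = (b.left.toAdd : ℤ) := h1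
  exact_mod_cast h3

section Steps

variable {G : Type u} [Group G] [Countable G] (hC : ClassC' G)
include hC

/-- Each pair of type `D_ℤ` becomes of type `D_ℚ` in some extension: the stable letter conjugates
the infinite dihedral subgroup into a subgroup `D_ℚ`. -/
theorem exists_extension_typeDQ {u v : G} (h : IsTypeDZ u v) :
    ∃ (H : Type u) (_ : Group H), Countable H ∧ ClassC' H ∧
      ∃ f : G →* H, Function.Injective f ∧ IsTypeDQ (f u) (f v) := by
  obtain ⟨E, hE, ⟨e⟩, hq⟩ := h
  obtain ⟨-, -, -, D, -, ⟨d⟩⟩ := hC.1.exists_typeDQ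
  let ψ : Dih ℤ →* G := (D.subtype.comp d.symm.toMonoidHom).comp Dih.intToRat
  have hψ : Function.Injective ψ := (coe_injective d).comp Dih.intToRat_injective
  let φ : E ≃* ψ.range := e.trans (MonoidHom.ofInjective hψ)
  have hB : ψ.range ≤ D := by
    rintro _ ⟨a, rfl⟩
    exact (d.symm (Dih.intToRat a)).2
  have hadm : Admissible φ := admissible_of_quasiMalnormal hC hq d hB fun a ha hf g hg => by
    obtain ⟨e'⟩ := nonempty_conjSubgroup_mulEquiv e g⁻¹
    refine not_mem_quasiMalnormal (hq.conj hC.2.1 (fun _ _ => hC.1.not_isOfFinOrder_mul) g⁻¹)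
      e' d hg ?_ ?_
    · have := isOfFinOrder_conj g⁻¹ (x := a)
      rw [inv_inv] at this
      rwa [this]
    · have := conj_mem_conjSubgroup (d := g⁻¹) ha
      rwa [inv_inv] at this
  refine ⟨HNNExtension G E ψ.range φ, inferInstance, inferInstance, classC' hC hadm, of, of_inj, ?_⟩
  obtain ⟨hu, hv⟩ := mem_of_closure_le hE
  have h1 : IsTypeDQ (φ ⟨u, hu⟩ : G) (φ ⟨v, hv⟩ : G) := by
    refine ⟨D, ?_, ⟨d⟩⟩
    rw [Subgroup.closure_le]
    rintro _ (rfl | rfl)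
    · exact hB (φ ⟨u, hu⟩).2
    · exact hB (φ ⟨v, hv⟩).2
  have h2 := (h1.map (f := (of : G →* HNNExtension G E ψ.range φ)) of_inj).conj t⁻¹
  rw [equiv_eq_conj, equiv_eq_conj] at h2
  simpa [mul_assoc] using h2

/-- Each isolated element becomes a translation in some extension. -/
theorem exists_extension_isTranslation {h : G} (hh : IsIsolated h) :
    ∃ (H : Type u) (_ : Group H), Countable H ∧ ClassC' H ∧
      ∃ f : G →* H, Function.Injective f ∧ IsTranslation (f h) := by
  obtain ⟨hf, k, hk, hm⟩ := hh
  have hkf := not_isOfFinOrder_of_mem_zpowers' hf hk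
  obtain ⟨-, -, -, D, -, ⟨d⟩⟩ := hC.1.exists_typeDQ
  obtain ⟨s, hsD, hs⟩ : ∃ s ∈ D, ¬ IsOfFinOrder s :=
    ⟨d.symm (Dih.rot 1), (d.symm (Dih.rot 1)).2, not_isOfFinOrder_coe_rot d one_ne_zero⟩
  have hB : Subgroup.zpowers s ≤ D := Subgroup.zpowers_le.2 hsD
  obtain ⟨φ⟩ : Nonempty (Subgroup.zpowers k ≃* Subgroup.zpowers s) := ⟨mulEquivOfCyclicCardEq (by
    rw [Nat.card_zpowers, Nat.card_zpowers, orderOf_eq_zero hs, orderOf_eq_zero hkf])⟩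
  have hadm : Admissible φ := admissible_of_quasiMalnormal hC hm.quasiMalnormal d hB
    fun a ha haf g hg => by
      have h1 : IsIsolated (g⁻¹ * a * g) := by
        have := IsIsolated.conj ⟨haf, k, ha, hm⟩ g⁻¹
        rwa [inv_inv] at this
      exact h1.not_isTranslation (isTranslation_of_mem d hg h1.1)
  refine ⟨HNNExtension G _ _ φ, inferInstance, inferInstance, classC' hC hadm, of, of_inj, ?_⟩
  have h1 : ¬ IsOfFinOrder (φ ⟨h, hk⟩ : G) := fun h2 => hf (by
    have h3 := (φ.injective.isOfFinOrder_iff (f := φ.toMonoidHom) (x := ⟨_, hk⟩)).1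
      (Submonoid.isOfFinOrder_coe.1 h2)
    exact Submonoid.isOfFinOrder_coe.2 h3)
  have h2 := ((isTranslation_of_mem d (hB (φ ⟨h, hk⟩).2) h1).map
    (f := (of : G →* HNNExtension G _ _ φ)) of_inj)
  rw [equiv_eq_conj] at h2
  exact h2.of_conj t

/-- Two homotheties become conjugate in some extension. -/
theorem exists_extension_isConj {h h' : G} (hh : IsHomothety h) (hh' : IsHomothety h') :
    ∃ (H : Type u) (_ : Group H), Countable H ∧ ClassC' H ∧
      ∃ f : G →* H, Function.Injective f ∧ IsConj (f h) (f h') := by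
  obtain ⟨hf, x, hx, hc⟩ := hh
  obtain ⟨hf', x', hx', hc'⟩ := hh'
  obtain ⟨g, rfl⟩ := hC.1.transitive_involutions x x' hx hx'
  -- conjugate so that both homotheties centralize the same involution `x`
  obtain ⟨k, hk⟩ : ∃ k, k = g⁻¹ * h' * g := ⟨_, rfl⟩
  have hgk : g * k * g⁻¹ = h' := by rw [hk]; group
  have hkf : ¬ IsOfFinOrder k := by
    have := isOfFinOrder_conj g⁻¹ (x := h')
    rw [inv_inv] at this
    rwa [hk, this]
  have hkc : k * x = x * k := by
    have := congrArg (fun z => g⁻¹ * z * g) hc'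
    simpa [hk, mul_assoc] using this
  have comm : ∀ l : G, l * x = x * l → ∀ (m : Multiplicative ℤ) (y : Subgroup.zpowers x),
      Commute (zpowersHom G l m) ((Subgroup.zpowers x).subtype y) := by
    rintro l hl m ⟨_, n, rfl⟩
    rw [zpowersHom_apply]
    exact (show Commute l x from hl).zpow_zpow _ _
  let ψ : ∀ l : G, l * x = x * l → Multiplicative ℤ × Subgroup.zpowers x →* G := fun l hl =>
    MonoidHom.noncommCoprod (zpowersHom G l) (Subgroup.zpowers x).subtype (comm l hl)
  have hψ : ∀ l hl, ¬ IsOfFinOrder l → Function.Injective (ψ l hl) := by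
    intro l hl hlf
    rw [injective_iff_map_eq_one]
    rintro ⟨m, y, hy⟩ h1
    have h2 : l ^ m.toAdd * y = 1 := h1
    have hyf : IsOfFinOrder y := IsOfFinOrder.of_mem_zpowers hx.isOfFinOrder hy
    have h3 : m.toAdd = 0 := by
      by_contra h0
      apply not_isOfFinOrder_zpow hlf h0
      rw [eq_inv_of_mul_eq_one_left h2]
      exact hyf.inv
    rw [h3, zpow_zero, one_mul] at h2
    subst h2
    exact Prod.ext h3 rfl
  have hψx : ∀ l hl, ψ l hl (1, ⟨x, Subgroup.mem_zpowers x⟩) = x := fun l hl => by simp [ψ]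
  have hψl : ∀ l hl, ψ l hl (Multiplicative.ofAdd 1, 1) = l := fun l hl => by simp [ψ]
  have hψc : ∀ l hl, ∀ a ∈ (ψ l hl).range, a * x = x * a := by
    rintro l hl _ ⟨⟨m, y⟩, rfl⟩
    have hy : y * ⟨x, Subgroup.mem_zpowers x⟩ = ⟨x, Subgroup.mem_zpowers x⟩ * y := by
      obtain ⟨_, n, rfl⟩ := y
      exact Subtype.ext ((Commute.refl x).zpow_left n)
    have h1 : ((m, y) : Multiplicative ℤ × Subgroup.zpowers x) * (1, ⟨x, Subgroup.mem_zpowers x⟩)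
        = (1, ⟨x, Subgroup.mem_zpowers x⟩) * (m, y) := Prod.ext (mul_comm m 1) hy
    have h2 := congrArg (ψ l hl) h1
    rwa [map_mul, map_mul, hψx l hl] at h2
  let φ : (ψ h hc).range ≃* (ψ k hkc).range :=
    (MonoidHom.ofInjective (hψ h hc hf)).symm.trans (MonoidHom.ofInjective (hψ k hkc hkf))
  have hφ : ∀ z, φ ⟨ψ h hc z, z, rfl⟩ = (⟨ψ k hkc z, z, rfl⟩ : (ψ k hkc).range) := fun z => by
    have : (⟨ψ h hc z, z, rfl⟩ : (ψ h hc).range) = MonoidHom.ofInjective (hψ h hc hf) z := rfl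
    rw [this, MulEquiv.trans_apply, MulEquiv.symm_apply_apply]
    rfl
  have hmem : ∀ {a : G} (z) (hz : ψ h hc z = a) (ha : a ∈ (ψ h hc).range),
      (φ ⟨a, ha⟩ : G) = ψ k hkc z := by
    rintro _ z rfl ha
    rw [hφ]
  have hxA : x ∈ (ψ h hc).range := ⟨_, hψx h hc⟩
  have hhA : h ∈ (ψ h hc).range := ⟨_, hψl h hc⟩
  have hadm : Admissible φ := admissible_of_centralizer hC hx hxA
    ((hmem _ (hψx h hc) hxA).trans (hψx k hkc)) (hψc h hc) (hψc k hkc)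
  refine ⟨HNNExtension G _ _ φ, inferInstance, inferInstance, classC' hC hadm, of, of_inj, ?_⟩
  have h1 := equiv_eq_conj (φ := φ) ⟨h, hhA⟩
  rw [hmem _ (hψl h hc) hhA, hψl k hkc] at h1
  have h2 : IsConj (of h : HNNExtension G _ _ φ) (of k) := isConj_iff.2 ⟨t, h1.symm⟩
  refine h2.trans (isConj_iff.2 ⟨of g, ?_⟩)
  rw [← map_inv, ← map_mul, ← map_mul, hgk]

/-- Some extension contains a homothety which is a product of two translations. In the
extension by a letter `t` centralizing an involution, `t * τ` is isolated for each translation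
`τ`: its exponent sum excludes translations, and the retraction killing `t` excludes homotheties.
A second extension makes it a translation. -/
theorem exists_extension_isHomothety :
    ∃ (H : Type u) (_ : Group H), Countable H ∧ ClassC' H ∧
      ∃ f : G →* H, Function.Injective f ∧
        ∃ s r : H, IsHomothety s ∧ IsTranslation r ∧ IsTranslation (s * r) := by
  obtain ⟨x, y, hxy, -⟩ := hC.1.exists_typeDQ
  have hτ : IsTranslation (x * y) := ⟨hC.1.not_isOfFinOrder_mul hxy, x, y, hxy, rfl⟩
  let φ : Subgroup.zpowers x ≃* Subgroup.zpowers x := MulEquiv.refl _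
  have hcomm : ∀ a ∈ Subgroup.zpowers x, a * x = x * a := by
    rintro _ ⟨n, rfl⟩
    exact ((Commute.refl x).zpow_left n)
  have hadm : Admissible φ := admissible_of_centralizer hC hxy.1 (Subgroup.mem_zpowers x) rfl
    hcomm hcomm
  have hC1 := classC' hC hadm
  have hinf : ∀ γ : HNNExtension G _ _ φ, expSum φ γ = Multiplicative.ofAdd 1 →
      ¬ IsOfFinOrder γ := by
    intro γ hγ hf
    have h1 := (expSum φ).isOfFinOrder hf
    rw [hγ, isOfFinOrder_iff_pow_eq_one] at h1
    obtain ⟨n, hn, h2⟩ := h1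
    rw [← ofAdd_nsmul, ofAdd_eq_one, nsmul_eq_mul, mul_one] at h2
    omega
  have ht : IsHomothety (t : HNNExtension G _ _ φ) :=
    ⟨hinf t (expSum_t φ), of x, (IsInvolution.map of_inj).2 hxy.1,
      t_mul_of (φ := φ) ⟨x, Subgroup.mem_zpowers x⟩⟩
  have hexp : expSum φ (t * of (x * y)) = Multiplicative.ofAdd 1 := by
    rw [map_mul, expSum_t, expSum_of, mul_one]
  have hiso : IsIsolated (t * of (x * y) : HNNExtension G _ _ φ) := by
    rcases hC1.2.2 _ (hinf _ hexp) with ⟨-, u, v, huv, h1⟩ | ⟨-, w, hw, h1⟩ | h1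
    · exfalso
      have h2 := congrArg (fun z => (expSum φ z).toAdd) h1
      simp only [hexp] at h2
      have h3 := (tree φ).χ_mul u v
      rw [(tree φ).χ_eq_zero_of_mul_self huv.1.mul_self,
        (tree φ).χ_eq_zero_of_mul_self huv.2.1.mul_self] at h3
      change (expSum φ (u * v)).toAdd = 0 + 0 at h3
      rw [h3] at h2
      simp at h2
    · exfalso
      let ρ : HNNExtension G _ _ φ →* G := lift (MonoidHom.id G) 1 (fun a => by simp [φ])
      have hw' : IsInvolution (ρ w) := by
        obtain ⟨δ, g, rfl⟩ := exists_conj_of_isOfFinOrder hw.isOfFinOrder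
        rw [isInvolution_conj, IsInvolution.map of_inj] at hw
        rw [map_mul, map_mul, map_inv, isInvolution_conj]
        simpa [ρ] using hw
      have h2 := congrArg ρ h1
      have h3 : ρ (t * of (x * y)) = x * y := by simp [ρ]
      rw [map_mul, map_mul ρ w, h3] at h2
      exact hC.1.not_commute_of_isTranslation hτ hw' h2
    · exact h1
  obtain ⟨H, _, hH, hHC, f, hf, h1⟩ := exists_extension_isTranslation hC1 hiso
  refine ⟨H, inferInstance, hH, hHC, f.comp of, hf.comp of_inj, f t, f (of (x * y)),
    ht.map hf, (hτ.map of_inj).map hf, ?_⟩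
  rwa [← map_mul]

end Steps

/-! ### Unions of chains of groups -/

section Limit

variable {G : ℕ → Type u} [∀ n, Group (G n)] (f : ∀ n, G n →* G (n + 1))

/-- The composite `G n →* G m` of the maps of a chain of groups, for `n ≤ m`. -/
def chainMap (n m : ℕ) (h : n ≤ m) : G n →* G m :=
  Nat.leRec (motive := fun m _ => G n →* G m) (MonoidHom.id _) (fun m _ g => (f m).comp g) h

theorem chainMap_self (n : ℕ) : chainMap f n n le_rfl = MonoidHom.id _ :=
  Nat.leRec_self _ _

theorem chainMap_succ (n m : ℕ) (h : n ≤ m) :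
    chainMap f n (m + 1) (Nat.le_succ_of_le h) = (f m).comp (chainMap f n m h) :=
  Nat.leRec_succ _ _ _

theorem chainMap_injective (hf : ∀ n, Function.Injective (f n)) (n m : ℕ) (h : n ≤ m) :
    Function.Injective (chainMap f n m h) := by
  induction m, h using Nat.le_induction with
  | base => rw [chainMap_self]; exact Function.injective_id
  | succ m h ih => rw [chainMap_succ _ _ _ h]; exact (hf m).comp ih

instance chainMap_directedSystem :
    DirectedSystem G (fun n m h => (chainMap f n m h : G n → G m)) where
  map_self n x := by rw [chainMap_self]; rfl
  map_map k j i hij hjk x := by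
    induction k, hjk using Nat.le_induction with
    | base => rw [chainMap_self]; rfl
    | succ k hjk ih =>
      rw [chainMap_succ _ _ _ hjk, chainMap_succ _ _ _ (hij.trans hjk), MonoidHom.comp_apply, ih,
        MonoidHom.comp_apply]

/-- Each chain of countable groups and injective homomorphisms has a union. -/
theorem exists_union_of_chain [∀ n, Countable (G n)] (hf : ∀ n, Function.Injective (f n)) :
    ∃ (L : Type u) (_ : Group L) (ι : ∀ n, G n →* L), Countable L ∧
      (∀ n, Function.Injective (ι n)) ∧
      (∀ n m h x, ι m (chainMap f n m h x) = ι n x) ∧ ∀ z, ∃ n x, ι n x = z := by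
  let L := DirectLimit G (chainMap f)
  let ι : ∀ n, G n →* L := fun n => MonoidHom.mk' (fun x => ⟦⟨n, x⟩⟧) fun x y =>
    (DirectLimit.mul_def (f := chainMap f) n x y).symm
  refine ⟨L, inferInstance, ι, ?_, fun n => ?_, fun n m h x => ?_, fun z => ?_⟩
  · exact Quotient.countable
  · exact DirectLimit.mk_injective (chainMap f) (chainMap_injective f hf) n
  · exact DirectLimit.mk_apply (f := chainMap f) n m x h
  · obtain ⟨n, x, rfl⟩ := DirectLimit.exists_eq_mk _ z
    exact ⟨n, x, rfl⟩

end Limit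

/-! ### Settling all pairs -/

/-- The pair `(a, b)` is *settled*: it is of type `D_ℚ` if it is a pair of distinct involutions,
neither `a` nor `b` is isolated, and `a` and `b` are conjugate if they are homotheties. -/
structure Settled {G : Type u} [Group G] (a b : G) : Prop where
  typeDQ : IsInvolutionPair a b → IsTypeDQ a b
  left : ¬ IsOfFinOrder a → IsTranslation a ∨ IsHomothety a
  right : ¬ IsOfFinOrder b → IsTranslation b ∨ IsHomothety b
  isConj : IsHomothety a → IsHomothety b → IsConj a b

section Steps

variable {G : Type u} [Group G] [Countable G] (hC : ClassC' G)
include hC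

theorem exists_extension_not_isolated (a : G) :
    ∃ (H : Type u) (_ : Group H), Countable H ∧ ClassC' H ∧
      ∃ f : G →* H, Function.Injective f ∧
        (¬ IsOfFinOrder a → IsTranslation (f a) ∨ IsHomothety (f a)) := by
  by_cases ha : IsIsolated a
  · obtain ⟨H, _, h1, h2, f, hf, h⟩ := exists_extension_isTranslation hC ha
    exact ⟨H, _, h1, h2, f, hf, fun _ => .inl h⟩
  · refine ⟨G, _, ‹_›, hC, MonoidHom.id G, Function.injective_id, fun h => ?_⟩
    rcases hC.2.2 a h with h | h | h
    exacts [.inl h, .inr h, absurd h ha]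

/-- Four extensions in a row settle the pair `(a, b)`: the first one makes it a pair of type `D_ℚ`,
if it is a pair of type `D_ℤ`, the next two make `a` and `b` translations, if they are isolated, and
the last one conjugates `a` and `b`, if they are homotheties. -/
theorem exists_extension_settled (a b : G) :
    ∃ (H : Type u) (_ : Group H), Countable H ∧ ClassC' H ∧
      ∃ f : G →* H, Function.Injective f ∧ Settled (f a) (f b) := by
  obtain ⟨H₁, _, h₁, hC₁, f₁, hf₁, h1⟩ : ∃ (H : Type u) (_ : Group H), Countable H ∧ ClassC' H ∧
      ∃ f : G →* H, Function.Injective f ∧ (IsInvolutionPair a b → IsTypeDQ (f a) (f b)) := by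
    by_cases hab : IsTypeDZ a b
    · obtain ⟨H, _, h1, h2, f, hf, h⟩ := exists_extension_typeDQ hC hab
      exact ⟨H, _, h1, h2, f, hf, fun _ => h⟩
    · exact ⟨G, _, ‹_›, hC, MonoidHom.id G, Function.injective_id, fun h =>
        (hC.1.type_pairs a b h).resolve_left hab⟩
  obtain ⟨H₂, _, h₂, hC₂, f₂, hf₂, h2⟩ := exists_extension_not_isolated hC₁ (f₁ a)
  obtain ⟨H₃, _, h₃, hC₃, f₃, hf₃, h3⟩ := exists_extension_not_isolated hC₂ (f₂ (f₁ b))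
  obtain ⟨H₄, _, h₄, hC₄, f₄, hf₄, h4⟩ : ∃ (H : Type u) (_ : Group H), Countable H ∧ ClassC' H ∧
      ∃ f : H₃ →* H, Function.Injective f ∧ (IsHomothety (f₃ (f₂ (f₁ a))) →
        IsHomothety (f₃ (f₂ (f₁ b))) → IsConj (f (f₃ (f₂ (f₁ a)))) (f (f₃ (f₂ (f₁ b))))) := by
    by_cases h : IsHomothety (f₃ (f₂ (f₁ a))) ∧ IsHomothety (f₃ (f₂ (f₁ b)))
    · obtain ⟨H, _, h1, h2, f, hf, h⟩ := exists_extension_isConj hC₃ h.1 h.2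
      exact ⟨H, _, h1, h2, f, hf, fun _ _ => h⟩
    · exact ⟨H₃, _, h₃, hC₃, MonoidHom.id _, Function.injective_id, fun h5 h6 =>
        absurd ⟨h5, h6⟩ h⟩
  -- the first three properties persist in later extensions
  have h2' : ¬ IsOfFinOrder (f₃ (f₂ (f₁ a))) →
      IsTranslation (f₃ (f₂ (f₁ a))) ∨ IsHomothety (f₃ (f₂ (f₁ a))) := fun h => by
    rw [hf₃.isOfFinOrder_iff, hf₂.isOfFinOrder_iff] at h
    exact (h2 h).imp (·.map hf₃) (·.map hf₃)
  rw [← hf₃.isOfFinOrder_iff] at h3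
  have key : ∀ c : H₃, (¬ IsOfFinOrder c → IsTranslation c ∨ IsHomothety c) →
      IsHomothety (f₄ c) → IsHomothety c := fun c hc h => by
    rcases hc (fun h' => h.1 (hf₄.isOfFinOrder_iff.2 h')) with h' | h'
    · exact absurd h (hC₄.1.not_isHomothety_of_isTranslation (h'.map hf₄))
    · exact h'
  refine ⟨H₄, _, h₄, hC₄, f₄.comp (f₃.comp (f₂.comp f₁)),
    hf₄.comp (hf₃.comp (hf₂.comp hf₁)), ⟨fun h => ?_, fun h => ?_, fun h => ?_, fun h h' => ?_⟩⟩
  · rw [isInvolutionPair_map (f := f₄.comp (f₃.comp (f₂.comp f₁)))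
      (hf₄.comp (hf₃.comp (hf₂.comp hf₁)))] at h
    exact (((h1 h).map hf₂).map hf₃).map hf₄
  · exact (h2' fun h' => h (hf₄.isOfFinOrder_iff.2 h')).imp (·.map hf₄) (·.map hf₄)
  · exact (h3 fun h' => h (hf₄.isOfFinOrder_iff.2 h')).imp (·.map hf₄) (·.map hf₄)
  · exact h4 (key _ h2' h) (key _ h3 h')

end Steps

/-- A countable group of the class `𝒞'`, to be a member of a chain, with a table of pairs of its
elements which are to be settled one after the other. -/
structure Stage where
  carrier : Type u
  [group : Group carrier]
  [countable : Countable carrier]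
  classC' : ClassC' carrier
  /-- Row `i` of the table lists the pairs of elements of the `i`-th group of the chain; the rows
  after that of the current group have no meaning. -/
  table : ℕ → ℕ → carrier × carrier

namespace Stage

attribute [instance] Stage.group Stage.countable

/-- At step `n`, the entry of the table with index `n` is settled, the rows up to `n` are kept, and
row `n + 1` is filled with all pairs of elements of the new group. As `n.unpair.1 ≤ n`, the entry
belongs to a row that is already filled. -/
theorem exists_next (n : ℕ) (S : Stage.{u}) :
    ∃ (S' : Stage.{u}) (f : S.carrier →* S'.carrier), Function.Injective f ∧
      (∀ p, p = S.table n.unpair.1 n.unpair.2 → Settled (f p.1) (f p.2)) ∧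
      (∀ i ≤ n, ∀ k, S'.table i k = Prod.map f f (S.table i k)) ∧
      Function.Surjective (S'.table (n + 1)) := by
  obtain ⟨H, _, hH, hC, f, hf, h⟩ := exists_extension_settled S.classC'
    (S.table n.unpair.1 n.unpair.2).1 (S.table n.unpair.1 n.unpair.2).2
  obtain ⟨e, he⟩ := exists_surjective_nat (H × H)
  refine ⟨⟨H, hC, fun i k => if i ≤ n then Prod.map f f (S.table i k) else e k⟩, f, hf, ?_, ?_, ?_⟩
  · rintro _ rfl
    exact h
  · intro i hi k
    exact if_pos hi
  · intro p
    obtain ⟨k, rfl⟩ := he p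
    exact ⟨k, if_neg (by omega)⟩

end Stage

/-- Each countable group of the class `𝒞'` is contained in a countable union of a chain of groups
of the class `𝒞'` in which each pair of elements is settled at some stage. -/
theorem exists_settled_chain {G₀ : Type u} [Group G₀] [Countable G₀] (hC : ClassC' G₀) :
    ∃ (G : ℕ → Type u) (_ : ∀ n, Group (G n)) (f : ∀ n, G n →* G (n + 1))
      (L : Type u) (_ : Group L) (ι : ∀ n, G n →* L) (f₀ : G₀ →* L), Countable L ∧
      (∀ n, ClassC' (G n)) ∧ (∀ n, Function.Injective (f n)) ∧ (∀ n, Function.Injective (ι n)) ∧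
      Function.Injective f₀ ∧
      (∀ n m h x, ι m (chainMap f n m h x) = ι n x) ∧ (∀ z, ∃ n x, ι n x = z) ∧
      ∀ y z, ∃ n a b, ι n a = y ∧ ι n b = z ∧ Settled a b := by
  choose next F hF hset hrow hnew using Stage.exists_next.{u}
  obtain ⟨e, he⟩ := exists_surjective_nat (G₀ × G₀)
  let S : ℕ → Stage.{u} := fun n =>
    Nat.rec (motive := fun _ => Stage.{u}) ⟨G₀, hC, fun _ => e⟩ next n
  let f : ∀ n : ℕ, (S n).carrier →* (S (n + 1)).carrier := fun n => F n (S n)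
  have hf : ∀ n, Function.Injective (f n) := fun n => hF n (S n)
  obtain ⟨L, _, ι, hL, hι, hc, hs⟩ :=
    exists_union_of_chain (G := fun n => (S n).carrier) f hf
  have hsurj : ∀ n, Function.Surjective ((S n).table n) := by
    rintro (_ | n)
    · exact he
    · exact hnew n (S n)
  have htab : ∀ n m (h : n ≤ m) k, (S m).table n k =
      Prod.map (chainMap (G := fun n => (S n).carrier) f n m h)
        (chainMap (G := fun n => (S n).carrier) f n m h) ((S n).table n k) := by
    intro n m h k
    induction m, h using Nat.le_induction with
    | base => rw [chainMap_self]; rfl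
    | succ m h ih =>
      rw [chainMap_succ _ _ _ h]
      refine (hrow m (S m) n h k).trans ?_
      rw [ih]
      rfl
  refine ⟨fun n => (S n).carrier, inferInstance, f, L, _, ι, ι 0, hL, fun n => (S n).classC', hf,
    hι, hι 0, hc, hs, fun y z => ?_⟩
  obtain ⟨n, a, rfl⟩ := hs y
  obtain ⟨m, b, rfl⟩ := hs z
  rw [← hc n (max n m) (le_max_left _ _) a, ← hc m (max n m) (le_max_right _ _) b]
  generalize chainMap f n (max n m) _ a = a
  generalize chainMap f m (max n m) _ b = b
  generalize max n m = i at a b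
  obtain ⟨k, hk⟩ := hsurj i (a, b)
  -- the pair `(a, b)` is settled at the step whose index encodes its row and its column
  have h1 : i ≤ Nat.pair i k := Nat.left_le_pair i k
  have h2 := hset (Nat.pair i k) (S (Nat.pair i k)) _ rfl
  rw [Nat.unpair_pair, htab i _ h1 k, hk] at h2
  have h3 : ∀ x, ι (Nat.pair i k + 1) (f _ (chainMap f i _ h1 x)) = ι i x := fun x => by
    rw [← MonoidHom.comp_apply (f _), ← chainMap_succ, hc]
  exact ⟨_, _, _, h3 a, h3 b, h2⟩

/-! ### The union of a settled chain -/

/-- A group of the class `𝒞'` in which all pairs of elements are settled. -/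
structure Saturated (G : Type u) [Group G] : Prop where
  classC' : ClassC' G
  typeDQ : ∀ {x y : G}, IsInvolutionPair x y → IsTypeDQ x y
  translation_or_homothety : ∀ {h : G}, ¬ IsOfFinOrder h → IsTranslation h ∨ IsHomothety h
  isConj_of_isHomothety : ∀ {h h' : G}, IsHomothety h → IsHomothety h' → IsConj h h'

/-- Each countable group of the class `𝒞'` embeds into a countable saturated group. All conditions
on the union concern finitely many elements, so that they can be checked at a finite stage. -/
theorem exists_saturated {G₀ : Type u} [Group G₀] [Countable G₀] (hC : ClassC' G₀) :
    ∃ (L : Type u) (_ : Group L), Countable L ∧ Saturated L ∧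
      ∃ f : G₀ →* L, Function.Injective f := by
  obtain ⟨G, _, f, L, _, ι, f₀, hL, hG, hf, hι, hf₀, hc, hs, hset⟩ := exists_settled_chain hC
  have htyp : ∀ {x y : L}, IsInvolutionPair x y → IsTypeDQ x y := by
    intro x y hxy
    obtain ⟨n, a, b, rfl, rfl, h⟩ := hset x y
    exact (h.typeDQ ((isInvolutionPair_map (hι n)).1 hxy)).map (hι n)
  have hinf : ∀ {h : L}, ¬ IsOfFinOrder h → IsTranslation h ∨ IsHomothety h := by
    intro x hx
    obtain ⟨n, a, b, rfl, -, h⟩ := hset x x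
    exact (h.left fun h' => hx ((hι n).isOfFinOrder_iff.2 h')).imp (·.map (hι n)) (·.map (hι n))
  have hCL : ClassC L := by
    refine ⟨fun x y hx hy => ?_, fun x y hxy g hgx hgy => ?_, fun x y h => .inr (htyp h), ?_,
      fun x y x' y' hxy _ hxy' _ => ?_⟩
    · obtain ⟨n, a, b, rfl, rfl, -⟩ := hset x y
      obtain ⟨g, rfl⟩ := (hG n).1.transitive_involutions a b ((IsInvolution.map (hι n)).1 hx)
        ((IsInvolution.map (hι n)).1 hy)
      exact ⟨ι n g, by simp⟩
    · obtain ⟨n, a, b, rfl, rfl, -⟩ := hset x y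
      obtain ⟨m, c, rfl⟩ := hs g
      have hn := le_max_left n m
      have hm := le_max_right n m
      rw [← hc n _ hn a] at hxy hgx
      rw [← hc n _ hn b] at hxy hgy
      rw [← hc m _ hm] at hgx hgy ⊢
      rw [← map_inv, ← map_mul, ← map_mul] at hgx hgy
      rw [(hG _).1.free_pairs _ _ ((isInvolutionPair_map (hι _)).1 hxy) _ (hι _ hgx) (hι _ hgy),
        map_one]
    · obtain ⟨x, y, hxy, h⟩ := (hG 0).1.exists_typeDQ
      exact ⟨ι 0 x, ι 0 y, (isInvolutionPair_map (hι 0)).2 hxy, h.map (hι 0)⟩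
    · obtain ⟨n, a, b, rfl, rfl, h⟩ := hset x y
      obtain ⟨m, a', b', rfl, rfl, h'⟩ := hset x' y'
      rw [isInvolutionPair_map (hι _)] at hxy hxy'
      have hn := le_max_left n m
      have hm := le_max_right n m
      have hjn := chainMap_injective f hf n _ hn
      have hjm := chainMap_injective f hf m _ hm
      obtain ⟨g, h1, h2⟩ := (hG (max n m)).1.transitive_typeDQ _ _ _ _
        ((isInvolutionPair_map hjn).2 hxy) ((h.typeDQ hxy).map hjn)
        ((isInvolutionPair_map hjm).2 hxy') ((h'.typeDQ hxy').map hjm)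
      refine ⟨ι _ g, ?_, ?_⟩
      · rw [← hc m _ hm, ← h1, map_mul, map_mul, map_inv, hc]
      · rw [← hc m _ hm, ← h2, map_mul, map_mul, map_inv, hc]
  refine ⟨L, _, hL, ⟨⟨hCL, fun x => ?_, fun x hx => ?_⟩, htyp, hinf, fun {x y} hx hy => ?_⟩,
    f₀, hf₀⟩
  · obtain ⟨n, a, rfl⟩ := hs x
    rw [orderOf_injective _ (hι n), (hι n).isOfFinOrder_iff]
    exact (hG n).2.1 a
  · exact (hinf hx).imp_right .inl
  · obtain ⟨n, a, b, rfl, rfl, h⟩ := hset x y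
    -- translations stay translations in the union, and these are not homotheties there
    have key : ∀ c : G n, (¬ IsOfFinOrder c → IsTranslation c ∨ IsHomothety c) →
        IsHomothety (ι n c) → IsHomothety c := fun c hc h =>
      (hc fun h' => h.1 ((hι n).isOfFinOrder_iff.2 h')).resolve_left fun h' =>
        hCL.not_isHomothety_of_isTranslation (h'.map (hι n)) h
    exact (ι n).map_isConj (h.isConj (key a h.left hx) (key b h.right hy))

/-! ### Properties of saturated groups -/

namespace Saturated

variable {G : Type u} [Group G] (hG : Saturated G)
include hG

theorem exists_conj_pair {x y x' y' : G} (h : IsInvolutionPair x y) (h' : IsInvolutionPair x' y') :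
    ∃ g : G, g * x * g⁻¹ = x' ∧ g * y * g⁻¹ = y' :=
  hG.classC'.1.transitive_typeDQ _ _ _ _ h (hG.typeDQ h) h' (hG.typeDQ h')

/-- The group acts sharply 2-transitively on its involutions by conjugation. -/
theorem isSharplyTwoTransitive : IsSharplyTwoTransitive G := by
  let act : MulAction G {x : G // IsInvolution x} :=
    { smul := fun g x => ⟨g * x * g⁻¹, (isInvolution_conj g).2 x.2⟩
      one_smul := fun x => Subtype.ext (by change 1 * (x : G) * 1⁻¹ = x; simp)
      mul_smul := fun g h x => Subtype.ext (by
        change g * h * (x : G) * (g * h)⁻¹ = g * (h * x * h⁻¹) * g⁻¹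
        simp [mul_assoc]) }
  have hsm : ∀ (g : G) (x y : {x : G // IsInvolution x}), g • x = y ↔ g * x * g⁻¹ = (y : G) :=
    fun g x y => Subtype.ext_iff
  refine ⟨{x : G // IsInvolution x}, act, ?_, ?_⟩
  · obtain ⟨x, y, hxy, -⟩ := hG.classC'.1.exists_typeDQ
    exact ⟨⟨x, hxy.1⟩, ⟨y, hxy.2.1⟩, fun h => hxy.2.2 (congrArg Subtype.val h)⟩
  · rintro ⟨x₁, hx₁⟩ ⟨x₂, hx₂⟩ ⟨y₁, hy₁⟩ ⟨y₂, hy₂⟩ hx hy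
    simp only [hsm]
    have hx' : IsInvolutionPair x₁ x₂ := ⟨hx₁, hx₂, fun h => hx (Subtype.ext h)⟩
    have hy' : IsInvolutionPair y₁ y₂ := ⟨hy₁, hy₂, fun h => hy (Subtype.ext h)⟩
    obtain ⟨g, h1, h2⟩ := hG.exists_conj_pair hx' hy'
    refine ⟨g, ⟨h1, h2⟩, ?_⟩
    rintro k ⟨h3, h4⟩
    have key : ∀ z, k * z * k⁻¹ = g * z * g⁻¹ → g⁻¹ * k * z * (g⁻¹ * k)⁻¹ = z := fun z hz => by
      calc g⁻¹ * k * z * (g⁻¹ * k)⁻¹ = g⁻¹ * (k * z * k⁻¹) * g := by group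
        _ = z := by rw [hz]; group
    have h5 := hG.classC'.1.free_pairs x₁ x₂ hx' (g⁻¹ * k) (key _ (h3.trans h1.symm))
      (key _ (h4.trans h2.symm))
    exact (inv_mul_eq_one.1 h5).symm

theorem cases (g : G) : g = 1 ∨ IsInvolution g ∨ IsTranslation g ∨ IsHomothety g := by
  rcases hG.classC'.2.1 g with h | h | h
  · exact .inl (orderOf_eq_one_iff.1 h)
  · exact .inr (.inl h)
  · exact .inr (.inr (hG.translation_or_homothety h))

theorem isConj_of_isInvolution {x y : G} (hx : IsInvolution x) (hy : IsInvolution y) :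
    IsConj x y :=
  isConj_iff.2 (hG.classC'.1.transitive_involutions x y hx hy)

theorem isConj_of_isTranslation {h h' : G} (hh : IsTranslation h) (hh' : IsTranslation h') :
    IsConj h h' := by
  obtain ⟨-, x, y, hxy, rfl⟩ := hh
  obtain ⟨-, x', y', hxy', rfl⟩ := hh'
  obtain ⟨g, rfl, rfl⟩ := hG.exists_conj_pair hxy hxy'
  exact isConj_iff.2 ⟨g, by group⟩

theorem isTranslation_mul {x y : G} (h : IsInvolutionPair x y) : IsTranslation (x * y) :=
  ⟨hG.classC'.1.not_isOfFinOrder_mul h, x, y, h, rfl⟩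

theorem range_carrier {s : G} (hs : IsHomothety s) :
    Set.range (ConjClasses.carrier : ConjClasses G → Set G) =
      {{1}, {g : G | IsInvolution g}, {g : G | IsTranslation g}, {g : G | IsHomothety g}} := by
  have key : ∀ {a : G} {C : Set G}, (∀ b, IsConj a b ↔ b ∈ C) →
      (ConjClasses.mk a).carrier = C := fun {a C} h => by
    ext b
    rw [ConjClasses.mem_carrier_iff_mk_eq, ConjClasses.mk_eq_mk_iff_isConj, isConj_comm, h]
  have h1 : (ConjClasses.mk (1 : G)).carrier = {1} := key fun b => isConj_one_right
  have h2 : ∀ {a : G}, IsInvolution a → (ConjClasses.mk a).carrier = {g | IsInvolution g} :=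
    fun {a} ha => key fun b => ⟨fun h => by
      obtain ⟨c, rfl⟩ := isConj_iff.1 h
      exact (isInvolution_conj c).2 ha, hG.isConj_of_isInvolution ha⟩
  have h3 : ∀ {a : G}, IsTranslation a → (ConjClasses.mk a).carrier = {g | IsTranslation g} :=
    fun {a} ha => key fun b => ⟨fun h => by
      obtain ⟨c, rfl⟩ := isConj_iff.1 h
      exact ha.conj c, hG.isConj_of_isTranslation ha⟩
  have h4 : ∀ {a : G}, IsHomothety a → (ConjClasses.mk a).carrier = {g | IsHomothety g} :=
    fun {a} ha => key fun b => ⟨fun h => by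
      obtain ⟨c, rfl⟩ := isConj_iff.1 h
      exact ha.conj c, hG.isConj_of_isHomothety ha⟩
  obtain ⟨x, y, hxy, -⟩ := hG.classC'.1.exists_typeDQ
  apply Set.Subset.antisymm
  · rintro _ ⟨c, rfl⟩
    obtain ⟨a, rfl⟩ := ConjClasses.exists_rep c
    rcases hG.cases a with rfl | h | h | h
    · exact .inl h1
    · exact .inr (.inl (h2 h))
    · exact .inr (.inr (.inl (h3 h)))
    · exact .inr (.inr (.inr (h4 h)))
  · rintro _ (rfl | rfl | rfl | rfl)
    exacts [⟨_, h1⟩, ⟨_, h2 hxy.1⟩, ⟨_, h3 (hG.isTranslation_mul hxy)⟩, ⟨_, h4 hs⟩]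

theorem card_conjClasses {s : G} (hs : IsHomothety s) : Nat.card (ConjClasses G) = 4 := by
  obtain ⟨x, y, hxy, -⟩ := hG.classC'.1.exists_typeDQ
  have ht := hG.isTranslation_mul hxy
  have hinj : Function.Injective (ConjClasses.carrier : ConjClasses G → Set G) := by
    intro c d h
    obtain ⟨a, rfl⟩ := ConjClasses.exists_rep c
    have h1 : a ∈ (ConjClasses.mk a).carrier := ConjClasses.mem_carrier_mk
    exact ConjClasses.mem_carrier_iff_mk_eq.1 (h ▸ h1)
  have h1 : ¬ IsInvolution (1 : G) := fun h => h.ne_one rfl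
  have h2 : ¬ IsTranslation (1 : G) := fun h => h.1 IsOfFinOrder.one
  have h3 : ¬ IsHomothety (1 : G) := fun h => h.1 IsOfFinOrder.one
  have h4 : ¬ IsTranslation x := fun h => h.1 hxy.1.isOfFinOrder
  have h5 : ¬ IsHomothety x := fun h => h.1 hxy.1.isOfFinOrder
  have h6 := hG.classC'.1.not_isHomothety_of_isTranslation ht
  have mem : ∀ {P Q : G → Prop} (a : G), P a → ¬ Q a → {g | P g} ≠ {g | Q g} :=
    fun a hP hQ h => hQ ((Set.ext_iff.1 h a).1 hP)
  rw [← Nat.card_range_of_injective hinj, Nat.card_coe_set_eq, hG.range_carrier hs,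
    Set.ncard_insert_of_notMem, Set.ncard_insert_of_notMem, Set.ncard_pair]
  · exact mem _ ht h6
  · rintro (h | h)
    exacts [mem x hxy.1 h4 h, mem x hxy.1 h5 h]
  · rintro (h | h | h)
    exacts [mem (P := (· = 1)) 1 rfl h1 h, mem (P := (· = 1)) 1 rfl h2 h,
      mem (P := (· = 1)) 1 rfl h3 h]

/-- A nontrivial normal subgroup contains a commutator of an involution with one of its elements
which is a translation. If moreover some homothety is a product of two translations, the subgroup
contains all homotheties, and hence all involutions, since the product of a homothety and its
central involution is a homothety. -/
theorem isSimpleGroup {s r : G} (hs : IsHomothety s) (hr : IsTranslation r)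
    (hsr : IsTranslation (s * r)) : IsSimpleGroup G := by
  obtain ⟨x, y, hxy, -⟩ := hG.classC'.1.exists_typeDQ
  have : Nontrivial G := ⟨x, y, hxy.2.2⟩
  refine ⟨fun N hN => or_iff_not_imp_left.2 fun hbot => ?_⟩
  have hmem : ∀ {a b : G}, IsConj a b → a ∈ N → b ∈ N := fun h ha => by
    obtain ⟨c, rfl⟩ := isConj_iff.1 h
    exact hN.conj_mem _ ha c
  obtain ⟨n, hn, hn1⟩ := (Subgroup.bot_or_exists_ne_one N).resolve_left hbot
  -- an involution which does not commute with `n`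
  obtain ⟨u, hu, hnu⟩ : ∃ u, IsInvolution u ∧ n * u ≠ u * n := by
    by_contra! h
    exact hxy.2.2 (hG.classC'.1.involution_unique hn1 hxy.1 hxy.2.1 (h x hxy.1) (h y hxy.2.1))
  -- the commutator `n * u * n⁻¹ * u` is a product of two distinct involutions
  have htr : IsTranslation (n * u * n⁻¹ * u) := hG.isTranslation_mul
    ⟨(isInvolution_conj n).2 hu, hu, fun h => hnu (mul_inv_eq_iff_eq_mul.1 h)⟩
  have htrN : n * u * n⁻¹ * u ∈ N := by
    have h1 := N.mul_mem hn (hN.conj_mem _ (N.inv_mem hn) u)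
    rwa [hu.inv, ← mul_assoc, ← mul_assoc] at h1
  have hT : ∀ {τ : G}, IsTranslation τ → τ ∈ N := fun hτ =>
    hmem (hG.isConj_of_isTranslation htr hτ) htrN
  -- `s = (s * r) * r⁻¹`
  have hsN : s ∈ N := by
    have h1 := N.mul_mem (hT hsr) (N.inv_mem (hT hr))
    rwa [mul_inv_cancel_right] at h1
  have hH : ∀ {h : G}, IsHomothety h → h ∈ N := fun hh => hmem (hG.isConj_of_isHomothety hs hh) hsN
  obtain ⟨hsf, w, hw, hc⟩ := hs
  have hsw : IsHomothety (s * w) := by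
    refine ⟨fun h => hsf ?_, w, hw, by rw [hc, mul_assoc, hc]⟩
    have h1 : (s * w) * w = s := by rw [mul_assoc, hw.mul_self, mul_one]
    rw [← h1]
    exact Commute.isOfFinOrder_mul (show s * w * w = w * (s * w) by rw [hc, mul_assoc, hc]) h
      hw.isOfFinOrder
  have hwN : w ∈ N := by
    have h1 := N.mul_mem (N.inv_mem hsN) (hH hsw)
    rwa [inv_mul_cancel_left] at h1
  refine (Subgroup.eq_top_iff' N).2 fun g => ?_
  rcases hG.cases g with rfl | h | h | h
  exacts [N.one_mem, hmem (hG.isConj_of_isInvolution hw h) hwN, hT h, hH h]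

end Saturated

end SharpTwo

theorem mainTheorem6 (G₀ : Type u) [Group G₀] [Countable G₀] (hG₀ : SharpTwo.ClassC' G₀) :
    ∃ (G : Type u) (_ : Group G),
      Countable G ∧
      (∃ f : G₀ →* G, Function.Injective f) ∧
      SharpTwo.IsSharplyTwoTransitive G ∧
      SharpTwo.ClassC' G ∧
      Nat.card (ConjClasses G) = 4 ∧
      Set.range (ConjClasses.carrier : ConjClasses G → Set G) =
        {{1}, {g : G | SharpTwo.IsInvolution g}, {g : G | SharpTwo.IsTranslation g},
          {g : G | SharpTwo.IsHomothety g}} ∧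
      IsSimpleGroup G := by
  obtain ⟨H, _, _, hH, f, hf, s, r, hs, hr, hsr⟩ := SharpTwo.exists_extension_isHomothety hG₀
  obtain ⟨G, _, hcount, hG, k, hk⟩ := SharpTwo.exists_saturated hH
  exact ⟨G, _, hcount, ⟨k.comp f, hk.comp hf⟩, hG.isSharplyTwoTransitive, hG.classC',
    hG.card_conjClasses (hs.map hk), hG.range_carrier (hs.map hk),
    hG.isSimpleGroup (hs.map hk) (hr.map hk) (by rw [← map_mul]; exact hsr.map hk)⟩
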